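/- **Planar webs.** Let $n\ge 1$. A planar $n$-web $\Gamma$ is a surface in $\mathbb R^2=\mathbb C$, oriented by the plane, composed of finitely many smoothly embedded closed discs, bands $[0,1]\times[0,1]$ and directed annuli $S^1\times[0,1]$. The discs, the annuli and the interiors $[0,1]\times(0,1)$ of the bands are pairwise disjoint. The sources $[0,1]\times\{0\}$ and targets $[0,1]\times\{1\}$ of the bands are pairwise disjoint and lie in the boundaries of the discs. The boundary of each disc contains either exactly $n$ sources and no target (the disc is a *source*) or exactly $n$ targets and no source (a *sink*), and it carries a marked point away from them. The $n$ bands at a disc are numbered $1,\dots,n$ in the order in which they are met from the marked point, counter-clockwise around a source and clockwise around a sink. **The bracket.** Deform $\Gamma$ by a smooth isotopy of the plane so that it can be cut into pieces: at each source the marked point is at the top and all bands leave downwards; at each sink the marked point is at the bottom and all bands arrive downwards; and the rest of the bands and the annuli consist of downward strands, upward strands, caps and cups. Let $V$ be the free module over $\mathbb Z[q^{\pm 1/n}]$ with basis $e_1,\dots,e_n$ and dual basis $e^1,\dots,e^n$. Assign to downward and upward strands $\mathrm{Id}_V$ and $\mathrm{Id}_{V^*}$. Assign to caps directed to the right $e^i\otimes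 e_j\mapsto\delta_{ij}$; to caps directed to the left $e_i\otimes e^j\mapsto q^{2i-n-1}\delta_{ij}$; to cups directed to the right $1\mapsto\sum_i e_i\otimes e^i$; to cups directed to the left $1\mapsto\sum_i q^{n+1-2i}e^i\otimes e_i$. Assign to sinks $1\mapsto\sum_{\sigma\in S_n}(-q)^{l(\sigma)}e_{\sigma(1)}\otimes\dots\otimes e_{\sigma(n)}$, and to sources the map $V^{\otimes n}\to\mathbb Z[q^{\pm1/n}]$ sending $e_{i_1}\otimes\dots\otimes e_{i_n}$ to $(-q)^{l(\sigma)}$ if $k\mapsto i_k$ is a permutation $\sigma$, and to $0$ otherwise. Here $l(\sigma)=\#\{i<j:\sigma(i)>\sigma(j)\}$. The bracket $\langle\Gamma\rangle_n\in\mathbb Z[q^{\pm1/n}]$ is the scalar obtained by contracting the tensors of all pieces. **States and rotation index.** A state $S$ of $\Gamma$ is a labeling of its bands and annuli by elements of $\{1,\dots,n\}$ such that the bands attached to each disc have different labels; $P(S,v)\in S_n$ is the permutation sending $i$ to the label of the $i$-th band at the disc $v$. A core of $\Gamma$ consists of a smooth embedded arc $\alpha_b:[0,1]\to\mathbb C$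 for each band $b$, running from the marked point of the source disc of $b$ to the marked point of its sink disc inside the union of $b$ and these two discs, such that different arcs meet at most in endpoints and the tangent vectors of all arcs at a given marked point have the same direction. Given a core, put $\mathrm{ind}(b)=\mathrm{Re}\bigl(\frac1{2\pi i}\int_0^1\frac{\alpha_b''(t)}{\alpha_b'(t)}\,dt\bigr)$ for a band $b$, put $\mathrm{ind}(a)=+1$ or $-1$ for an annulus $a$ directed anti-clockwise or clockwise, and let $$\mathrm{rot}_n(S)=\sum_e \mathrm{ind}(e)\,(2S(e)-n-1),$$ the sum being over all bands and annuli $e$. **Theorem.** Let $\Gamma$ be a planar $n$-web. For every core of $\Gamma$ and every state $S$ the number $\mathrm{rot}_n(S)$ is an integer, and, whichever core and whichever decomposition into pieces are used, $$\langle\Gamma\rangle_n=\sum_S q^{\mathrm{rot}_n(S)}\prod_v(-q)^{l(P(S,v))},$$ where the sum is over all states $S$ of $\Gamma$ and the product is over all discs $v$ of $\Gamma$. -/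

import Mathlib

open scoped ContDiff

/-! ### The ground ring, permutations -/

/-- The power `q ^ k` in `ℤ[q^{±1/n}]`. This ring is the ring of Laurent polynomials in the
variable `T = q^{1/n}`, so that `q ^ k = T ^ (n * k)`. -/
noncomputable def qpow (n : ℕ) (k : ℤ) : LaurentPolynomial ℤ :=
  LaurentPolynomial.T ((n : ℤ) * k)

/-- The length of a permutation: the number of pairs `i < j` with `σ i > σ j`. -/
def permLength {n : ℕ} (σ : Equiv.Perm (Fin n)) : ℕ :=
  (Finset.univ.filter fun p : Fin n × Fin n => p.1 < p.2 ∧ σ p.2 < σ p.1).card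

/-- The integer `2 i - n - 1`, where `i ∈ {1, …, n}` is the label represented by an element
of `Fin n` (label `i` is the element with value `i - 1`). -/
def labelWeight {n : ℕ} (i : Fin n) : ℤ := 2 * ((i : ℤ) + 1) - n - 1

/-! ### Planar webs -/

/-- The standard closed annulus, with core circle `‖z‖ = 3 / 2`. -/
def stdAnnulus : Set ℂ := {z | 1 ≤ ‖z‖ ∧ ‖z‖ ≤ 2}

/-- A planar `n`-web: a surface in the plane `ℂ` composed of discs (indexed by `V`), bands
(indexed by `B`) and annuli (indexed by `A`), all smoothly embedded. Its orientation as a surface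
is that of the plane. -/
structure PlanarWeb (n : ℕ) (V B A : Type*) where
  /-- the discs are of two kinds, sources and sinks -/
  isSource : V → Prop
  /-- the disc containing the source of a band -/
  src : B → V
  /-- the disc containing the target of a band -/
  tgt : B → V
  /-- an embedding of the closed unit disc; the image of `1` is the marked boundary point -/
  disc : V → ℂ → ℂ
  /-- an embedding of the square; its source is the image of `[0,1] × {0}`, its target that of
  `[0,1] × {1}` -/
  band : B → ℝ × ℝ → ℂ
  /-- an embedding of the standard annulus; the direction of the annulus is the image of the
  anti-clockwise direction of the standard one -/
  annulus : A → ℂ → ℂ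
  /-- the canonical ordering of the bands attached to a disc -/
  bandAt : V → Fin n → B
  disc_smooth : ∀ v, ContDiff ℝ ∞ (disc v)
  disc_injOn : ∀ v, Set.InjOn (disc v) (Metric.closedBall 0 1)
  disc_det_pos : ∀ v, ∀ z ∈ Metric.closedBall (0 : ℂ) 1, 0 < (fderiv ℝ (disc v) z).det
  band_smooth : ∀ b, ContDiff ℝ ∞ (band b)
  band_injOn : ∀ b, Set.InjOn (band b) (Set.Icc 0 1 ×ˢ Set.Icc 0 1)
  band_immersion : ∀ b, ∀ x ∈ (Set.Icc 0 1 ×ˢ Set.Icc 0 1 : Set (ℝ × ℝ)),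
    Function.Injective (fderiv ℝ (band b) x)
  annulus_smooth : ∀ a, ContDiff ℝ ∞ (annulus a)
  annulus_injOn : ∀ a, Set.InjOn (annulus a) stdAnnulus
  annulus_immersion : ∀ a, ∀ z ∈ stdAnnulus, Function.Injective (fderiv ℝ (annulus a) z)
  /-- the discs, the interiors of the bands and the annuli are disjoint from each other -/
  pieces_disjoint : Pairwise fun x y : V ⊕ B ⊕ A =>
    let piece : V ⊕ B ⊕ A → Set ℂ := Sum.elim (fun v => disc v '' Metric.closedBall 0 1)
      (Sum.elim (fun b => band b '' (Set.Icc 0 1 ×ˢ Set.Ioo 0 1)) (fun a => annulus a '' stdAnnulus))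
    Disjoint (piece x) (piece y)
  /-- the sources and the targets of the bands are disjoint from each other -/
  ends_disjoint : Pairwise fun x y : B ⊕ B =>
    let bandEnd : B ⊕ B → Set ℂ := Sum.elim (fun b => band b '' (Set.Icc 0 1 ×ˢ {0}))
      (fun b => band b '' (Set.Icc 0 1 ×ˢ {1}))
    Disjoint (bandEnd x) (bandEnd y)
  /-- the source of a band lies in the boundary of a source disc -/
  src_isSource : ∀ b, isSource (src b)
  src_attached : ∀ b, band b '' (Set.Icc 0 1 ×ˢ {0}) ⊆ disc (src b) '' Metric.sphere 0 1
  /-- the target of a band lies in the boundary of a sink disc -/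
  tgt_isSink : ∀ b, ¬ isSource (tgt b)
  tgt_attached : ∀ b, band b '' (Set.Icc 0 1 ×ˢ {1}) ⊆ disc (tgt b) '' Metric.sphere 0 1
  /-- the marked points lie outside the sources and targets of the bands -/
  mark_notMem_src : ∀ v b, disc v 1 ∉ band b '' (Set.Icc 0 1 ×ˢ {0})
  mark_notMem_tgt : ∀ v b, disc v 1 ∉ band b '' (Set.Icc 0 1 ×ˢ {1})
  /-- the bands attached to a source disc are exactly the `bandAt v i` -/
  source_valence : ∀ v, isSource v → ∀ b, src b = v ↔ b ∈ Set.range (bandAt v)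
  /-- … and these are pairwise distinct and numbered in the order in which they are met when one
  starts at the marked point and moves counter-clockwise around the boundary of the disc -/
  source_order : ∀ v, isSource v → ∃ θ : Fin n → ℝ, StrictMono θ ∧
    (∀ i, θ i ∈ Set.Ioo 0 (2 * Real.pi)) ∧
    ∀ i, disc v (Complex.exp (θ i * Complex.I)) = band (bandAt v i) (1 / 2, 0)
  /-- the bands attached to a sink disc are exactly the `bandAt v i` -/
  sink_valence : ∀ v, ¬ isSource v → ∀ b, tgt b = v ↔ b ∈ Set.range (bandAt v)
  /-- … and these are pairwise distinct and numbered in the order in which they are met when one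
  starts at the marked point and moves clockwise around the boundary of the disc -/
  sink_order : ∀ v, ¬ isSource v → ∃ θ : Fin n → ℝ, StrictAnti θ ∧
    (∀ i, θ i ∈ Set.Ioo 0 (2 * Real.pi)) ∧
    ∀ i, disc v (Complex.exp (θ i * Complex.I)) = band (bandAt v i) (1 / 2, 1)

namespace PlanarWeb

variable {n : ℕ} {V B A : Type*}

/-- The directed core circle of an annulus, as a `1`-periodic curve. -/
noncomputable def loop (Γ : PlanarWeb n V B A) (a : A) (t : ℝ) : ℂ :=
  Γ.annulus a (3 / 2 * Complex.exp (2 * Real.pi * t * Complex.I))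

/-- An annulus is oriented anti-clockwise if its directed core circle winds once in the positive
sense around some point. -/
def IsAnticlockwise (Γ : PlanarWeb n V B A) (a : A) : Prop :=
  ∃ w : ℂ, w ∉ Set.range (Γ.loop a) ∧
    (2 * Real.pi * Complex.I)⁻¹ * ∫ t in (0 : ℝ)..1, deriv (Γ.loop a) t / (Γ.loop a t - w) = 1

/-- The index of an annulus. -/
noncomputable def annulusInd (Γ : PlanarWeb n V B A) (a : A) : ℝ :=
  open Classical in if Γ.IsAnticlockwise a then 1 else -1

/-! ### Cores and states -/

/-- A core of a planar web. For each band it contains a smooth embedded arc from the marked point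
of the source of the band to the marked point of its sink. -/
structure Core (Γ : PlanarWeb n V B A) where
  arc : B → ℝ → ℂ
  smooth : ∀ b, ContDiff ℝ ∞ (arc b)
  immersion : ∀ b, ∀ t ∈ Set.Icc (0 : ℝ) 1, deriv (arc b) t ≠ 0
  injOn : ∀ b, Set.InjOn (arc b) (Set.Icc 0 1)
  start : ∀ b, arc b 0 = Γ.disc (Γ.src b) 1
  finish : ∀ b, arc b 1 = Γ.disc (Γ.tgt b) 1
  mem : ∀ b, ∀ t ∈ Set.Icc (0 : ℝ) 1, arc b t ∈
    Γ.band b '' (Set.Icc 0 1 ×ˢ Set.Icc 0 1) ∪ Γ.disc (Γ.src b) '' Metric.closedBall 0 1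
      ∪ Γ.disc (Γ.tgt b) '' Metric.closedBall 0 1
  /-- different arcs can only meet at their endpoints -/
  disjoint : ∀ b b', b ≠ b' → ∀ s ∈ Set.Icc (0 : ℝ) 1, ∀ t ∈ Set.Icc (0 : ℝ) 1,
    arc b s = arc b' t → (s = 0 ∨ s = 1) ∧ (t = 0 ∨ t = 1)
  /-- the tangent vectors of all the arcs at a vertex have the same direction -/
  tangent_src : ∀ b b', Γ.src b = Γ.src b' → SameRay ℝ (deriv (arc b) 0) (deriv (arc b') 0)
  tangent_tgt : ∀ b b', Γ.tgt b = Γ.tgt b' → SameRay ℝ (deriv (arc b) 1) (deriv (arc b') 1)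

/-- The winding number `(2πi)⁻¹ ∫ α'' / α'` of the arc of a core in a band. The real part only
removes the contribution `log |α'(1)| - log |α'(0)|` of the speed of the parametrization. -/
noncomputable def Core.ind {Γ : PlanarWeb n V B A} (C : Γ.Core) (b : B) : ℝ :=
  ((2 * Real.pi * Complex.I)⁻¹ *
    ∫ t in (0 : ℝ)..1, deriv (deriv (C.arc b)) t / deriv (C.arc b) t).re

/-- The states of a planar web: the labelings of its bands and annuli such that the bands attached
to any disc have different labels. -/
def State (Γ : PlanarWeb n V B A) : Type _ :=
  {S : B ⊕ A → Fin n // ∀ v, Function.Injective fun i => S (Sum.inl (Γ.bandAt v i))}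

noncomputable instance [Fintype B] [Fintype A] (Γ : PlanarWeb n V B A) : Fintype Γ.State :=
  open Classical in inferInstanceAs (Fintype
    {S : B ⊕ A → Fin n // ∀ v, Function.Injective fun i => S (Sum.inl (Γ.bandAt v i))})

/-- The label of a band or an annulus in a state. -/
def State.label {Γ : PlanarWeb n V B A} (S : Γ.State) (e : B ⊕ A) : Fin n := S.1 e

/-- The permutation `P(S,v)`: it sends `i` to the label of the `i`-th band attached to `v`. -/
noncomputable def State.perm {Γ : PlanarWeb n V B A} (S : Γ.State) (v : V) : Equiv.Perm (Fin n) :=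
  Equiv.ofBijective (fun i => S.label (Sum.inl (Γ.bandAt v i)))
    (Finite.injective_iff_bijective.1 (S.2 v))

/-- The rotation index of a state, computed with a core. -/
noncomputable def Core.rot [Fintype B] [Fintype A] {Γ : PlanarWeb n V B A} (C : Γ.Core)
    (S : Γ.State) : ℝ :=
  ∑ b : B, C.ind b * labelWeight (S.label (Sum.inl b)) +
    ∑ a : A, Γ.annulusInd a * labelWeight (S.label (Sum.inr a))

/-! ### Isotopies -/

/-- `Γ₀` is the image of `Γ` under a smooth ambient isotopy of the plane. -/
def IsIsotopic (Γ Γ₀ : PlanarWeb n V B A) : Prop :=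
  ∃ Φ : ℝ → ℂ → ℂ, ContDiff ℝ ∞ (fun p : ℝ × ℂ => Φ p.1 p.2) ∧
    (∀ t ∈ Set.Icc (0 : ℝ) 1, Function.Bijective (Φ t) ∧ ∀ z, (fderiv ℝ (Φ t) z).det ≠ 0) ∧
    (∀ z, Φ 0 z = z) ∧
    (∀ v, Γ₀.isSource v ↔ Γ.isSource v) ∧ Γ₀.src = Γ.src ∧ Γ₀.tgt = Γ.tgt ∧
    (∀ v, Set.EqOn (Γ₀.disc v) (Φ 1 ∘ Γ.disc v) (Metric.closedBall 0 1)) ∧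
    (∀ b, Set.EqOn (Γ₀.band b) (Φ 1 ∘ Γ.band b) (Set.Icc 0 1 ×ˢ Set.Icc 0 1)) ∧
    ∀ a, Set.EqOn (Γ₀.annulus a) (Φ 1 ∘ Γ.annulus a) stdAnnulus

end PlanarWeb

/-! ### The bracket: decompositions into pieces and contraction of tensors -/

/-- The pieces into which the bands and annuli are cut: strands directed down (identity of the
module `V`) or up (identity of `V*`), caps and cups. A cap or cup is traversed to the right or
to the left. -/
inductive WebPiece
  | down
  | up
  | capRight
  | capLeft
  | cupRight
  | cupLeft

/-- The part of the directed curve `α` between the times `s` and `t` is a piece of the given kind.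
The vertical direction is the imaginary one. A cap has a single horizontal tangent, at its maximum,
and a cup has a single one, at its minimum. -/
def WebPiece.Fits (α : ℝ → ℂ) (s t : ℝ) : WebPiece → Prop
  | .down => ∀ u ∈ Set.Icc s t, (deriv α u).im < 0
  | .up => ∀ u ∈ Set.Icc s t, 0 < (deriv α u).im
  | .capRight => ∃ c ∈ Set.Ioo s t, (∀ u ∈ Set.Ico s c, 0 < (deriv α u).im) ∧
      (deriv α c).im = 0 ∧ 0 < (deriv α c).re ∧ ∀ u ∈ Set.Ioc c t, (deriv α u).im < 0
  | .capLeft => ∃ c ∈ Set.Ioo s t, (∀ u ∈ Set.Ico s c, 0 < (deriv α u).im) ∧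
      (deriv α c).im = 0 ∧ (deriv α c).re < 0 ∧ ∀ u ∈ Set.Ioc c t, (deriv α u).im < 0
  | .cupRight => ∃ c ∈ Set.Ioo s t, (∀ u ∈ Set.Ico s c, (deriv α u).im < 0) ∧
      (deriv α c).im = 0 ∧ 0 < (deriv α c).re ∧ ∀ u ∈ Set.Ioc c t, 0 < (deriv α u).im
  | .cupLeft => ∃ c ∈ Set.Ioo s t, (∀ u ∈ Set.Ico s c, (deriv α u).im < 0) ∧
      (deriv α c).im = 0 ∧ (deriv α c).re < 0 ∧ ∀ u ∈ Set.Ioc c t, 0 < (deriv α u).im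

/-- The curve `α` between the times `s` and `t` is cut into the listed pieces, one after
the other. -/
inductive CutInto (α : ℝ → ℂ) : ℝ → ℝ → List WebPiece → Prop
  | nil (t : ℝ) : CutInto α t t []
  | cons {s t u : ℝ} {p : WebPiece} {l : List WebPiece} (hst : s < t) (hp : p.Fits α s t)
      (hl : CutInto α t u l) : CutInto α s u (p :: l)

/-- The tensor of a piece with respect to the basis `e_1, …, e_n` of `V` and the dual basis of
`V*`. Its two indices are those at the beginning and at the end of the directed piece. The strands
give identities, and
* the cap to the right gives `V* ⊗ V → R`, `e^i ⊗ e_j ↦ δ_ij`;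
* the cap to the left gives `V ⊗ V* → R`, `e_i ⊗ e^j ↦ q^{2i-n-1} δ_ij`;
* the cup to the right gives `R → V ⊗ V*`, `1 ↦ ∑ e_i ⊗ e^i`;
* the cup to the left gives `R → V* ⊗ V`, `1 ↦ ∑ q^{n+1-2i} e^i ⊗ e_i`. -/
noncomputable def WebPiece.tensor (n : ℕ) :
    WebPiece → Matrix (Fin n) (Fin n) (LaurentPolynomial ℤ)
  | .down => 1
  | .up => 1
  | .capRight => 1
  | .capLeft => Matrix.diagonal fun i => qpow n (labelWeight i)
  | .cupRight => 1
  | .cupLeft => Matrix.diagonal fun i => qpow n (-labelWeight i)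

/-- The components of the tensors of a source, `V^{⊗ n} → R`, and of a sink, `R → V^{⊗ n}`, at
the basis vector `e_{f 1} ⊗ … ⊗ e_{f n}`. -/
noncomputable def vertexTensor {n : ℕ} (f : Fin n → Fin n) : LaurentPolynomial ℤ :=
  open Classical in
  if h : Function.Bijective f then (-qpow n 1) ^ permLength (Equiv.ofBijective f h) else 0

namespace PlanarWeb

variable {n : ℕ} {V B A : Type*}

/-- A decomposition of a planar web into pieces: every band (followed along an arc of a core) and
every annulus is cut into strands, caps and cups, and at every disc the marked point is
at the top for a source, with all the bands leaving downwards, and at the bottom for a sink, with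
all the bands arriving downwards. The order from left to right of the bands at a disc is then
the canonical one. -/
structure Decomposition (Γ : PlanarWeb n V B A) where
  core : Γ.Core
  src_down : ∀ b, (deriv (core.arc b) 0).im < 0
  tgt_down : ∀ b, (deriv (core.arc b) 1).im < 0
  bandPieces : B → List WebPiece
  band_cut : ∀ b, CutInto (core.arc b) 0 1 (bandPieces b)
  annulusStart : A → ℝ
  annulusPieces : A → List WebPiece
  annulus_cut : ∀ a, CutInto (Γ.loop a) (annulusStart a) (annulusStart a + 1) (annulusPieces a)

/-- The scalar obtained by contracting the tensors of all the pieces of a decomposition. Contraction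
along the cuts inside a band gives the product of the tensors of its pieces, with an
index at its source and one at its sink, and contraction along the cuts of an annulus gives the
trace of such a product. The indices `x b` and `y b` at the sources and at the sinks of the bands
are contracted with the tensors of the discs. -/
noncomputable def Decomposition.contraction [Fintype V] [Fintype B] [Fintype A]
    {Γ : PlanarWeb n V B A} (D : Γ.Decomposition) : LaurentPolynomial ℤ :=
  open Classical in
  ∑ x : B → Fin n, ∑ y : B → Fin n,
    (∏ b : B, ((D.bandPieces b).map (WebPiece.tensor n)).prod (x b) (y b)) *
      (∏ a : A, (((D.annulusPieces a).map (WebPiece.tensor n)).prod).trace) *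
      ∏ v : V, if Γ.isSource v then vertexTensor fun i => x (Γ.bandAt v i)
        else vertexTensor fun i => y (Γ.bandAt v i)

/-- `x` is the value `⟨Γ⟩_n` of the bracket: it is the contraction of the tensors of a decomposition
into pieces of `Γ`, where `Γ` may first be deformed by an isotopy of the plane. -/
def IsBracket [Fintype V] [Fintype B] [Fintype A] (Γ : PlanarWeb n V B A)
    (x : LaurentPolynomial ℤ) : Prop :=
  ∃ Γ₀ : PlanarWeb n V B A, Γ.IsIsotopic Γ₀ ∧ ∃ D : Γ₀.Decomposition, D.contraction = x

end PlanarWeb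

/-! Algebra. Every piece has a diagonal tensor, and only caps and cups traversed to the left carry a
power of `q`. The contraction therefore collapses to a sum over labelings, the tensors of the discs
kill all labelings that are not states, and the exponent of `q` is the sum of (left caps minus left
cups) times `2S(e) - n - 1` over all bands and annuli `e` (`Decomposition.contraction_eq_sum`). It
remains to identify this integer with the rotation index.

Turning. Angles are measured by `logVar`, the variation of a continuous logarithm. Along a curve cut
into pieces, the tangent turns by `2π` (left caps minus left cups) plus the difference of the
principal arguments at the two ends (`CutInto.logVar_deriv`). For a band these arguments depend only
on the two discs, since all arcs leave or reach a marked point in one direction. The labels at a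
disc are `1, …, n`, each used once, and their weights `2i - n - 1` add up to `0`, so any quantity
attached to the discs drops out (`State.sum_eq_of_sub_eq`). This cancellation is used three times:
for the end arguments of a decomposition, for the change of core, and for the isotopy.

Change of core. By Hopf's secant argument the turning of an embedded arc is that of its secants from
the initial point plus that of its secants to the final point. These secants are governed by a
logarithm of `z - p` on the union of the band and its two discs with the marked point `p` removed;
that logarithm ignores the core, and only the tangent directions at the ends remain
(`exists_logVar_core_eq`).

Isotopy. A core is pushed forward, and each turning changes by the rotation of the end tangents
during the isotopy, which again is attached to the discs (`IsIsotopic.exists_core`).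

Annuli. The turning of a simple closed curve is `±2π`. It is also the sum of the windings of the
core circle around a point of each boundary circle (`logVar_deriv_polarMap`), and one of these is
`0`. Hence the sign of the turning is the one that decides the index of the annulus. -/

/-! ### Continuous logarithms -/

/-- `H` is a continuous logarithm of `f` on `s`. -/
structure IsLogOn {X : Type*} [TopologicalSpace X] (H f : X → ℂ) (s : Set X) : Prop where
  cont : ContinuousOn H s
  exp_eq : ∀ x ∈ s, Complex.exp (H x) = f x

namespace IsLogOn

variable {X Y : Type*} [TopologicalSpace X] [TopologicalSpace Y] {H H' f g : X → ℂ} {s t : Set X}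

theorem mono (h : IsLogOn H f s) (hts : t ⊆ s) : IsLogOn H f t :=
  ⟨h.cont.mono hts, fun x hx => h.exp_eq x (hts hx)⟩

theorem congr (h : IsLogOn H f s) (hfg : ∀ x ∈ s, f x = g x) : IsLogOn H g s :=
  ⟨h.cont, fun x hx => (h.exp_eq x hx).trans (hfg x hx)⟩

theorem comp (h : IsLogOn H f s) {φ : Y → X} {u : Set Y} (hφ : ContinuousOn φ u)
    (hu : Set.MapsTo φ u s) : IsLogOn (H ∘ φ) (f ∘ φ) u :=
  ⟨h.cont.comp hφ hu, fun _ hy => h.exp_eq _ (hu hy)⟩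

theorem mul (h : IsLogOn H f s) (h' : IsLogOn H' g s) :
    IsLogOn (fun x => H x + H' x) (fun x => f x * g x) s :=
  ⟨h.cont.add h'.cont, fun x hx => by rw [Complex.exp_add, h.exp_eq x hx, h'.exp_eq x hx]⟩

theorem neg (h : IsLogOn H f s) : IsLogOn (fun x => -H x) (fun x => (f x)⁻¹) s :=
  ⟨h.cont.neg, fun x hx => by rw [Complex.exp_neg, h.exp_eq x hx]⟩

theorem const {c : ℂ} (hc : c ≠ 0) : IsLogOn (fun _ : X => Complex.log c) (fun _ => c) s :=
  ⟨continuousOn_const, fun _ _ => Complex.exp_log hc⟩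

theorem principal (hf : ContinuousOn f s) (hs : ∀ x ∈ s, f x ∈ Complex.slitPlane) :
    IsLogOn (fun x => Complex.log (f x)) f s :=
  ⟨hf.clog hs, fun x hx => Complex.exp_log (Complex.slitPlane_ne_zero (hs x hx))⟩

theorem ne_zero (h : IsLogOn H f s) {x : X} (hx : x ∈ s) : f x ≠ 0 := by
  rw [← h.exp_eq x hx]; exact Complex.exp_ne_zero _

/-- A continuous logarithm of `1` on a connected set is constant. -/
theorem eq_of_one (hs : IsPreconnected s) (h : IsLogOn H (fun _ => 1) s) {x y : X} (hx : x ∈ s)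
    (hy : y ∈ s) : H x = H y := by
  have key : ∀ z ∈ s, ∃ n : ℤ, H z = n * (2 * Real.pi * Complex.I) := fun z hz =>
    Complex.exp_eq_one_iff.1 (h.exp_eq z hz)
  -- `H / (2πi)` takes integer values, and a continuous map from a connected set to the discrete set
  -- of integers is constant.
  have hc : ContinuousOn (fun z => (H z / (2 * Real.pi * Complex.I)).re) s :=
    Complex.continuous_re.comp_continuousOn (h.cont.div_const _)
  have hm : Set.MapsTo (fun z => (H z / (2 * Real.pi * Complex.I)).re) s
      (Set.range ((↑) : ℤ → ℝ)) := by
    intro z hz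
    obtain ⟨n, hn⟩ := key z hz
    refine ⟨n, ?_⟩
    simp only [hn]
    rw [mul_div_cancel_right₀ _ Complex.two_pi_I_ne_zero]
    simp
  have hcn := hs.constant_of_mapsTo (T := Set.range ((↑) : ℤ → ℝ))
    (Set.image_univ ▸ IsDiscrete.univ.image Int.isClosedEmbedding_coe_real.isInducing) hc hm hx hy
  obtain ⟨n, hn⟩ := key x hx
  obtain ⟨m, hm⟩ := key y hy
  simp only [hn, hm] at hcn ⊢
  rw [mul_div_cancel_right₀ _ Complex.two_pi_I_ne_zero,
    mul_div_cancel_right₀ _ Complex.two_pi_I_ne_zero] at hcn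
  have : (n : ℝ) = m := by simpa using hcn
  rw [Int.cast_inj.1 this]

/-- Two continuous logarithms of a function on a connected set differ by a constant. -/
theorem sub_eq (hs : IsPreconnected s) (h : IsLogOn H f s) (h' : IsLogOn H' f s) {x y : X}
    (hx : x ∈ s) (hy : y ∈ s) : H x - H y = H' x - H' y := by
  have := eq_of_one (H := fun x => H x + -H' x) hs ((h.mul h'.neg).congr fun z hz =>
    mul_inv_cancel₀ (h.ne_zero hz)) hx hy
  linear_combination this

end IsLogOn

/-- Shrinking along rays to the centre is a homotopy from a constant map to `f` through nonvanishing
functions. The constant map has a logarithm, and the covering `exp` lifts the homotopy. -/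
theorem exists_isLogOn_of_starConvex {E : Type*} [AddCommGroup E] [Module ℝ E]
    [TopologicalSpace E] [ContinuousAdd E] [ContinuousSub E] [ContinuousSMul ℝ E] {s : Set E} {x₀ : E}
    (hs : StarConvex ℝ x₀ s) (hx₀ : x₀ ∈ s) {f : E → ℂ} (hf : ContinuousOn f s)
    (h0 : ∀ x ∈ s, f x ≠ 0) : ∃ H, IsLogOn H f s := by
  classical
  have hmem : ∀ (u : unitInterval) (x : s), x₀ + (u : ℝ) • ((x : E) - x₀) ∈ s := by
    intro u x
    have := hs x.2 (a := 1 - u) (b := u) (by linarith [u.2.2]) u.2.1 (by ring)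
    convert this using 1
    rw [smul_sub, sub_smul, one_smul]; abel
  let K : C(unitInterval × s, {z : ℂ // z ≠ 0}) :=
    ⟨fun p => ⟨f (x₀ + (p.1 : ℝ) • ((p.2 : E) - x₀)), h0 _ (hmem _ _)⟩, by
      refine Continuous.subtype_mk ?_ _
      refine hf.comp_continuous ?_ fun p => hmem _ _
      fun_prop⟩
  let k0 : C(s, ℂ) := ⟨fun _ => Complex.log (f x₀), continuous_const⟩
  have hK0 : ∀ a, K (0, a) = (fun z : ℂ => (⟨_, z.exp_ne_zero⟩ : {z : ℂ // z ≠ 0})) (k0 a) := by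
    intro a
    apply Subtype.ext
    simp [K, k0, Complex.exp_log (h0 x₀ hx₀)]
  let L := Complex.isCoveringMap_exp.liftHomotopy K k0 hK0
  have hL := Complex.isCoveringMap_exp.liftHomotopy_lifts K k0 hK0
  have hL' : ∀ x : s, Complex.exp (L (1, x)) = f x := by
    intro x
    have := congrArg Subtype.val (congrFun hL (1, x))
    simpa only [K, Function.comp_apply, ContinuousMap.coe_mk, Set.Icc.coe_one, one_smul,
      add_sub_cancel] using this
  refine ⟨fun x => if h : x ∈ s then L (1, ⟨x, h⟩) else 0, ?_, ?_⟩
  · rw [continuousOn_iff_continuous_domRestrict]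
    have : Set.domRestrict s (fun x => if h : x ∈ s then L (1, ⟨x, h⟩) else 0) =
        fun x : s => L (1, x) := by
      ext x; simp [Set.domRestrict]
    rw [this]
    fun_prop
  · intro x hx
    simp only [hx, dif_pos]
    exact hL' ⟨x, hx⟩

theorem exists_isLogOn_Icc {f : ℝ → ℂ} {a b : ℝ} (hab : a ≤ b) (hf : ContinuousOn f (Set.Icc a b))
    (h0 : ∀ x ∈ Set.Icc a b, f x ≠ 0) : ∃ H, IsLogOn H f (Set.Icc a b) :=
  exists_isLogOn_of_starConvex ((convex_Icc a b).starConvex (Set.left_mem_Icc.2 hab))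
    (Set.left_mem_Icc.2 hab) hf h0

/-- The variation of a continuous logarithm of `f` between `a` and `b`. -/
noncomputable def logVar (f : ℝ → ℂ) (a b : ℝ) : ℂ :=
  open Classical in
  -- The choice of `H` is immaterial because an interval is connected; `0` is a default for
  -- functions without a logarithm.
  if h : ∃ H, IsLogOn H f (Set.Icc a b) then h.choose b - h.choose a else 0

theorem IsLogOn.logVar_eq {f H : ℝ → ℂ} {a b : ℝ} (hab : a ≤ b) (h : IsLogOn H f (Set.Icc a b)) :
    logVar f a b = H b - H a := by
  have hex : ∃ H, IsLogOn H f (Set.Icc a b) := ⟨H, h⟩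
  rw [logVar, dif_pos hex]
  exact hex.choose_spec.sub_eq isPreconnected_Icc h (Set.right_mem_Icc.2 hab)
    (Set.left_mem_Icc.2 hab)

theorem logVar_congr {f g : ℝ → ℂ} {a b : ℝ} (h : Set.EqOn f g (Set.Icc a b)) :
    logVar f a b = logVar g a b := by
  have : ∀ H, IsLogOn H f (Set.Icc a b) ↔ IsLogOn H g (Set.Icc a b) := fun H =>
    ⟨fun k => k.congr h, fun k => k.congr h.symm⟩
  have this' : (fun H => IsLogOn H f (Set.Icc a b)) = fun H => IsLogOn H g (Set.Icc a b) :=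
    funext fun H => propext (this H)
  unfold logVar
  rw [this']

/-- If `f` avoids the closed ray from `0` through `-c`, then rotating by `c` makes the principal
logarithm continuous along `f`. The added constant `log c` cancels. -/
theorem logVar_of_slitPlane {f : ℝ → ℂ} {a b : ℝ} (hab : a ≤ b) {c : ℂ} (hc : c ≠ 0)
    (hf : ContinuousOn f (Set.Icc a b)) (h : ∀ t ∈ Set.Icc a b, f t / c ∈ Complex.slitPlane) :
    logVar f a b = Complex.log (f b / c) - Complex.log (f a / c) := by
  have h1 : IsLogOn (fun t => Complex.log (f t / c) + Complex.log c) f (Set.Icc a b) :=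
    ((IsLogOn.principal (hf.div_const c) h).mul (IsLogOn.const hc)).congr fun x _ => by
      field_simp
  rw [h1.logVar_eq hab]; ring

theorem logVar_mul {f g : ℝ → ℂ} {a b : ℝ} (hab : a ≤ b) (hf : ContinuousOn f (Set.Icc a b))
    (hf0 : ∀ x ∈ Set.Icc a b, f x ≠ 0) (hg : ContinuousOn g (Set.Icc a b))
    (hg0 : ∀ x ∈ Set.Icc a b, g x ≠ 0) :
    logVar (fun t => f t * g t) a b = logVar f a b + logVar g a b := by
  obtain ⟨F, hF⟩ := exists_isLogOn_Icc hab hf hf0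
  obtain ⟨G, hG⟩ := exists_isLogOn_Icc hab hg hg0
  rw [hF.logVar_eq hab, hG.logVar_eq hab, (hF.mul hG).logVar_eq hab]; ring

theorem logVar_const {c : ℂ} {a b : ℝ} (hab : a ≤ b) (hc : c ≠ 0) :
    logVar (fun _ => c) a b = 0 := by
  rw [(IsLogOn.const hc).logVar_eq hab]; ring

theorem logVar_const_mul {f : ℝ → ℂ} {a b : ℝ} (hab : a ≤ b) (hf : ContinuousOn f (Set.Icc a b))
    (hf0 : ∀ x ∈ Set.Icc a b, f x ≠ 0) {c : ℂ} (hc : c ≠ 0) :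
    logVar (fun t => c * f t) a b = logVar f a b := by
  rw [logVar_mul hab continuousOn_const (fun _ _ => hc) hf hf0, logVar_const hab hc, zero_add]

theorem logVar_neg {f : ℝ → ℂ} {a b : ℝ} (hab : a ≤ b) (hf : ContinuousOn f (Set.Icc a b))
    (hf0 : ∀ x ∈ Set.Icc a b, f x ≠ 0) : logVar (fun t => -f t) a b = logVar f a b := by
  simpa using logVar_const_mul hab hf hf0 (c := -1) (by norm_num)

/-- Multiplying a function by a positive one changes the variation by a real number. -/
theorem logVar_smul_im {f : ℝ → ℂ} {ρ : ℝ → ℝ} {a b : ℝ} (hab : a ≤ b)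
    (hf : ContinuousOn f (Set.Icc a b)) (hf0 : ∀ x ∈ Set.Icc a b, f x ≠ 0)
    (hρ : ContinuousOn ρ (Set.Icc a b)) (hρ0 : ∀ x ∈ Set.Icc a b, 0 < ρ x) :
    (logVar (fun t => ρ t * f t) a b).im = (logVar f a b).im := by
  have hc : ContinuousOn (fun t => (ρ t : ℂ)) (Set.Icc a b) :=
    Complex.continuous_ofReal.comp_continuousOn hρ
  rw [logVar_mul hab hc (fun x hx => by exact_mod_cast (hρ0 x hx).ne') hf hf0,
    logVar_of_slitPlane hab one_ne_zero hc fun x hx => by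
      rw [div_one]; exact Complex.ofReal_mem_slitPlane.2 (hρ0 x hx)]
  simp only [div_one, Complex.add_im, Complex.sub_im, Complex.log_im]
  rw [Complex.arg_ofReal_of_nonneg (hρ0 b (Set.right_mem_Icc.2 hab)).le,
    Complex.arg_ofReal_of_nonneg (hρ0 a (Set.left_mem_Icc.2 hab)).le]
  ring

theorem logVar_reverse {f : ℝ → ℂ} (hf : ContinuousOn f (Set.Icc 0 1))
    (hf0 : ∀ x ∈ Set.Icc (0 : ℝ) 1, f x ≠ 0) :
    logVar (fun t => f (1 - t)) 0 1 = -logVar f 0 1 := by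
  obtain ⟨F, hF⟩ := exists_isLogOn_Icc zero_le_one hf hf0
  have h1 := hF.comp (φ := fun t : ℝ => 1 - t) (u := Set.Icc 0 1) (by fun_prop)
    (fun t ht => ⟨by linarith [ht.2], by linarith [ht.1]⟩)
  have h2 : logVar (fun t => f (1 - t)) 0 1 = _ := h1.logVar_eq zero_le_one
  rw [h2, hF.logVar_eq zero_le_one]
  simp

theorem logVar_add_adjacent {f : ℝ → ℂ} {a b c : ℝ} (hab : a ≤ b) (hbc : b ≤ c)
    (hf : ContinuousOn f (Set.Icc a c)) (hf0 : ∀ x ∈ Set.Icc a c, f x ≠ 0) :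
    logVar f a c = logVar f a b + logVar f b c := by
  obtain ⟨F, hF⟩ := exists_isLogOn_Icc (hab.trans hbc) hf hf0
  rw [hF.logVar_eq (hab.trans hbc), (hF.mono (Set.Icc_subset_Icc_right hbc)).logVar_eq hab,
    (hF.mono (Set.Icc_subset_Icc_left hab)).logVar_eq hbc]
  ring

theorem logVar_shift (f : ℝ → ℂ) {a b : ℝ} (hab : a ≤ b) (c : ℝ)
    (hf : ContinuousOn f (Set.Icc (a + c) (b + c)))
    (hf0 : ∀ x ∈ Set.Icc (a + c) (b + c), f x ≠ 0) :
    logVar (fun t => f (t + c)) a b = logVar f (a + c) (b + c) := by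
  obtain ⟨F, hF⟩ := exists_isLogOn_Icc (by linarith) hf hf0
  have h1 := hF.comp (φ := fun t : ℝ => t + c) (u := Set.Icc a b) (by fun_prop)
    (fun t ht => ⟨by linarith [ht.1], by linarith [ht.2]⟩)
  have h2 : logVar (fun t => f (t + c)) a b = _ := h1.logVar_eq hab
  rw [h2, hF.logVar_eq (by linarith)]
  simp

/-- The variation over a period does not depend on the period. -/
theorem logVar_periodic {f : ℝ → ℂ} (hf : Continuous f) (hf0 : ∀ t, f t ≠ 0)
    (hp : ∀ t, f (t + 1) = f t) (a : ℝ) : logVar f a (a + 1) = logVar f 0 1 := by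
  have key : ∀ a b : ℝ, a ≤ b → logVar f a (a + 1) = logVar f b (b + 1) := by
    intro a b hab
    have h1 := logVar_add_adjacent (f := f) (a := a) (b := a + 1) (c := b + 1) (by linarith)
      (by linarith) hf.continuousOn fun x _ => hf0 x
    have h2 := logVar_add_adjacent (f := f) (a := a) (b := b) (c := b + 1) (by linarith)
      (by linarith) hf.continuousOn fun x _ => hf0 x
    have h3 := logVar_shift f hab 1 hf.continuousOn fun x _ => hf0 x
    simp only [hp] at h3
    linear_combination h2 - h1 + h3
  rcases le_total a 0 with h | h
  · simpa using key a 0 h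
  · simpa using (key 0 a h).symm

/-- The variations along two opposite paths around a square agree. -/
theorem logVar_square {f : ℝ → ℝ → ℂ} {a b c d : ℝ} (hab : a ≤ b) (hcd : c ≤ d)
    (hf : ContinuousOn (fun p : ℝ × ℝ => f p.1 p.2) (Set.Icc a b ×ˢ Set.Icc c d))
    (hf0 : ∀ x ∈ Set.Icc a b, ∀ y ∈ Set.Icc c d, f x y ≠ 0) :
    logVar (fun x => f x c) a b + logVar (f b) c d = logVar (f a) c d + logVar (fun x => f x d) a b := by
  have hmem : ((a, c) : ℝ × ℝ) ∈ Set.Icc a b ×ˢ Set.Icc c d :=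
    ⟨Set.left_mem_Icc.2 hab, Set.left_mem_Icc.2 hcd⟩
  -- One logarithm on the whole rectangle serves all four sides, so both paths give the difference
  -- of its values at the same two corners.
  obtain ⟨F, hF⟩ := exists_isLogOn_of_starConvex
    (((convex_Icc a b).prod (convex_Icc c d)).starConvex hmem) hmem hf fun p hp =>
      hf0 _ hp.1 _ hp.2
  have hx : ∀ y ∈ Set.Icc c d, logVar (fun x => f x y) a b = F (b, y) - F (a, y) := fun y hy =>
    (hF.comp (φ := fun x : ℝ => ((x, y) : ℝ × ℝ)) (u := Set.Icc a b) (by fun_prop)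
      fun x hx => ⟨hx, hy⟩).logVar_eq hab
  have hy : ∀ x ∈ Set.Icc a b, logVar (f x) c d = F (x, d) - F (x, c) := fun x hx =>
    (hF.comp (φ := fun y : ℝ => ((x, y) : ℝ × ℝ)) (u := Set.Icc c d) (by fun_prop)
      fun y hy => ⟨hx, hy⟩).logVar_eq hcd
  rw [hx c (Set.left_mem_Icc.2 hcd), hx d (Set.right_mem_Icc.2 hcd), hy a (Set.left_mem_Icc.2 hab),
    hy b (Set.right_mem_Icc.2 hab)]
  ring

/-- The variation along closed curves is invariant under homotopies of closed curves. -/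
theorem logVar_homotopy {f : ℝ → ℝ → ℂ} {c d : ℝ} (hcd : c ≤ d)
    (hf : ContinuousOn (fun p : ℝ × ℝ => f p.1 p.2) (Set.Icc 0 1 ×ˢ Set.Icc c d))
    (hf0 : ∀ x ∈ Set.Icc (0 : ℝ) 1, ∀ y ∈ Set.Icc c d, f x y ≠ 0)
    (hp : ∀ x ∈ Set.Icc (0 : ℝ) 1, f x d = f x c) : logVar (f 0) c d = logVar (f 1) c d := by
  have h1 := logVar_square zero_le_one hcd hf hf0
  rw [logVar_congr (f := fun x => f x d) (g := fun x => f x c) hp] at h1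
  linear_combination -h1

/-- The integral of the logarithmic derivative. -/
theorem integral_logDeriv_eq_logVar {f : ℝ → ℂ} {a b : ℝ} (hab : a ≤ b) (hf : ContDiff ℝ 1 f)
    (hf0 : ∀ x ∈ Set.Icc a b, f x ≠ 0) : ∫ t in a..b, deriv f t / f t = logVar f a b := by
  obtain ⟨F, hF⟩ := exists_isLogOn_Icc hab hf.continuous.continuousOn hf0
  have hd : ContinuousOn (deriv f) (Set.Icc a b) := (hf.continuous_deriv le_rfl).continuousOn
  have hint : ContinuousOn (fun t => deriv f t / f t) (Set.Icc a b) :=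
    hd.div hf.continuous.continuousOn hf0
  set G : ℝ → ℂ := fun x => ∫ t in a..x, deriv f t / f t with hG
  have hGc : ContinuousOn G (Set.Icc a b) := by
    have := intervalIntegral.continuousOn_primitive_interval (μ := MeasureTheory.volume)
      (f := fun t => deriv f t / f t) (a := a) (b := b)
      (by rw [Set.uIcc_of_le hab]; exact hint.integrableOn_Icc)
    rwa [Set.uIcc_of_le hab] at this
  have hGd : ∀ x ∈ Set.Ico a b, HasDerivAt G (deriv f x / f x) x := by
    intro x hx
    refine intervalIntegral.integral_hasDerivAt_right ?_ ?_ ?_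
    · exact (hint.mono (Set.uIcc_of_le hx.1 ▸ Set.Icc_subset_Icc_right hx.2.le)).intervalIntegrable
    · exact ((hf.continuous_deriv le_rfl).measurable.div
        hf.continuous.measurable).stronglyMeasurable.stronglyMeasurableAtFilter
    · exact (hf.continuous_deriv le_rfl).continuousAt.div hf.continuous.continuousAt
        (hf0 x (Set.Ico_subset_Icc_self hx))
  -- The product `f · exp (-G)` has derivative zero, so `G` is a logarithm of `f` up to an additive
  -- constant.
  have hcst : ∀ x ∈ Set.Icc a b, f x * Complex.exp (-G x) = f a * Complex.exp (-G a) := by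
    apply constant_of_has_deriv_right_zero (f := fun x => f x * Complex.exp (-G x))
    · exact hf.continuous.continuousOn.mul (hGc.neg.cexp)
    · intro x hx
      have h1 : HasDerivAt (fun x => f x * Complex.exp (-G x)) _ x :=
        (hf.differentiable one_ne_zero x).hasDerivAt.mul (hGd x hx).fun_neg.cexp
      refine h1.hasDerivWithinAt.congr_deriv ?_
      have := hf0 x (Set.Ico_subset_Icc_self hx)
      field_simp
      ring
  have hGlog : IsLogOn (fun x => G x + Complex.log (f a)) f (Set.Icc a b) := by
    refine ⟨hGc.add continuousOn_const, fun x hx => ?_⟩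
    have := hcst x hx
    have hGa : G a = 0 := by simp [hG]
    rw [hGa, neg_zero, Complex.exp_zero, mul_one, Complex.exp_neg] at this
    rw [Complex.exp_add, Complex.exp_log (hf0 a (Set.left_mem_Icc.2 hab)), ← this]
    field_simp [Complex.exp_ne_zero]
  rw [hGlog.logVar_eq hab]
  simp [hG]

/-! ### Secants and the theorem of turning tangents -/

/-- The difference quotient of a curve, extended by the derivative to the diagonal. -/
noncomputable def secant (γ : ℝ → ℂ) (s t : ℝ) : ℂ := ∫ u in (0 : ℝ)..1, deriv γ (s + u * (t - s))

theorem secant_self (γ : ℝ → ℂ) (s : ℝ) : secant γ s s = deriv γ s := by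
  simp [secant]

/-- The difference quotient is written as an average of the derivative precisely so that continuity
across the diagonal costs nothing. -/
theorem continuous_secant {γ : ℝ → ℂ} (hγ : ContDiff ℝ 1 γ) :
    Continuous fun p : ℝ × ℝ => secant γ p.1 p.2 := by
  have hd := hγ.continuous_deriv le_rfl
  refine intervalIntegral.continuous_parametric_intervalIntegral_of_continuous' ?_ 0 1
  exact hd.comp (by fun_prop)

theorem mul_secant {γ : ℝ → ℂ} (hγ : ContDiff ℝ 1 γ) (s t : ℝ) :
    ((t - s : ℝ) : ℂ) * secant γ s t = γ t - γ s := by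
  have hd := hγ.continuous_deriv le_rfl
  have h := intervalIntegral.smul_integral_comp_add_mul (a := 0) (b := 1) (deriv γ) (t - s) s
  have h2 : ∫ x in (s + (t - s) * 0)..(s + (t - s) * 1), deriv γ x = γ t - γ s := by
    rw [intervalIntegral.integral_deriv_eq_sub
      (fun x _ => hγ.differentiable one_ne_zero x) (hd.intervalIntegrable _ _)]
    congr 1 <;> congr 1 <;> ring
  rw [h2] at h
  rw [← h, secant, Complex.real_smul]
  congr 2
  ext u
  rw [mul_comm]

theorem secant_comm {γ : ℝ → ℂ} (hγ : ContDiff ℝ 1 γ) (s t : ℝ) : secant γ s t = secant γ t s := by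
  rcases eq_or_ne s t with rfl | hst
  · rfl
  have h1 := mul_secant hγ s t
  have h2 := mul_secant hγ t s
  have h3 : ((t - s : ℝ) : ℂ) ≠ 0 := by exact_mod_cast sub_ne_zero.2 hst.symm
  apply mul_left_cancel₀ h3
  rw [h1]
  push_cast at h2 ⊢
  linear_combination h2

theorem secant_ne_zero {γ : ℝ → ℂ} (hγ : ContDiff ℝ 1 γ) {s t : ℝ} (h : γ s ≠ γ t) :
    secant γ s t ≠ 0 := by
  intro h0
  have := mul_secant hγ s t
  rw [h0, mul_zero] at this
  exact h (sub_eq_zero.1 this.symm).symm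

theorem secant_ne_zero_of_injOn {γ : ℝ → ℂ} (hγ : ContDiff ℝ 1 γ) {S : Set ℝ} (hinj : Set.InjOn γ S)
    (h0 : ∀ t ∈ S, deriv γ t ≠ 0) {s t : ℝ} (hs : s ∈ S) (ht : t ∈ S) : secant γ s t ≠ 0 := by
  rcases eq_or_ne s t with rfl | hst
  · rw [secant_self]; exact h0 s hs
  · exact secant_ne_zero hγ fun h => hst (hinj hs ht h)

/-- The turning of an embedded arc is the sum of the turnings of its secants from the initial point
and of its secants to the final point. -/
theorem logVar_deriv_eq_secant {γ : ℝ → ℂ} (hγ : ContDiff ℝ 1 γ)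
    (hinj : Set.InjOn γ (Set.Icc 0 1)) (h0 : ∀ t ∈ Set.Icc (0 : ℝ) 1, deriv γ t ≠ 0) :
    logVar (deriv γ) 0 1 = logVar (secant γ 0) 0 1 + logVar (secant γ 1) 0 1 := by
  have hz : ((0, 0) : ℝ × ℝ) ∈ Set.Icc (0 : ℝ) 1 ×ˢ Set.Icc (0 : ℝ) 1 := by simp
  -- The secant never vanishes on the square. Its diagonal gives the tangent, and the two sides
  -- through `(0, 1)` give the secants from the initial point and those to the final point.
  obtain ⟨H, hH⟩ := exists_isLogOn_of_starConvex
    (((convex_Icc (0 : ℝ) 1).prod (convex_Icc (0 : ℝ) 1)).starConvex hz) hz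
    (continuous_secant hγ).continuousOn fun p hp => secant_ne_zero_of_injOn hγ hinj h0 hp.1 hp.2
  have key : ∀ φ : ℝ → ℝ × ℝ, ContinuousOn φ (Set.Icc 0 1) →
      Set.MapsTo φ (Set.Icc 0 1) (Set.Icc 0 1 ×ˢ Set.Icc 0 1) →
      logVar (fun t => secant γ (φ t).1 (φ t).2) 0 1 = H (φ 1) - H (φ 0) := fun φ hφ hm =>
    (hH.comp hφ hm).logVar_eq zero_le_one
  have e1 := key (fun t => (t, t)) (by fun_prop) fun t ht => ⟨ht, ht⟩
  have e2 := key (fun t => (0, t)) (by fun_prop) fun t ht => ⟨by simp, ht⟩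
  have e3 := key (fun t => (t, 1)) (by fun_prop) fun t ht => ⟨ht, by simp⟩
  simp only [secant_self] at e1
  have e4 : (fun t => secant γ t 1) = secant γ 1 := funext fun t => secant_comm hγ t 1
  simp only at e3
  rw [e4] at e3
  rw [e3, e1]
  simp only at e2
  have e5 : (fun t => secant γ 0 t) = secant γ 0 := rfl
  rw [e5] at e2
  rw [e2]; ring

theorem mem_slitPlane_of_re_nonneg {z : ℂ} (h : 0 ≤ z.re) (hz : z ≠ 0) : z ∈ Complex.slitPlane := by
  rcases h.lt_or_eq with h | h
  · exact Or.inl h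
  · exact Or.inr fun hi => hz (Complex.ext h.symm hi)

/-- The turning of a simple closed curve is `2π` or `-2π`. -/
theorem logVar_deriv_of_simple_closed {γ : ℝ → ℂ} (hγ : ContDiff ℝ 1 γ)
    (hp : ∀ t, γ (t + 1) = γ t) (hinj : Set.InjOn γ (Set.Ico 0 1)) (h0 : ∀ t, deriv γ t ≠ 0) :
    logVar (deriv γ) 0 1 = 2 * Real.pi * Complex.I ∨
      logVar (deriv γ) 0 1 = -(2 * Real.pi * Complex.I) := by
  have hper : Function.Periodic γ 1 := hp
  have hinj' : ∀ s t, s < t → t < s + 1 → γ s ≠ γ t := by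
    intro s t hst hts heq
    have hf : ∀ x, γ (Int.fract x) = γ x := fun x => by
      have := hper.sub_int_mul_eq (x := x) ⌊x⌋
      rwa [mul_one] at this
    have h1 := hinj ⟨Int.fract_nonneg s, Int.fract_lt_one s⟩ ⟨Int.fract_nonneg t, Int.fract_lt_one t⟩
      (by rw [hf, hf, heq])
    obtain ⟨k, hk⟩ := Int.fract_eq_fract.1 h1
    have h2 : (-1 : ℝ) < k := by linarith
    have h3 : (k : ℝ) < 0 := by linarith
    have h4 : (-1 : ℤ) < k := by exact_mod_cast h2
    have h5 : k < 0 := by exact_mod_cast h3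
    omega
  have hdper : ∀ t, deriv γ (t + 1) = deriv γ t := fun t => by
    rw [← deriv_comp_add_const]; simp only [hp]
  have hdc := hγ.continuous_deriv le_rfl
  -- a lowest point
  obtain ⟨t₀, -, ht₀⟩ := isCompact_Icc.exists_isMinOn (Set.nonempty_Icc.2 (zero_le_one (α := ℝ)))
    (Complex.continuous_im.comp hγ.continuous).continuousOn
  have hmin : ∀ t, (γ t₀).im ≤ (γ t).im := by
    intro t
    have hf : γ (Int.fract t) = γ t := by
      have := hper.sub_int_mul_eq (x := t) ⌊t⌋
      rwa [mul_one] at this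
    rw [← hf]
    exact ht₀ ⟨Int.fract_nonneg t, (Int.fract_lt_one t).le⟩
  have him : (deriv γ t₀).im = 0 := by
    have h1 : HasDerivAt (fun t => (γ t).im) (deriv γ t₀).im t₀ :=
      Complex.imCLM.hasFDerivAt.comp_hasDerivAt t₀ (hγ.differentiable one_ne_zero t₀).hasDerivAt
    exact IsLocalMin.hasDerivAt_eq_zero (Filter.Eventually.of_forall hmin) h1
  -- the normalized secants
  set h : ℝ × ℝ → ℂ := fun p => if p.2 - p.1 = 1 then -deriv γ p.1 else
    secant γ p.1 p.2 / ((1 - (p.2 - p.1) : ℝ) : ℂ) with hh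
  -- By periodicity `h` has a second expression, regular where `t - s = 1`. The two together give
  -- continuity on the whole strip `0 ≤ t - s ≤ 1`, with boundary values `γ'` and `-γ'`.
  have hh1 : ∀ p : ℝ × ℝ, p.2 - p.1 ≠ 0 →
      h p = -secant γ p.2 (p.1 + 1) / ((p.2 - p.1 : ℝ) : ℂ) := by
    rintro ⟨s, t⟩ hst
    simp only at hst
    simp only [hh]
    split_ifs with h1
    · have : t = s + 1 := by linarith
      subst this
      rw [secant_self, hdper]; simp
    · have h2 : 1 - (t - s) ≠ 0 := fun h => h1 (by linarith)
      have h3 : ((t - s : ℝ) : ℂ) ≠ 0 := by exact_mod_cast hst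
      have h4 : ((1 - (t - s) : ℝ) : ℂ) ≠ 0 := by exact_mod_cast h2
      have e1 := mul_secant hγ s t
      have e2 := mul_secant hγ t (s + 1)
      rw [hp] at e2
      rw [div_eq_div_iff h4 h3]
      push_cast at e1 e2 ⊢
      linear_combination e1 + e2
  have hhc : Continuous h := by
    rw [continuous_iff_continuousAt]
    rintro ⟨s, t⟩
    by_cases h1 : t - s = 1
    · have hopen : {p : ℝ × ℝ | p.2 - p.1 ≠ 0} ∈ nhds (s, t) :=
        (isOpen_ne_fun (by fun_prop) (by fun_prop)).mem_nhds (by simp [h1])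
      refine ContinuousAt.congr (f := fun p : ℝ × ℝ =>
        -secant γ p.2 (p.1 + 1) / ((p.2 - p.1 : ℝ) : ℂ)) ?_ ?_
      · refine ContinuousAt.div ?_ ?_ (by simp [h1])
        · exact ((continuous_secant hγ).comp
            (f := fun p : ℝ × ℝ => (p.2, p.1 + 1)) (by fun_prop)).neg.continuousAt
        · fun_prop
      · filter_upwards [hopen] with p hp' using (hh1 p hp').symm
    · have hopen : {p : ℝ × ℝ | p.2 - p.1 ≠ 1} ∈ nhds (s, t) :=
        (isOpen_ne_fun (by fun_prop) (by fun_prop)).mem_nhds (by simpa using h1)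
      refine ContinuousAt.congr (f := fun p : ℝ × ℝ =>
        secant γ p.1 p.2 / ((1 - (p.2 - p.1) : ℝ) : ℂ)) ?_ ?_
      · refine ContinuousAt.div ?_ ?_ ?_
        · exact (continuous_secant hγ).continuousAt
        · fun_prop
        · intro h2
          have : (1 - (t - s) : ℝ) = 0 := by exact_mod_cast h2
          exact h1 (by linarith)
      · filter_upwards [hopen] with p hp' using by
          have hp'' : p.2 - p.1 ≠ 1 := hp'
          simp only [hh, hp'', if_false]
  have hsec : ∀ s t, 0 < t - s → t - s < 1 →
      h (s, t) = ((((t - s) * (1 - (t - s)))⁻¹ : ℝ) : ℂ) * (γ t - γ s) := by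
    intro s t h1 h2
    have h3 : ((t - s : ℝ) : ℂ) ≠ 0 := by exact_mod_cast h1.ne'
    have h4 : ((1 - (t - s) : ℝ) : ℂ) ≠ 0 := by exact_mod_cast (sub_pos.2 h2).ne'
    rw [← mul_secant hγ s t]
    simp only [hh, h2.ne, if_false]
    push_cast at h3 h4 ⊢
    field_simp
  have hh0 : ∀ s t, 0 ≤ t - s → t - s ≤ 1 → h (s, t) ≠ 0 := by
    intro s t h1 h2
    rcases h1.eq_or_lt with h1 | h1
    · have : t = s := by linarith
      subst this
      simpa [hh, secant_self] using h0 t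
    rcases h2.eq_or_lt with h2 | h2
    · simpa [hh, h2] using h0 s
    rw [hsec s t h1 h2]
    refine mul_ne_zero ?_ (sub_ne_zero.2 (hinj' s t (by linarith) (by linarith)).symm)
    have := mul_pos h1 (sub_pos.2 h2)
    exact_mod_cast (inv_pos.2 this).ne'
  have hconv : Convex ℝ {p : ℝ × ℝ | p.2 - p.1 ∈ Set.Icc (0 : ℝ) 1} := by
    have := (convex_Icc (0 : ℝ) 1).linear_preimage (LinearMap.snd ℝ ℝ ℝ - LinearMap.fst ℝ ℝ ℝ)
    exact this
  have hmem0 : ((0, 0) : ℝ × ℝ) ∈ {p : ℝ × ℝ | p.2 - p.1 ∈ Set.Icc (0 : ℝ) 1} := by simp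
  obtain ⟨H, hH⟩ := exists_isLogOn_of_starConvex (hconv.starConvex hmem0) hmem0 hhc.continuousOn
    fun p hp => hh0 _ _ hp.1 hp.2
  have ht01 : t₀ ≤ t₀ + 1 := by linarith
  have key : ∀ φ : ℝ → ℝ × ℝ, Continuous φ → (∀ t ∈ Set.Icc t₀ (t₀ + 1),
      (φ t).2 - (φ t).1 ∈ Set.Icc (0 : ℝ) 1) →
      logVar (fun t => h (φ t)) t₀ (t₀ + 1) = H (φ (t₀ + 1)) - H (φ t₀) := fun φ hφ hm =>
    (hH.comp (φ := φ) (u := Set.Icc t₀ (t₀ + 1)) hφ.continuousOn hm).logVar_eq ht01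
  -- The diagonal path from `(t₀, t₀)` to `(t₀ + 1, t₀ + 1)` carries the tangent. It is compared
  -- with the path through the corner `(t₀, t₀ + 1)`.
  have e1 := key (fun t => (t, t)) (by fun_prop) fun t ht => by simp
  have e2 := key (fun t => (t₀, t)) (by fun_prop) fun t ht =>
    ⟨by linarith [ht.1], by linarith [ht.2]⟩
  have e3 := key (fun t => (t, t₀ + 1)) (by fun_prop) fun t ht =>
    ⟨by linarith [ht.2], by linarith [ht.1]⟩
  have hdiag : ∀ t, h (t, t) = deriv γ t := fun t => by simp [hh, secant_self]
  have hcorner : h (t₀, t₀ + 1) = -deriv γ t₀ := by simp [hh]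
  -- Seen from the lowest point `γ t₀`, the curve lies in the closed upper half plane. Dividing by
  -- `I` turns this into the right half plane, where the principal logarithm works.
  have e2' := logVar_of_slitPlane ht01 Complex.I_ne_zero (f := fun t => h (t₀, t))
    (by fun_prop) (fun t ht => by
      refine mem_slitPlane_of_re_nonneg ?_ (div_ne_zero
        (hh0 _ _ (by linarith [ht.1]) (by linarith [ht.2])) Complex.I_ne_zero)
      have : (h (t₀, t) / Complex.I).re = (h (t₀, t)).im := by simp [Complex.div_I]
      rw [this]
      rcases ht.1.eq_or_lt with h1 | h1
      · rw [← h1, hdiag, him]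
      rcases ht.2.eq_or_lt with h2 | h2
      · rw [h2, hcorner, Complex.neg_im, him, neg_zero]
      rw [hsec _ _ (by linarith) (by linarith), Complex.im_ofReal_mul, Complex.sub_im]
      have h3 : 0 < (t - t₀) * (1 - (t - t₀)) := mul_pos (by linarith) (by linarith)
      exact mul_nonneg (inv_pos.2 h3).le (by linarith [hmin t]))
  -- Here the secants end at the lowest point, so they lie in the closed lower half plane and the
  -- divisor is `-I`.
  have e3' := logVar_of_slitPlane ht01 (neg_ne_zero.2 Complex.I_ne_zero)
    (f := fun t => h (t, t₀ + 1)) (by fun_prop) (fun t ht => by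
      refine mem_slitPlane_of_re_nonneg ?_ (div_ne_zero
        (hh0 _ _ (by linarith [ht.2]) (by linarith [ht.1])) (neg_ne_zero.2 Complex.I_ne_zero))
      have : (h (t, t₀ + 1) / -Complex.I).re = -(h (t, t₀ + 1)).im := by
        simp [div_neg, Complex.div_I]
      rw [this]
      rcases ht.1.eq_or_lt with h1 | h1
      · rw [← h1, hcorner]; simp [him]
      rcases ht.2.eq_or_lt with h2 | h2
      · rw [h2, hdiag, hdper, him, neg_zero]
      rw [hsec _ _ (by linarith) (by linarith), Complex.im_ofReal_mul, hp, Complex.sub_im,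
        ← mul_neg]
      have h3 : 0 < (t₀ + 1 - t) * (1 - (t₀ + 1 - t)) := mul_pos (by linarith) (by linarith)
      exact mul_nonneg (inv_pos.2 h3).le (by linarith [hmin t]))
  simp only [hdiag, hcorner, hdper] at e1 e2 e3 e2' e3'
  rw [← logVar_periodic hdc h0 hdper t₀]
  -- Each of the two sides contributes the same half turn between `γ'` and `-γ'` at the lowest
  -- point. The horizontal direction of the curve there decides its sign.
  have e4 : logVar (deriv γ) t₀ (t₀ + 1) =
      2 * (Complex.log (-deriv γ t₀ / Complex.I) - Complex.log (deriv γ t₀ / Complex.I)) := by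
    have e5 : deriv γ t₀ / -Complex.I = -deriv γ t₀ / Complex.I := by
      rw [div_neg, neg_div]
    have e6 : -deriv γ t₀ / -Complex.I = deriv γ t₀ / Complex.I := neg_div_neg_eq _ _
    rw [e5, e6] at e3'
    have e7 : logVar (fun t => deriv γ t) t₀ (t₀ + 1) = logVar (deriv γ) t₀ (t₀ + 1) := rfl
    linear_combination e1 - e2 - e3 + e2' + e3' - e7
  have hreal : deriv γ t₀ = ((deriv γ t₀).re : ℂ) := Complex.ext rfl (by simpa using him)
  rw [e4, hreal]
  have hre : (deriv γ t₀).re ≠ 0 := fun h => h0 t₀ (by rw [hreal, h]; simp)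
  have hd1 : ∀ x : ℝ, (x : ℂ) / Complex.I = (x : ℂ) * (-Complex.I) := fun x => by
    rw [Complex.div_I]; ring
  have hd2 : ∀ x : ℝ, -(x : ℂ) / Complex.I = (x : ℂ) * Complex.I := fun x => by
    rw [Complex.div_I]; ring
  rw [hd1, hd2]
  rcases lt_or_gt_of_ne hre with hneg | hpos
  · right
    have h1 : ((deriv γ t₀).re : ℂ) * Complex.I =
        ((-(deriv γ t₀).re : ℝ) : ℂ) * (-Complex.I) := by push_cast; ring
    have h2 : ((deriv γ t₀).re : ℂ) * (-Complex.I) =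
        ((-(deriv γ t₀).re : ℝ) : ℂ) * Complex.I := by push_cast; ring
    rw [h1, h2, Complex.log_ofReal_mul (by linarith) (by simp), Complex.log_ofReal_mul (by linarith)
      (by simp), Complex.log_I, Complex.log_neg_I]
    ring
  · left
    rw [Complex.log_ofReal_mul hpos (by simp), Complex.log_ofReal_mul hpos (by simp),
      Complex.log_I, Complex.log_neg_I]
    ring

/-! ### Decompositions: turning and tensors -/

theorem qpow_add (n : ℕ) (k l : ℤ) : qpow n (k + l) = qpow n k * qpow n l := by
  rw [qpow, qpow, qpow, ← LaurentPolynomial.T_add]; congr 1; ring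

theorem qpow_zero (n : ℕ) : qpow n 0 = 1 := by simp [qpow]

theorem qpow_sum {ι : Type*} (n : ℕ) (s : Finset ι) (f : ι → ℤ) :
    qpow n (∑ i ∈ s, f i) = ∏ i ∈ s, qpow n (f i) := by
  classical
  induction s using Finset.induction_on with
  | empty => simp [qpow_zero]
  | insert a s ha ih => rw [Finset.sum_insert ha, Finset.prod_insert ha, qpow_add, ih]

/-- The contribution of a piece to the number of left caps minus the number of left cups. -/
def WebPiece.turn : WebPiece → ℤ
  | .capLeft => 1
  | .cupLeft => -1
  | _ => 0

/-- The number of left caps minus the number of left cups. -/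
def pieceTurn (l : List WebPiece) : ℤ := (l.map WebPiece.turn).sum

/-- Diagonality is what reduces the contraction to labelings that are constant along each band and
annulus; along a cut curve the exponents simply add. -/
theorem WebPiece.tensor_eq (n : ℕ) (p : WebPiece) :
    p.tensor n = Matrix.diagonal fun i => qpow n (p.turn * labelWeight i) := by
  cases p <;> simp [WebPiece.tensor, WebPiece.turn, qpow_zero]

theorem prod_tensor_eq (n : ℕ) (l : List WebPiece) :
    (l.map (WebPiece.tensor n)).prod =
      Matrix.diagonal fun i => qpow n (pieceTurn l * labelWeight i) := by
  induction l with
  | nil => simp [pieceTurn, qpow_zero]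
  | cons p l ih =>
    rw [List.map_cons, List.prod_cons, ih, WebPiece.tensor_eq, Matrix.diagonal_mul_diagonal]
    congr 1
    funext i
    rw [← qpow_add, pieceTurn, pieceTurn, List.map_cons, List.sum_cons, add_mul]

theorem Complex.log_neg_of_im_neg {z : ℂ} (hz : z.im < 0) :
    Complex.log (-z) = Complex.log z + Real.pi * Complex.I := by
  simp [Complex.log, Complex.arg_neg_eq_arg_add_pi_of_im_neg hz]; ring

theorem Complex.log_neg_of_im_pos {z : ℂ} (hz : 0 < z.im) :
    Complex.log (-z) = Complex.log z - Real.pi * Complex.I := by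
  simp [Complex.log, Complex.arg_neg_eq_arg_sub_pi_of_im_pos hz]; ring

/-- The turning of the tangent of a curve along a piece. -/
theorem WebPiece.Fits.logVar_deriv {α : ℝ → ℂ} (hα : ContDiff ℝ 1 α) {p : WebPiece} {s t : ℝ}
    (hst : s < t) (h : p.Fits α s t) :
    (∀ u ∈ Set.Icc s t, deriv α u ≠ 0) ∧ logVar (deriv α) s t =
      Complex.log (deriv α t) - Complex.log (deriv α s) + 2 * Real.pi * Complex.I * p.turn := by
  have hc := (hα.continuous_deriv le_rfl).continuousOn (s := Set.Icc s t)
  -- Strands, and caps and cups to the right, have tangents that avoid the negative real axis, so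
  -- the principal logarithm stays continuous along them.
  have right : (∀ u ∈ Set.Icc s t, deriv α u ∈ Complex.slitPlane) →
      (∀ u ∈ Set.Icc s t, deriv α u ≠ 0) ∧ logVar (deriv α) s t =
      Complex.log (deriv α t) - Complex.log (deriv α s) + 2 * Real.pi * Complex.I * (0 : ℤ) := by
    intro h
    refine ⟨fun u hu => Complex.slitPlane_ne_zero (h u hu), ?_⟩
    rw [logVar_of_slitPlane hst.le one_ne_zero hc (by simpa using h)]
    simp
  -- Caps and cups to the left have tangents that avoid the positive real axis, so the principal
  -- logarithm of the opposite vector is used.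
  have left : (∀ u ∈ Set.Icc s t, -deriv α u ∈ Complex.slitPlane) →
      (∀ u ∈ Set.Icc s t, deriv α u ≠ 0) ∧ logVar (deriv α) s t =
      Complex.log (-deriv α t) - Complex.log (-deriv α s) := by
    intro h
    refine ⟨fun u hu => neg_ne_zero.1 (Complex.slitPlane_ne_zero (h u hu)), ?_⟩
    rw [logVar_of_slitPlane hst.le (c := -1) (by norm_num) hc (by simpa [div_neg] using h)]
    simp [div_neg]
  have up : ∀ z : ℂ, 0 < z.im → z ∈ Complex.slitPlane ∧ -z ∈ Complex.slitPlane := fun z hz =>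
    ⟨Or.inr hz.ne', Or.inr (by simpa using hz.ne')⟩
  have down : ∀ z : ℂ, z.im < 0 → z ∈ Complex.slitPlane ∧ -z ∈ Complex.slitPlane := fun z hz =>
    ⟨Or.inr hz.ne, Or.inr (by simpa using hz.ne)⟩
  cases p with
  | down => exact right fun u hu => (down _ (h u hu)).1
  | up => exact right fun u hu => (up _ (h u hu)).1
  | capRight =>
    obtain ⟨c, hc, h1, -, h3, h4⟩ := h
    refine right fun u hu => ?_
    rcases lt_trichotomy u c with h | rfl | h
    · exact (up _ (h1 u ⟨hu.1, h⟩)).1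
    · exact Or.inl h3
    · exact (down _ (h4 u ⟨h, hu.2⟩)).1
  | cupRight =>
    obtain ⟨c, hc, h1, -, h3, h4⟩ := h
    refine right fun u hu => ?_
    rcases lt_trichotomy u c with h | rfl | h
    · exact (down _ (h1 u ⟨hu.1, h⟩)).1
    · exact Or.inl h3
    · exact (up _ (h4 u ⟨h, hu.2⟩)).1
  | capLeft =>
    obtain ⟨c, hc, h1, -, h3, h4⟩ := h
    have := left fun u hu => by
      rcases lt_trichotomy u c with h | rfl | h
      · exact (up _ (h1 u ⟨hu.1, h⟩)).2
      · exact Or.inl (by simpa using h3)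
      · exact (down _ (h4 u ⟨h, hu.2⟩)).2
    refine ⟨this.1, this.2.trans ?_⟩
    -- Returning from `log (-z)` to `log z` costs `π` at each end, with opposite signs; the
    -- difference is the full turn counted by `turn`.
    rw [Complex.log_neg_of_im_neg (h4 t ⟨hc.2, le_rfl⟩),
      Complex.log_neg_of_im_pos (h1 s ⟨le_rfl, hc.1⟩)]
    simp [WebPiece.turn]; ring
  | cupLeft =>
    obtain ⟨c, hc, h1, -, h3, h4⟩ := h
    have := left fun u hu => by
      rcases lt_trichotomy u c with h | rfl | h
      · exact (down _ (h1 u ⟨hu.1, h⟩)).2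
      · exact Or.inl (by simpa using h3)
      · exact (up _ (h4 u ⟨h, hu.2⟩)).2
    refine ⟨this.1, this.2.trans ?_⟩
    rw [Complex.log_neg_of_im_pos (h4 t ⟨hc.2, le_rfl⟩),
      Complex.log_neg_of_im_neg (h1 s ⟨le_rfl, hc.1⟩)]
    simp [WebPiece.turn]; ring

theorem CutInto.le {α : ℝ → ℂ} {s t : ℝ} {l : List WebPiece} (h : CutInto α s t l) : s ≤ t := by
  induction h with
  | nil => exact le_rfl
  | cons hst _ _ ih => exact hst.le.trans ih

/-- The turning of the tangent of a curve which is cut into pieces. -/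
theorem CutInto.logVar_deriv {α : ℝ → ℂ} (hα : ContDiff ℝ 1 α) {s t : ℝ} {l : List WebPiece}
    (h : CutInto α s t l) (hs : deriv α s ≠ 0) :
    (∀ u ∈ Set.Icc s t, deriv α u ≠ 0) ∧ logVar (deriv α) s t =
      Complex.log (deriv α t) - Complex.log (deriv α s) + 2 * Real.pi * Complex.I * pieceTurn l := by
  induction h with
  | nil t =>
    have h0 : ∀ u ∈ Set.Icc t t, deriv α u ≠ 0 := by simpa using hs
    refine ⟨h0, ?_⟩
    obtain ⟨F, hF⟩ := exists_isLogOn_Icc le_rfl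
      ((hα.continuous_deriv le_rfl).continuousOn (s := Set.Icc t t)) h0
    rw [hF.logVar_eq le_rfl]
    simp [pieceTurn]
  | @cons s t u p l hst hp hl ih =>
    obtain ⟨h1, h2⟩ := hp.logVar_deriv hα hst
    obtain ⟨h3, h4⟩ := ih (h1 t (Set.right_mem_Icc.2 hst.le))
    have h0 : ∀ x ∈ Set.Icc s u, deriv α x ≠ 0 := fun x hx => by
      rcases le_total x t with h | h
      · exact h1 x ⟨hx.1, h⟩
      · exact h3 x ⟨h, hx.2⟩
    refine ⟨h0, ?_⟩
    rw [logVar_add_adjacent hst.le hl.le (hα.continuous_deriv le_rfl).continuousOn h0, h2, h4,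
      pieceTurn, pieceTurn, List.map_cons, List.sum_cons]
    push_cast
    ring

/-! ### The contraction as a state sum, and cancellation at the discs. -/

namespace PlanarWeb

variable {n : ℕ} {V B A : Type*}

theorem vertexTensor_perm {Γ : PlanarWeb n V B A} (S : Γ.State) (v : V) :
    vertexTensor (fun i => S.label (Sum.inl (Γ.bandAt v i))) =
      (-qpow n 1) ^ permLength (S.perm v) := by
  have h : Function.Bijective fun i => S.label (Sum.inl (Γ.bandAt v i)) :=
    Finite.injective_iff_bijective.1 (S.2 v)
  rw [vertexTensor, dif_pos h]
  rfl

/-- The contraction of a decomposition is a sum over states. -/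
theorem Decomposition.contraction_eq_sum [Fintype V] [Fintype B] [Fintype A]
    {Γ : PlanarWeb n V B A} (D : Γ.Decomposition) :
    D.contraction = ∑ S : Γ.State,
      qpow n (∑ b, pieceTurn (D.bandPieces b) * labelWeight (S.label (Sum.inl b)) +
        ∑ a, pieceTurn (D.annulusPieces a) * labelWeight (S.label (Sum.inr a))) *
      ∏ v : V, (-qpow n 1) ^ permLength (S.perm v) := by
  classical
  have h1 : D.contraction = ∑ x : B → Fin n,
      (∏ b, qpow n (pieceTurn (D.bandPieces b) * labelWeight (x b))) *
      (∏ a, ∑ i : Fin n, qpow n (pieceTurn (D.annulusPieces a) * labelWeight i)) *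
      ∏ v : V, vertexTensor fun i => x (Γ.bandAt v i) := by
    rw [Decomposition.contraction]
    refine Finset.sum_congr rfl fun x _ => ?_
    rw [Finset.sum_eq_single x]
    · simp only [prod_tensor_eq, Matrix.diagonal_apply_eq, Matrix.trace_diagonal, ite_self]
    · intro y _ hy
      obtain ⟨b, hb⟩ := Function.ne_iff.1 hy
      rw [Finset.prod_eq_zero (Finset.mem_univ b), zero_mul, zero_mul]
      rw [prod_tensor_eq, Matrix.diagonal_apply_ne _ hb.symm]
    · simp
  have h2 : D.contraction = ∑ f : B ⊕ A → Fin n,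
      qpow n (∑ b, pieceTurn (D.bandPieces b) * labelWeight (f (Sum.inl b)) +
        ∑ a, pieceTurn (D.annulusPieces a) * labelWeight (f (Sum.inr a))) *
      ∏ v : V, vertexTensor fun i => f (Sum.inl (Γ.bandAt v i)) := by
    rw [h1, ← (Equiv.sumArrowEquivProdArrow B A (Fin n)).symm.sum_comp, Fintype.sum_prod_type]
    refine Finset.sum_congr rfl fun x _ => ?_
    -- The product of the traces is expanded into a sum over all labelings of the annuli.
    rw [Finset.prod_univ_sum, Finset.mul_sum, Finset.sum_mul, Fintype.piFinset_univ]
    refine Finset.sum_congr rfl fun y _ => ?_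
    simp [Equiv.sumArrowEquivProdArrow, qpow_add, qpow_sum]
  rw [h2]
  have h3 : ∀ S : Γ.State, (∏ v : V, (-qpow n 1) ^ permLength (S.perm v)) =
      ∏ v : V, vertexTensor fun i => S.label (Sum.inl (Γ.bandAt v i)) := fun S =>
    Finset.prod_congr rfl fun v _ => (vertexTensor_perm S v).symm
  simp only [h3]
  symm
  refine Finset.sum_of_injOn (fun S : Γ.State => S.1) Subtype.val_injective.injOn (by simp) ?_ ?_
  · intro f _ hf
    -- A labeling that is not a state repeats a label at some disc, and the tensor of that disc
    -- vanishes.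
    have : ∃ v, ¬ Function.Injective fun i => f (Sum.inl (Γ.bandAt v i)) := by
      by_contra! hcon
      exact hf ⟨⟨f, hcon⟩, Finset.mem_coe.2 (Finset.mem_univ _), rfl⟩
    obtain ⟨v, hv⟩ := this
    rw [Finset.prod_eq_zero (Finset.mem_univ v), mul_zero]
    rw [vertexTensor, dif_neg fun h => hv h.1]
  · intro S _
    rfl

/-- The reflection `i ↦ n + 1 - i` changes the sign of the weight. This is the cancellation that
removes every quantity attached to a disc. -/
theorem sum_labelWeight_perm (σ : Equiv.Perm (Fin n)) : ∑ i, labelWeight (σ i) = 0 := by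
  rw [Equiv.sum_comp σ fun i => labelWeight i]
  have h1 : ∑ i : Fin n, labelWeight (Fin.rev i) = ∑ i : Fin n, labelWeight i :=
    Equiv.sum_comp Fin.revPerm fun i => labelWeight i
  have h2 : ∀ i : Fin n, labelWeight (Fin.rev i) = -labelWeight i := by
    intro i
    have := i.2
    simp only [labelWeight, Fin.val_rev]
    rw [Nat.cast_sub (by omega)]
    push_cast
    ring
  simp only [h2, Finset.sum_neg_distrib] at h1
  omega

theorem State.sum_bandAt {Γ : PlanarWeb n V B A} (S : Γ.State) (v : V) :
    ∑ i, labelWeight (S.label (Sum.inl (Γ.bandAt v i))) = 0 :=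
  sum_labelWeight_perm (S.perm v)

theorem exp_angle_inj {θ φ : ℝ} (hθ : θ ∈ Set.Ioo 0 (2 * Real.pi))
    (hφ : φ ∈ Set.Ioo 0 (2 * Real.pi))
    (h : Complex.exp (θ * Complex.I) = Complex.exp (φ * Complex.I)) : θ = φ := by
  obtain ⟨k, hk⟩ := Complex.exp_eq_exp_iff_exists_int.1 h
  have h1 : (θ : ℂ) = φ + k * (2 * Real.pi) := by
    apply mul_right_cancel₀ Complex.I_ne_zero
    rw [hk]; ring
  have h2 : θ = φ + k * (2 * Real.pi) := by exact_mod_cast h1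
  have hpi := Real.two_pi_pos
  have h3 : (k : ℝ) < 1 := by
    by_contra! hcon
    nlinarith [hθ.2, hφ.1]
  have h4 : (-1 : ℝ) < k := by
    by_contra! hcon
    nlinarith [hθ.1, hφ.2]
  have h5 : k < 1 := by exact_mod_cast h3
  have h6 : -1 < k := by exact_mod_cast h4
  have : k = 0 := by omega
  rw [h2, this]; simp

theorem exp_angle_mem (θ : ℝ) : Complex.exp (θ * Complex.I) ∈ Metric.closedBall (0 : ℂ) 1 := by
  simp [Complex.norm_exp_ofReal_mul_I]

theorem bandAt_injective (Γ : PlanarWeb n V B A) (v : V) : Function.Injective (Γ.bandAt v) := by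
  intro i j hij
  by_cases hv : Γ.isSource v
  · obtain ⟨θ, hm, hθ, h⟩ := Γ.source_order v hv
    refine hm.injective (exp_angle_inj (hθ i) (hθ j) ?_)
    exact Γ.disc_injOn v (exp_angle_mem _) (exp_angle_mem _) (by rw [h, h, hij])
  · obtain ⟨θ, hm, hθ, h⟩ := Γ.sink_order v hv
    refine hm.injective (exp_angle_inj (hθ i) (hθ j) ?_)
    exact Γ.disc_injOn v (exp_angle_mem _) (exp_angle_mem _) (by rw [h, h, hij])

/-- A quantity attached to the source discs does not contribute to the weighted sum of a state. -/
theorem State.sum_src [Fintype B] {Γ : PlanarWeb n V B A} (S : Γ.State) {x : B → ℝ}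
    (hx : ∀ b b', Γ.src b = Γ.src b' → x b = x b') :
    ∑ b, x b * labelWeight (S.label (Sum.inl b)) = 0 := by
  classical
  rw [← Finset.sum_fiberwise_of_maps_to (s := Finset.univ) (t := Finset.univ.image Γ.src)
    (g := Γ.src) (fun b _ => Finset.mem_image_of_mem _ (Finset.mem_univ b))]
  refine Finset.sum_eq_zero fun v hv => ?_
  obtain ⟨b₀, -, rfl⟩ := Finset.mem_image.1 hv
  -- The bands leaving a disc are exactly its `n` numbered bands, so a state gives them every label
  -- once.
  have h1 : (Finset.univ.filter fun b => Γ.src b = Γ.src b₀) =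
      Finset.univ.image (Γ.bandAt (Γ.src b₀)) := by
    ext b
    simp [Γ.source_valence _ (Γ.src_isSource b₀) b]
  have h2 : ∑ b ∈ Finset.univ.filter (fun b => Γ.src b = Γ.src b₀),
      x b * labelWeight (S.label (Sum.inl b)) =
      ∑ b ∈ Finset.univ.filter (fun b => Γ.src b = Γ.src b₀),
      x b₀ * labelWeight (S.label (Sum.inl b)) :=
    Finset.sum_congr rfl fun b hb => by rw [hx b b₀ (Finset.mem_filter.1 hb).2]
  rw [h2, ← Finset.mul_sum, h1, Finset.sum_image (bandAt_injective Γ _).injOn]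
  have := S.sum_bandAt (Γ.src b₀)
  rw [← Int.cast_sum, this]; simp

/-- A quantity attached to the sink discs does not contribute to the weighted sum of a state. -/
theorem State.sum_tgt [Fintype B] {Γ : PlanarWeb n V B A} (S : Γ.State) {x : B → ℝ}
    (hx : ∀ b b', Γ.tgt b = Γ.tgt b' → x b = x b') :
    ∑ b, x b * labelWeight (S.label (Sum.inl b)) = 0 := by
  classical
  rw [← Finset.sum_fiberwise_of_maps_to (s := Finset.univ) (t := Finset.univ.image Γ.tgt)
    (g := Γ.tgt) (fun b _ => Finset.mem_image_of_mem _ (Finset.mem_univ b))]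
  refine Finset.sum_eq_zero fun v hv => ?_
  obtain ⟨b₀, -, rfl⟩ := Finset.mem_image.1 hv
  have h1 : (Finset.univ.filter fun b => Γ.tgt b = Γ.tgt b₀) =
      Finset.univ.image (Γ.bandAt (Γ.tgt b₀)) := by
    ext b
    simp [Γ.sink_valence _ (Γ.tgt_isSink b₀) b]
  have h2 : ∑ b ∈ Finset.univ.filter (fun b => Γ.tgt b = Γ.tgt b₀),
      x b * labelWeight (S.label (Sum.inl b)) =
      ∑ b ∈ Finset.univ.filter (fun b => Γ.tgt b = Γ.tgt b₀),
      x b₀ * labelWeight (S.label (Sum.inl b)) :=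
    Finset.sum_congr rfl fun b hb => by rw [hx b b₀ (Finset.mem_filter.1 hb).2]
  rw [h2, ← Finset.mul_sum, h1, Finset.sum_image (bandAt_injective Γ _).injOn]
  have := S.sum_bandAt (Γ.tgt b₀)
  rw [← Int.cast_sum, this]; simp

/-- Weighted sums agree when the coefficients differ by quantities attached to the discs. -/
theorem State.sum_eq_of_sub_eq [Fintype B] {Γ : PlanarWeb n V B A} (S : Γ.State) {f g x y : B → ℝ}
    (hx : ∀ b b', Γ.src b = Γ.src b' → x b = x b') (hy : ∀ b b', Γ.tgt b = Γ.tgt b' → y b = y b')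
    (h : ∀ b, f b - g b = y b - x b) :
    ∑ b, f b * labelWeight (S.label (Sum.inl b)) = ∑ b, g b * labelWeight (S.label (Sum.inl b)) := by
  have h1 := S.sum_src hx
  have h2 := S.sum_tgt hy
  have h3 : ∀ b, f b * labelWeight (S.label (Sum.inl b)) = g b * labelWeight (S.label (Sum.inl b)) +
      y b * labelWeight (S.label (Sum.inl b)) - x b * labelWeight (S.label (Sum.inl b)) := by
    intro b
    linear_combination (labelWeight (S.label (Sum.inl b)) : ℝ) * h b
  simp only [h3, Finset.sum_sub_distrib, Finset.sum_add_distrib, h1, h2]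
  ring

theorem Core.contDiff_deriv {Γ : PlanarWeb n V B A} (C : Γ.Core) (b : B) :
    ContDiff ℝ 1 (deriv (C.arc b)) := by
  exact (contDiff_infty_iff_deriv.1 (C.smooth b)).2.of_le (by exact_mod_cast le_top)

/-- The index of a band in terms of the variation of the argument of the tangent. -/
theorem Core.ind_eq {Γ : PlanarWeb n V B A} (C : Γ.Core) (b : B) :
    C.ind b = (logVar (deriv (C.arc b)) 0 1).im / (2 * Real.pi) := by
  rw [Core.ind, integral_logDeriv_eq_logVar zero_le_one (C.contDiff_deriv b) (C.immersion b)]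
  have h : (2 * (Real.pi : ℂ) * Complex.I)⁻¹ = ((2 * Real.pi)⁻¹ : ℝ) * -Complex.I := by
    rw [mul_inv, Complex.inv_I]; push_cast; ring
  rw [h, mul_assoc, Complex.re_ofReal_mul]
  simp
  ring

/-- The arguments of tangent vectors with the same direction agree. -/
theorem arg_eq_of_sameRay {z w : ℂ} (hz : z ≠ 0) (hw : w ≠ 0) (h : SameRay ℝ z w) :
    z.arg = w.arg := by
  obtain ⟨r, hr, h⟩ := h.exists_pos_left hz hw
  rw [← h, Complex.real_smul, Complex.arg_real_mul z hr]

/-- The rotation index of a state for the core of a decomposition. -/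
theorem Decomposition.sum_ind [Fintype B] {Γ : PlanarWeb n V B A} (D : Γ.Decomposition)
    (S : Γ.State) : ∑ b, D.core.ind b * labelWeight (S.label (Sum.inl b)) =
      ∑ b, (pieceTurn (D.bandPieces b) : ℝ) * labelWeight (S.label (Sum.inl b)) := by
  -- The index and the count differ by end arguments, which depend only on the common direction of
  -- the arcs at the marked point.
  refine S.sum_eq_of_sub_eq (x := fun b => (deriv (D.core.arc b) 0).arg / (2 * Real.pi))
    (y := fun b => (deriv (D.core.arc b) 1).arg / (2 * Real.pi)) ?_ ?_ ?_
  · intro b b' h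
    rw [arg_eq_of_sameRay (D.core.immersion b 0 (by simp)) (D.core.immersion b' 0 (by simp))
      (D.core.tangent_src b b' h)]
  · intro b b' h
    rw [arg_eq_of_sameRay (D.core.immersion b 1 (by simp)) (D.core.immersion b' 1 (by simp))
      (D.core.tangent_tgt b b' h)]
  · intro b
    have := ((D.band_cut b).logVar_deriv ((D.core.smooth b).of_le (by exact_mod_cast le_top))
      (D.core.immersion b 0 (by simp))).2
    rw [Core.ind_eq, this]
    have hpi := Real.two_pi_pos.ne'
    have h2 : (2 * (Real.pi : ℂ) * Complex.I * (pieceTurn (D.bandPieces b) : ℂ)).im =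
        2 * Real.pi * pieceTurn (D.bandPieces b) := by
      simp
    rw [Complex.add_im, h2, Complex.sub_im, Complex.log_im, Complex.log_im]
    field_simp
    ring

end PlanarWeb

/-! ### Logarithms near a boundary point of an embedded disc -/

/-- A continuous injective map from a compact set to a Hausdorff space is closed, hence a
homeomorphism onto its image. Only the topology of the discs and bands is needed to transport
logarithms to them. -/
theorem exists_continuousOn_leftInvOn {X Y : Type*} [TopologicalSpace X] [Nonempty X]
    [TopologicalSpace Y] [T2Space Y] {K : Set X} (hK : IsCompact K) {f : X → Y}
    (hf : ContinuousOn f K) (hinj : Set.InjOn f K) :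
    ∃ g : Y → X, ContinuousOn g (f '' K) ∧ Set.LeftInvOn g f K := by
  have hl : Set.LeftInvOn (Function.invFunOn f K) f K := hinj.leftInvOn_invFunOn
  refine ⟨Function.invFunOn f K, ?_, hl⟩
  rw [continuousOn_iff_isClosed]
  intro C hC
  refine ⟨f '' (K ∩ C), ((hK.inter_right hC).image_of_continuousOn
    (hf.mono Set.inter_subset_left)).isClosed, ?_⟩
  ext y
  constructor
  · rintro ⟨h1, x, hx, rfl⟩
    refine ⟨⟨x, ⟨hx, ?_⟩, rfl⟩, x, hx, rfl⟩
    rwa [Set.mem_preimage, hl hx] at h1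
  · rintro ⟨⟨x, ⟨hx, hxC⟩, rfl⟩, -⟩
    refine ⟨?_, x, hx, rfl⟩
    rwa [Set.mem_preimage, hl hx]

/-- The function is pulled back to the convex set `K`, where a logarithm exists, and this logarithm
is carried back by the continuous inverse of `g`. -/
theorem exists_isLogOn_image {E : Type*} [NormedAddCommGroup E] [NormedSpace ℝ E] {K : Set E}
    (hK : IsCompact K) (hconv : Convex ℝ K) (hne : K.Nonempty) {g : E → ℂ} (hg : ContinuousOn g K)
    (hinj : Set.InjOn g K) {f : ℂ → ℂ} (hf : ContinuousOn f (g '' K)) (h0 : ∀ z ∈ g '' K, f z ≠ 0) :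
    ∃ M, IsLogOn M f (g '' K) := by
  obtain ⟨x₀, hx₀⟩ := hne
  obtain ⟨h, hh, hl⟩ := exists_continuousOn_leftInvOn hK hg hinj
  obtain ⟨L, hL⟩ := exists_isLogOn_of_starConvex (f := f ∘ g) (hconv.starConvex hx₀) hx₀
    (hf.comp hg (Set.mapsTo_image g K)) fun x hx => h0 _ ⟨x, hx, rfl⟩
  refine ⟨L ∘ h, (hL.comp hh ?_).congr ?_⟩
  · rintro _ ⟨x, hx, rfl⟩
    rwa [hl hx]
  · rintro _ ⟨x, hx, rfl⟩
    simp [hl hx]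

/-- Continuous logarithms can be glued along a connected intersection. -/
theorem IsLogOn.glue {M M' f : ℂ → ℂ} {X Y : Set ℂ} (h : IsLogOn M f X) (h' : IsLogOn M' f Y)
    (hX : ∀ z ∈ Y, z ∉ X → z ∉ closure X) (hY : ∀ z ∈ X, z ∉ Y → z ∉ closure Y)
    (hXY : IsPreconnected (X ∩ Y)) (hne : (X ∩ Y).Nonempty) :
    ∃ N, IsLogOn N f (X ∪ Y) ∧ Set.EqOn N M X := by
  classical
  obtain ⟨z₀, hz₀⟩ := hne
  -- On the connected overlap the two logarithms differ by this constant, a period of `exp`, so `M'`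
  -- can be shifted to match `M`.
  set c := M z₀ - M' z₀ with hc
  have hexpc : Complex.exp c = 1 := by
    rw [hc, Complex.exp_sub, h.exp_eq _ hz₀.1, h'.exp_eq _ hz₀.2, div_self (h.ne_zero hz₀.1)]
  have hcX : ∀ z ∈ X ∩ Y, M z = M' z + c := by
    intro z hz
    have := (h.mono Set.inter_subset_left).sub_eq hXY (h'.mono Set.inter_subset_right) hz hz₀
    rw [hc]; linear_combination this
  set N : ℂ → ℂ := fun z => if z ∈ X then M z else M' z + c with hN
  have hNX : Set.EqOn N M X := fun z hz => by simp [hN, hz]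
  have hNY : Set.EqOn N (fun z => M' z + c) Y := fun z hz => by
    by_cases hzX : z ∈ X
    · rw [hNX hzX]; exact hcX z ⟨hzX, hz⟩
    · simp [hN, hzX]
  refine ⟨N, ⟨?_, ?_⟩, hNX⟩
  · have hcontX : ContinuousOn N X := h.cont.congr hNX
    have hcontY : ContinuousOn N Y := (h'.cont.add continuousOn_const).congr hNY
    -- `hX` and `hY` say that both sets are relatively closed in the union. Away from one of them,
    -- continuity within it is vacuous, so the two continuities combine.
    have auxX : ∀ z ∈ X ∪ Y, ContinuousWithinAt N X z := fun z hz => by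
      by_cases hzX : z ∈ X
      · exact hcontX z hzX
      · have : nhdsWithin z X = ⊥ := by
          by_contra hcon
          exact hX z (hz.resolve_left hzX) hzX
            (mem_closure_iff_nhdsWithin_neBot.2 (Filter.neBot_iff.2 hcon))
        rw [ContinuousWithinAt, this]; exact Filter.tendsto_bot
    have auxY : ∀ z ∈ X ∪ Y, ContinuousWithinAt N Y z := fun z hz => by
      by_cases hzY : z ∈ Y
      · exact hcontY z hzY
      · have : nhdsWithin z Y = ⊥ := by
          by_contra hcon
          exact hY z (hz.resolve_right hzY) hzY
            (mem_closure_iff_nhdsWithin_neBot.2 (Filter.neBot_iff.2 hcon))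
        rw [ContinuousWithinAt, this]; exact Filter.tendsto_bot
    exact fun z hz => (auxX z hz).union (auxY z hz)
  · rintro z (hz | hz)
    · rw [hNX hz, h.exp_eq z hz]
    · rw [hNY hz, Complex.exp_add, hexpc, mul_one, h'.exp_eq z hz]

/-- The inner normal vector at the marked point of an embedded disc. -/
noncomputable def markNormal (f : ℂ → ℂ) : ℂ := Complex.I * fderiv ℝ f 1 Complex.I

theorem ContinuousLinearMap.det_complex (A : ℂ →L[ℝ] ℂ) :
    A.det = (A 1).re * (A Complex.I).im - (A Complex.I).re * (A 1).im := by
  rw [ContinuousLinearMap.det, ← LinearMap.det_toMatrix Complex.basisOneI, Matrix.det_fin_two]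
  simp [LinearMap.toMatrix_apply]

theorem markNormal_ne_zero {f : ℂ → ℂ} (h : 0 < (fderiv ℝ f 1).det) : markNormal f ≠ 0 := by
  intro h0
  rw [markNormal, mul_eq_zero, or_iff_right Complex.I_ne_zero] at h0
  rw [ContinuousLinearMap.det_complex, h0] at h
  simp at h

/-- With `N = markNormal f`, the image of the tangent `I` is orthogonal to `N`. The real part is
therefore `-Re ζ` times the determinant over `|N|²`: vectors pointing into the unit disc at `1` go
to the inner side. -/
theorem re_fderiv_div_markNormal {f : ℂ → ℂ} (h : 0 < (fderiv ℝ f 1).det) {ζ : ℂ}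
    (hζ : ζ.re ≤ 0) : 0 ≤ (fderiv ℝ f 1 ζ / markNormal f).re := by
  have h0 := markNormal_ne_zero h
  rw [ContinuousLinearMap.det_complex] at h
  have h1 : fderiv ℝ f 1 ζ = ζ.re • fderiv ℝ f 1 1 + ζ.im • fderiv ℝ f 1 Complex.I := by
    rw [← map_smul, ← map_smul, ← map_add]
    congr 1
    apply Complex.ext <;> simp
  rw [h1, Complex.div_re, ← add_div]
  refine div_nonneg ?_ (Complex.normSq_nonneg _)
  simp only [markNormal, Complex.add_re, Complex.add_im, Complex.real_smul, Complex.mul_re,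
    Complex.mul_im, Complex.I_re, Complex.I_im, Complex.ofReal_re, Complex.ofReal_im]
  linarith [mul_nonneg (neg_nonneg.2 hζ) h.le]

/-- Near its marked point, an embedded disc is contained in a cone around the inner normal. -/
theorem exists_cone {f : ℂ → ℂ} (hf : DifferentiableAt ℝ f 1) (h : 0 < (fderiv ℝ f 1).det) :
    ∃ δ > 0, ∀ z ∈ Metric.closedBall (0 : ℂ) 1, dist z 1 < δ →
      -(1 / 2) * ‖(f z - f 1) / markNormal f‖ ≤ ((f z - f 1) / markNormal f).re := by
  have hn := markNormal_ne_zero h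
  have hinj : Function.Injective (fderiv ℝ f 1) := by
    exact LinearMap.ker_eq_bot.1 (not_not.1 fun hcon =>
      h.ne' (LinearMap.det_eq_zero_iff_ker_ne_bot.2 hcon))
  obtain ⟨k, hk, hanti⟩ := (fderiv ℝ f 1 : ℂ →ₗ[ℝ] ℂ).exists_antilipschitzWith
    (LinearMap.ker_eq_bot.2 hinj)
  set c : ℝ := (k : ℝ)⁻¹ with hc
  have hcpos : 0 < c := inv_pos.2 (by exact_mod_cast hk)
  have hlow : ∀ ζ, c * ‖ζ‖ ≤ ‖fderiv ℝ f 1 ζ‖ := by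
    intro ζ
    have := hanti.le_mul_dist ζ 0
    simp only [dist_zero_right, map_zero] at this
    rw [hc, inv_mul_le_iff₀ (by exact_mod_cast hk)]
    exact this
  -- With `c / 3` the error `e` is at most a third of the linear term, whose real part after
  -- division by the normal is nonnegative. The sum then has norm at least twice that of `e`, which
  -- gives the factor `1 / 2` of the cone.
  have ho := hf.hasFDerivAt.isLittleO.def (c := c / 3) (by positivity)
  obtain ⟨δ, hδ, hball⟩ := Metric.eventually_nhds_iff.1 ho
  refine ⟨δ, hδ, fun z hz hzδ => ?_⟩
  have h1 := hball hzδ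
  have hre : (z - 1).re ≤ 0 := by
    have h2 : z.re ≤ 1 := (Complex.re_le_norm z).trans (by simpa using hz)
    simpa using h2
  have h2 := re_fderiv_div_markNormal h hre
  have h3 := hlow (z - 1)
  set e := f z - f 1 - fderiv ℝ f 1 (z - 1) with he
  have h4 : f z - f 1 = fderiv ℝ f 1 (z - 1) + e := by rw [he]; ring
  rw [h4, add_div, Complex.add_re]
  have h5 : -(‖e‖ / ‖markNormal f‖) ≤ (e / markNormal f).re := by
    rw [← norm_div]
    exact (abs_le.1 (Complex.abs_re_le_norm _)).1
  have h6 : (‖fderiv ℝ f 1 (z - 1)‖ - ‖e‖) / ‖markNormal f‖ ≤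
      ‖fderiv ℝ f 1 (z - 1) / markNormal f + e / markNormal f‖ := by
    rw [← add_div, norm_div]
    gcongr
    have := norm_sub_le (fderiv ℝ f 1 (z - 1) + e) e
    rw [add_sub_cancel_right] at this
    linarith
  have hnpos : 0 < ‖markNormal f‖ := norm_pos_iff.2 hn
  have h7 : 2 * (‖e‖ / ‖markNormal f‖) ≤ (‖fderiv ℝ f 1 (z - 1)‖ - ‖e‖) / ‖markNormal f‖ := by
    rw [← mul_div_assoc]
    gcongr
    linarith
  linarith

/-- On the negative real axis the real part is `-‖w‖`, which the cone excludes. -/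
theorem mem_slitPlane_of_cone {w : ℂ} (hw : w ≠ 0) (h : -(1 / 2) * ‖w‖ ≤ w.re) :
    w ∈ Complex.slitPlane := by
  by_cases hi : w.im = 0
  · left
    have hr : w.re ≠ 0 := fun h0 => hw (Complex.ext h0 hi)
    by_contra! hcon
    have h1 : ‖w‖ = |w.re| := by
      have : w = (w.re : ℂ) := Complex.ext rfl (by simpa using hi)
      conv_lhs => rw [this]
      simp
    rw [h1, abs_of_nonpos hcon] at h
    exact hr (by linarith)
  · exact Or.inr hi

/-- The point `1` is the only point of the ball with real part `1`, so removing it amounts to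
intersecting with an open half plane. -/
theorem convex_closedBall_diff_one : Convex ℝ (Metric.closedBall (0 : ℂ) 1 \ {1}) := by
  have h : Metric.closedBall (0 : ℂ) 1 \ {1} = Metric.closedBall (0 : ℂ) 1 ∩ {z | z.re < 1} := by
    ext z
    simp only [Set.mem_sdiff, Set.mem_singleton_iff, Set.mem_inter_iff]
    refine and_congr_right fun hz => ⟨fun h1 => ?_, fun h1 h2 => ?_⟩
    · have hz' : ‖z‖ ≤ 1 := by simpa using hz
      refine lt_of_le_of_ne ((Complex.re_le_norm z).trans hz') fun h2 => h1 ?_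
      have h3 := Complex.sq_norm z
      rw [Complex.normSq_apply, h2] at h3
      have h4 : z.im = 0 := by nlinarith [norm_nonneg z]
      exact Complex.ext h2 h4
    · subst h2
      exact lt_irrefl (1 : ℝ) h1
  rw [h]
  exact (convex_closedBall 0 1).inter (convex_halfSpace_lt Complex.reLm.isLinear 1)

/-- On an embedded disc there is a continuous logarithm of `z - p`, where `p` is the marked point,
which is a principal one near `p`. -/
theorem exists_isLogOn_disc {f : ℂ → ℂ} (hf : ContDiff ℝ 1 f)
    (hinj : Set.InjOn f (Metric.closedBall 0 1)) (hdet : 0 < (fderiv ℝ f 1).det) :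
    ∃ M, IsLogOn M (fun z => z - f 1) (f '' Metric.closedBall 0 1 \ {f 1}) ∧
      ∃ r > 0, ∀ z ∈ f '' Metric.closedBall 0 1, z ≠ f 1 → dist z (f 1) < r →
        M z = Complex.log ((z - f 1) / markNormal f) + Complex.log (markNormal f) ∧
        -(1 / 2) * ‖(z - f 1) / markNormal f‖ ≤ ((z - f 1) / markNormal f).re := by
  have hn := markNormal_ne_zero hdet
  have h1mem : (1 : ℂ) ∈ Metric.closedBall (0 : ℂ) 1 := by simp
  obtain ⟨δ, hδ, hcone⟩ := exists_cone (hf.differentiable one_ne_zero 1) hdet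
  obtain ⟨g, hg, hl⟩ := exists_continuousOn_leftInvOn (isCompact_closedBall (0 : ℂ) 1)
    hf.continuous.continuousOn hinj
  have hsub : ∀ z ∈ Metric.closedBall (0 : ℂ) 1, z ≠ 1 → f z - f 1 ≠ 0 := fun z hz hz1 h =>
    hz1 (hinj hz h1mem (sub_eq_zero.1 h))
  have h0mem : (0 : ℂ) ∈ Metric.closedBall (0 : ℂ) 1 \ {1} := by simp
  obtain ⟨L, hL⟩ := exists_isLogOn_of_starConvex (f := fun z => f z - f 1)
    (convex_closedBall_diff_one.starConvex h0mem) h0mem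
    (hf.continuous.continuousOn.sub continuousOn_const) fun z hz => hsub z hz.1 hz.2
  set N := (Metric.closedBall (0 : ℂ) 1 \ {1}) ∩ Metric.ball 1 δ with hN
  have hNconv : IsPreconnected N :=
    (convex_closedBall_diff_one.inter (convex_ball 1 δ)).isPreconnected
  have hP : IsLogOn (fun z => Complex.log ((f z - f 1) / markNormal f) +
      Complex.log (markNormal f)) (fun z => f z - f 1) N := by
    refine ((IsLogOn.principal (f := fun z => (f z - f 1) / markNormal f) ?_ ?_).mul
      (IsLogOn.const hn)).congr fun z _ => div_mul_cancel₀ _ hn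
    · exact ((hf.continuous.continuousOn.sub continuousOn_const).div_const _)
    · intro z hz
      exact mem_slitPlane_of_cone (div_ne_zero (hsub z hz.1.1 hz.1.2) hn)
        (hcone z hz.1.1 (Metric.mem_ball.1 hz.2))
  obtain ⟨x₀, hx₀⟩ : N.Nonempty := by
    have hm : 0 < min δ 1 := lt_min hδ one_pos
    have hm1 := min_le_left δ 1
    have hm2 := min_le_right δ 1
    refine ⟨((1 - min δ 1 / 2 : ℝ) : ℂ), ⟨?_, ?_⟩, ?_⟩
    · rw [mem_closedBall_zero_iff, Complex.norm_real, Real.norm_of_nonneg (by linarith)]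
      linarith
    · intro h
      have : (1 - min δ 1 / 2 : ℝ) = 1 := by exact_mod_cast Set.mem_singleton_iff.1 h
      linarith
    · rw [Metric.mem_ball, Complex.dist_eq]
      have : ((1 - min δ 1 / 2 : ℝ) : ℂ) - 1 = ((-(min δ 1 / 2) : ℝ) : ℂ) := by push_cast; ring
      rw [this, Complex.norm_real, norm_neg, Real.norm_of_nonneg (by linarith)]
      linarith
  -- Near `1` the logarithm `L` and the principal one differ by this constant, as `N` is convex;
  -- subtracting it makes the logarithm principal near the marked point.
  set c := L x₀ - (Complex.log ((f x₀ - f 1) / markNormal f) + Complex.log (markNormal f)) with hc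
  have hexpc : Complex.exp c = 1 := by
    rw [hc, Complex.exp_sub, hL.exp_eq _ hx₀.1, hP.exp_eq _ hx₀, div_self (hL.ne_zero hx₀.1)]
  refine ⟨fun z => L (g z) - c, ⟨?_, ?_⟩, ?_⟩
  · refine (hL.cont.comp (hg.mono Set.sdiff_subset) ?_).sub continuousOn_const
    rintro _ ⟨⟨z, hz, rfl⟩, hz1⟩
    rw [hl hz]
    exact ⟨hz, fun h => hz1 (by rw [Set.mem_singleton_iff.1 h]; rfl)⟩
  · rintro _ ⟨⟨z, hz, rfl⟩, hz1⟩
    rw [hl hz, Complex.exp_sub, hexpc, div_one]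
    exact hL.exp_eq z ⟨hz, fun h => hz1 (by rw [Set.mem_singleton_iff.1 h]; rfl)⟩
  -- Continuity of the inverse `g`: points of the image close to `f 1` come from points close to
  -- `1`, where the cone applies.
  · obtain ⟨r, hr, hball⟩ := Metric.continuousWithinAt_iff.1 (hg (f 1) ⟨1, h1mem, rfl⟩) δ hδ
    refine ⟨r, hr, ?_⟩
    rintro _ ⟨z, hz, rfl⟩ hz1 hzr
    have h2 := hball ⟨z, hz, rfl⟩ hzr
    rw [hl hz, hl h1mem] at h2
    have hz1' : z ≠ 1 := fun h => hz1 (by rw [h])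
    refine ⟨?_, hcone z hz h2⟩
    simp only
    rw [hl hz]
    have := (hL.mono Set.inter_subset_left).sub_eq hNconv hP (x := z) (y := x₀) ⟨⟨hz, hz1'⟩, h2⟩ hx₀
    rw [hc]
    linear_combination this

/-! ### Independence of the core -/

/-- On the union of an embedded disc and two further pieces attached to each other in a row there
is a continuous logarithm of `z - p`, where `p` is the marked point of the disc. -/
theorem exists_isLogOn_chain {f : ℂ → ℂ} (hf : ContDiff ℝ 1 f)
    (hinj : Set.InjOn f (Metric.closedBall 0 1)) (hdet : 0 < (fderiv ℝ f 1).det) {Q D' : Set ℂ}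
    (hQ : IsClosed Q) (hD' : IsClosed D')
    (hLQ : ∃ M, IsLogOn M (fun z => z - f 1) Q) (hLD' : ∃ M, IsLogOn M (fun z => z - f 1) D')
    (hpQ : f 1 ∉ Q) (hDQ : IsPreconnected (f '' Metric.closedBall 0 1 ∩ Q))
    (hDQne : (f '' Metric.closedBall 0 1 ∩ Q).Nonempty)
    (hQD' : IsPreconnected (Q ∩ D')) (hQD'ne : (Q ∩ D').Nonempty)
    (hDD' : Disjoint (f '' Metric.closedBall 0 1) D') :
    ∃ M, IsLogOn M (fun z => z - f 1) ((f '' Metric.closedBall 0 1 ∪ Q ∪ D') \ {f 1}) ∧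
      ∃ r > 0, ∀ z ∈ f '' Metric.closedBall 0 1 ∪ Q ∪ D', z ≠ f 1 → dist z (f 1) < r →
        M z = Complex.log ((z - f 1) / markNormal f) + Complex.log (markNormal f) ∧
        -(1 / 2) * ‖(z - f 1) / markNormal f‖ ≤ ((z - f 1) / markNormal f).re := by
  set D := f '' Metric.closedBall 0 1 with hDdef
  have hDc : IsClosed D := ((isCompact_closedBall (0 : ℂ) 1).image hf.continuous).isClosed
  have hpD : f 1 ∈ D := ⟨1, by simp, rfl⟩
  have hpD' : f 1 ∉ D' := fun h => Set.disjoint_left.1 hDD' hpD h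
  obtain ⟨M, hM, r, hr, hMr⟩ := exists_isLogOn_disc hf hinj hdet
  obtain ⟨MQ, hMQ⟩ := hLQ
  obtain ⟨MD', hMD'⟩ := hLD'
  have hcl : closure (D \ {f 1}) ⊆ D := closure_minimal Set.sdiff_subset hDc
  have hDQ' : (D \ {f 1}) ∩ Q = D ∩ Q := by
    ext z
    refine ⟨fun h => ⟨h.1.1, h.2⟩, fun h => ⟨⟨h.1, fun h' => hpQ ?_⟩, h.2⟩⟩
    rw [← Set.mem_singleton_iff.1 h']; exact h.2
  obtain ⟨N, hN, hNM⟩ := hM.glue hMQ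
    (fun z hz hz' hz'' => hz' ⟨hcl hz'', fun h => hpQ (by rw [← Set.mem_singleton_iff.1 h]; exact hz)⟩)
    (fun z _ hz' hz'' => hz' (hQ.closure_eq ▸ hz'')) (hDQ' ▸ hDQ) (hDQ' ▸ hDQne)
  have hcap : (D \ {f 1} ∪ Q) ∩ D' = Q ∩ D' := by
    ext z
    refine ⟨fun h => ⟨h.1.resolve_left fun h1 => Set.disjoint_left.1 hDD' h1.1 h.2, h.2⟩,
      fun h => ⟨Or.inr h.1, h.2⟩⟩
  have hcl2 : closure (D \ {f 1} ∪ Q) ⊆ D ∪ Q :=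
    closure_minimal (Set.union_subset_union_left _ Set.sdiff_subset) (hDc.union hQ)
  obtain ⟨N', hN', hN'N⟩ := hN.glue hMD'
    (fun z hz hz' hz'' => (hcl2 hz'').elim (fun h => Set.disjoint_left.1 hDD' h hz)
      fun h => hz' (Or.inr h))
    (fun z _ hz' hz'' => hz' (hD'.closure_eq ▸ hz'')) (hcap ▸ hQD') (hcap ▸ hQD'ne)
  have hset : (D ∪ Q ∪ D') \ {f 1} = D \ {f 1} ∪ Q ∪ D' := by
    rw [Set.union_sdiff_distrib, Set.union_sdiff_distrib, Set.sdiff_singleton_eq_self hpQ,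
      Set.sdiff_singleton_eq_self hpD']
  -- A small ball around the marked point misses the other two pieces, so the normalization found on
  -- the disc survives the gluing.
  obtain ⟨r', hr', hball⟩ := Metric.isOpen_iff.1 (hQ.union hD').isOpen_compl (f 1)
    (by simp [hpQ, hpD'])
  refine ⟨N', hset ▸ hN', min r r', lt_min hr hr', fun z hz hz1 hzr => ?_⟩
  have hzD : z ∈ D := by
    have := hball (Metric.mem_ball.2 (hzr.trans_le (min_le_right _ _)))
    rw [Set.mem_compl_iff, Set.mem_union, not_or] at this
    exact (hz.resolve_right this.2).resolve_right this.1
  have hzD1 : z ∈ D \ {f 1} := ⟨hzD, fun h => hz1 (Set.mem_singleton_iff.1 h)⟩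
  rw [hN'N (Or.inl hzD1), hNM hzD1]
  exact hMr z hzD hz1 (hzr.trans_le (min_le_left _ _))

/-- The turning of the secants of an arc from its initial point, in terms of a logarithm of `z - p`
on a region containing the arc. -/
theorem logVar_secant_eq {α : ℝ → ℂ} (hα : ContDiff ℝ 1 α) (hinj : Set.InjOn α (Set.Icc 0 1))
    (h0 : ∀ t ∈ Set.Icc (0 : ℝ) 1, deriv α t ≠ 0) {R : Set ℂ} {M : ℂ → ℂ} {ν : ℂ} (hν : ν ≠ 0)
    (hM : IsLogOn M (fun z => z - α 0) (R \ {α 0})) (hR : ∀ t ∈ Set.Icc (0 : ℝ) 1, α t ∈ R)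
    {r : ℝ} (hr : 0 < r) (hMr : ∀ z ∈ R, z ≠ α 0 → dist z (α 0) < r →
        M z = Complex.log ((z - α 0) / ν) + Complex.log ν ∧
        -(1 / 2) * ‖(z - α 0) / ν‖ ≤ ((z - α 0) / ν).re) :
    logVar (secant α 0) 0 1 =
      M (α 1) - Complex.log (deriv α 0 / ν) - Complex.log ν := by
  have h0mem : (0 : ℝ) ∈ Set.Icc (0 : ℝ) 1 := by simp
  have hsc : Continuous (secant α 0) :=
    (continuous_secant hα).comp (f := fun t : ℝ => ((0 : ℝ), t)) (by fun_prop)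
  obtain ⟨H, hH⟩ := exists_isLogOn_Icc zero_le_one hsc.continuousOn fun t ht =>
    secant_ne_zero_of_injOn hα hinj h0 h0mem ht
  have hne : ∀ t ∈ Set.Ioc (0 : ℝ) 1, α t ≠ α 0 := fun t ht h =>
    ht.1.ne' (hinj ⟨ht.1.le, ht.2⟩ h0mem h)
  have hmul : ∀ t : ℝ, (t : ℂ) * secant α 0 t = α t - α 0 := fun t => by
    have := mul_secant hα 0 t
    rwa [sub_zero] at this
  have l1 : IsLogOn (M ∘ α) (fun t => α t - α 0) (Set.Ioc 0 1) :=
    hM.comp hα.continuous.continuousOn fun t ht =>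
      ⟨hR t ⟨ht.1.le, ht.2⟩, fun h => hne t ht (Set.mem_singleton_iff.1 h)⟩
  have l2 : IsLogOn (fun t : ℝ => Complex.log (t : ℂ) + H t) (fun t => α t - α 0) (Set.Ioc 0 1) :=
    ((IsLogOn.principal Complex.continuous_ofReal.continuousOn fun t ht =>
      Complex.ofReal_mem_slitPlane.2 ht.1).mul (hH.mono Set.Ioc_subset_Icc_self)).congr
      fun t _ => hmul t
  -- For `t > 0` both `M (α t)` and `log t + H t` are logarithms of `α t - α 0`, so their difference
  -- is the constant `c`. Letting `t` tend to `0`, where `M` is principal, evaluates it.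
  set c := M (α 1) - H 1 with hc
  have hconst : ∀ t ∈ Set.Ioc (0 : ℝ) 1, M (α t) - Complex.log (t : ℂ) = H t + c := by
    intro t ht
    have := l1.sub_eq isPreconnected_Ioc l2 ht (y := 1) (by simp)
    simp only [Function.comp_apply, Complex.ofReal_one, Complex.log_one] at this
    rw [hc]; linear_combination this
  have hev : ∀ᶠ t in nhdsWithin (0 : ℝ) (Set.Ioi 0), t ∈ Set.Ioc (0 : ℝ) 1 ∧ dist (α t) (α 0) < r := by
    refine Filter.Eventually.and (Ioc_mem_nhdsGT zero_lt_one) ?_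
    exact nhdsWithin_le_nhds (Metric.continuousAt_iff'.1 hα.continuous.continuousAt r hr)
  have hcone : ∀ᶠ t in nhdsWithin (0 : ℝ) (Set.Ioi 0),
      -(1 / 2) * ‖secant α 0 t / ν‖ ≤ (secant α 0 t / ν).re := by
    filter_upwards [hev] with t ht
    have h1 := (hMr (α t) (hR t ⟨ht.1.1.le, ht.1.2⟩) (hne t ht.1) ht.2).2
    rw [← hmul t, mul_div_assoc, Complex.re_ofReal_mul, norm_mul, Complex.norm_real,
      Real.norm_of_nonneg ht.1.1.le] at h1
    have h2 : t * (-(1 / 2) * ‖secant α 0 t / ν‖) ≤ t * (secant α 0 t / ν).re := by linarith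
    exact le_of_mul_le_mul_left h2 ht.1.1
  have hlim : Filter.Tendsto (fun t => secant α 0 t / ν) (nhdsWithin (0 : ℝ) (Set.Ioi 0))
      (nhds (deriv α 0 / ν)) := by
    have h1 : ContinuousAt (fun t => secant α 0 t / ν) 0 := (hsc.div_const ν).continuousAt
    have h2 := h1.tendsto
    rw [secant_self] at h2
    exact h2.mono_left nhdsWithin_le_nhds
  -- The cone is closed, so the limiting direction also avoids the cut. This allows arcs that are
  -- tangent to the boundary of the disc at the marked point.
  have hslit : deriv α 0 / ν ∈ Complex.slitPlane := by
    refine mem_slitPlane_of_cone (div_ne_zero (h0 0 h0mem) hν) ?_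
    exact le_of_tendsto_of_tendsto (hlim.norm.const_mul _)
      ((Complex.continuous_re.tendsto _).comp hlim) hcone
  have hloglim := (hlim.clog hslit).add_const (Complex.log ν)
  have hHlim : Filter.Tendsto (fun t => H t + c) (nhdsWithin (0 : ℝ) (Set.Ioi 0))
      (nhds (H 0 + c)) := by
    refine Filter.Tendsto.add_const c ?_
    have := (hH.cont 0 h0mem).mono (t := Set.Icc (0 : ℝ) 1) le_rfl
    have h3 : nhdsWithin (0 : ℝ) (Set.Ioi 0) ≤ nhdsWithin 0 (Set.Icc 0 1) := by
      rw [nhdsWithin_le_iff]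
      exact Filter.mem_of_superset (Ioc_mem_nhdsGT zero_lt_one) Set.Ioc_subset_Icc_self
    exact this.tendsto.mono_left h3
  have heq : (fun t => Complex.log (secant α 0 t / ν) + Complex.log ν) =ᶠ[nhdsWithin (0 : ℝ) (Set.Ioi 0)]
      fun t => H t + c := by
    filter_upwards [hev] with t ht
    have h1 := (hMr (α t) (hR t ⟨ht.1.1.le, ht.1.2⟩) (hne t ht.1) ht.2).1
    have h2 := hconst t ht.1
    rw [← hmul t, mul_div_assoc, Complex.log_ofReal_mul ht.1.1 (div_ne_zero
      (secant_ne_zero_of_injOn hα hinj h0 h0mem ⟨ht.1.1.le, ht.1.2⟩) hν),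
      Complex.ofReal_log ht.1.1.le] at h1
    rw [← h2, h1]; ring
  have := tendsto_nhds_unique (hloglim.congr' heq) hHlim
  rw [hH.logVar_eq zero_le_one]
  rw [hc] at this
  linear_combination this

theorem deriv_reverse (α : ℝ → ℂ) (t : ℝ) :
    deriv (fun t => α (1 - t)) t = -deriv α (1 - t) := deriv_comp_const_sub α 1 t

theorem secant_reverse (α : ℝ → ℂ) (t : ℝ) :
    secant (fun t => α (1 - t)) 0 t = -secant α 1 (1 - t) := by
  simp only [secant, deriv_reverse]
  rw [intervalIntegral.integral_neg]
  congr 2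
  ext u
  congr 1
  ring

/-- The turning of the secants of an arc to its final point, in terms of a logarithm of `z - q`
on a region containing the arc. -/
theorem logVar_secant_eq' {α : ℝ → ℂ} (hα : ContDiff ℝ 1 α) (hinj : Set.InjOn α (Set.Icc 0 1))
    (h0 : ∀ t ∈ Set.Icc (0 : ℝ) 1, deriv α t ≠ 0) {R : Set ℂ} {M : ℂ → ℂ} {ν : ℂ} (hν : ν ≠ 0)
    (hM : IsLogOn M (fun z => z - α 1) (R \ {α 1})) (hR : ∀ t ∈ Set.Icc (0 : ℝ) 1, α t ∈ R)
    {r : ℝ} (hr : 0 < r) (hMr : ∀ z ∈ R, z ≠ α 1 → dist z (α 1) < r →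
        M z = Complex.log ((z - α 1) / ν) + Complex.log ν ∧
        -(1 / 2) * ‖(z - α 1) / ν‖ ≤ ((z - α 1) / ν).re) :
    logVar (secant α 1) 0 1 =
      -(M (α 0) - Complex.log (-deriv α 1 / ν) - Complex.log ν) := by
  have hmem : ∀ t ∈ Set.Icc (0 : ℝ) 1, 1 - t ∈ Set.Icc (0 : ℝ) 1 := fun t ht =>
    ⟨by linarith [ht.2], by linarith [ht.1]⟩
  have h1 := logVar_secant_eq (α := fun t => α (1 - t)) (R := R) (M := M) (ν := ν) (r := r)
    (hα.comp (contDiff_const.sub contDiff_id))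
    (fun s hs t ht h => by have := hinj (hmem s hs) (hmem t ht) h; linarith)
    (fun t ht => by rw [deriv_reverse]; exact neg_ne_zero.2 (h0 _ (hmem t ht))) hν
    (by simpa using hM) (fun t ht => hR _ (hmem t ht)) hr (by simpa using hMr)
  have hsc : Continuous (secant α 1) :=
    (continuous_secant hα).comp (f := fun t : ℝ => ((1 : ℝ), t)) (by fun_prop)
  have hs0 : ∀ t ∈ Set.Icc (0 : ℝ) 1, secant α 1 t ≠ 0 := fun t ht =>
    secant_ne_zero_of_injOn hα hinj h0 (by simp) ht
  have h2 : secant (fun t => α (1 - t)) 0 = fun t => -secant α 1 (1 - t) :=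
    funext (secant_reverse α)
  rw [h2, logVar_neg (f := fun t => secant α 1 (1 - t)) zero_le_one
    (hsc.comp (by fun_prop)).continuousOn (fun t ht => hs0 _ (hmem t ht)),
    logVar_reverse hsc.continuousOn hs0, deriv_reverse] at h1
  simp only [sub_self, sub_zero] at h1
  rw [← h1]; ring

/-! ### The region formed by a band and its two discs. -/

namespace PlanarWeb

variable {n : ℕ} {V B A : Type*}

theorem disc_disjoint_band (Γ : PlanarWeb n V B A) (v : V) (b : B) :
    Disjoint (Γ.disc v '' Metric.closedBall 0 1) (Γ.band b '' (Set.Icc 0 1 ×ˢ Set.Ioo 0 1)) :=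
  Γ.pieces_disjoint (i := Sum.inl v) (j := Sum.inr (Sum.inl b)) (by simp)

theorem disc_disjoint_disc (Γ : PlanarWeb n V B A) {v w : V} (h : v ≠ w) :
    Disjoint (Γ.disc v '' Metric.closedBall 0 1) (Γ.disc w '' Metric.closedBall 0 1) :=
  Γ.pieces_disjoint (i := Sum.inl v) (j := Sum.inl w) (by simpa using h)

theorem src_ne_tgt (Γ : PlanarWeb n V B A) (b : B) : Γ.src b ≠ Γ.tgt b := fun h =>
  Γ.tgt_isSink b (h ▸ Γ.src_isSource b)

theorem src_attached' (Γ : PlanarWeb n V B A) (b : B) :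
    Γ.band b '' (Set.Icc 0 1 ×ˢ {0}) ⊆ Γ.disc (Γ.src b) '' Metric.closedBall 0 1 :=
  (Γ.src_attached b).trans (Set.image_mono Metric.sphere_subset_closedBall)

theorem tgt_attached' (Γ : PlanarWeb n V B A) (b : B) :
    Γ.band b '' (Set.Icc 0 1 ×ˢ {1}) ⊆ Γ.disc (Γ.tgt b) '' Metric.closedBall 0 1 :=
  (Γ.tgt_attached b).trans (Set.image_mono Metric.sphere_subset_closedBall)

theorem band_subset (Γ : PlanarWeb n V B A) (b : B) : Γ.band b '' (Set.Icc 0 1 ×ˢ Set.Icc 0 1) ⊆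
    Γ.band b '' (Set.Icc 0 1 ×ˢ {0}) ∪ Γ.band b '' (Set.Icc 0 1 ×ˢ Set.Ioo 0 1) ∪
      Γ.band b '' (Set.Icc 0 1 ×ˢ {1}) := by
  rintro _ ⟨⟨x, y⟩, ⟨hx, hy⟩, rfl⟩
  simp only at hx hy
  rcases hy.1.eq_or_lt with h | h
  · exact Or.inl (Or.inl ⟨(x, y), ⟨hx, h.symm⟩, rfl⟩)
  rcases hy.2.eq_or_lt with h' | h'
  · exact Or.inr ⟨(x, y), ⟨hx, h'⟩, rfl⟩
  · exact Or.inl (Or.inr ⟨(x, y), ⟨hx, h, h'⟩, rfl⟩)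

/-- The overlap with the closed band is a single edge, hence connected, as gluing the logarithms
requires. The open band and the sink disc are disjoint from the source disc. -/
theorem src_inter_band (Γ : PlanarWeb n V B A) (b : B) :
    Γ.disc (Γ.src b) '' Metric.closedBall 0 1 ∩ Γ.band b '' (Set.Icc 0 1 ×ˢ Set.Icc 0 1) =
      Γ.band b '' (Set.Icc 0 1 ×ˢ {0}) := by
  ext z
  constructor
  · rintro ⟨h1, h2⟩
    rcases Γ.band_subset b h2 with (h | h) | h
    · exact h
    · exact (Set.disjoint_left.1 (Γ.disc_disjoint_band _ _) h1 h).elim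
    · exact (Set.disjoint_left.1 (Γ.disc_disjoint_disc (Γ.src_ne_tgt b)) h1
        (Γ.tgt_attached' b h)).elim
  · intro h
    refine ⟨Γ.src_attached' b h, Set.image_mono (Set.prod_mono le_rfl ?_) h⟩
    simp

theorem band_inter_tgt (Γ : PlanarWeb n V B A) (b : B) :
    Γ.disc (Γ.tgt b) '' Metric.closedBall 0 1 ∩ Γ.band b '' (Set.Icc 0 1 ×ˢ Set.Icc 0 1) =
      Γ.band b '' (Set.Icc 0 1 ×ˢ {1}) := by
  ext z
  constructor
  · rintro ⟨h1, h2⟩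
    rcases Γ.band_subset b h2 with (h | h) | h
    · exact (Set.disjoint_left.1 (Γ.disc_disjoint_disc (Γ.src_ne_tgt b).symm) h1
        (Γ.src_attached' b h)).elim
    · exact (Set.disjoint_left.1 (Γ.disc_disjoint_band _ _) h1 h).elim
    · exact h
  · intro h
    refine ⟨Γ.tgt_attached' b h, Set.image_mono (Set.prod_mono le_rfl ?_) h⟩
    simp

theorem mark_notMem_band (Γ : PlanarWeb n V B A) (v : V) (b : B) :
    Γ.disc v 1 ∉ Γ.band b '' (Set.Icc 0 1 ×ˢ Set.Icc 0 1) := by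
  intro h
  rcases Γ.band_subset b h with (h | h) | h
  · exact Γ.mark_notMem_src v b h
  · exact Set.disjoint_left.1 (Γ.disc_disjoint_band v b) ⟨1, by simp, rfl⟩ h
  · exact Γ.mark_notMem_tgt v b h

theorem markNormal_disc_ne_zero (Γ : PlanarWeb n V B A) (v : V) : markNormal (Γ.disc v) ≠ 0 :=
  markNormal_ne_zero (Γ.disc_det_pos v 1 (by simp))

theorem disc_contDiff (Γ : PlanarWeb n V B A) (v : V) : ContDiff ℝ 1 (Γ.disc v) :=
  (Γ.disc_smooth v).of_le (by exact_mod_cast le_top)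

theorem disc_isClosed (Γ : PlanarWeb n V B A) (v : V) :
    IsClosed (Γ.disc v '' Metric.closedBall 0 1) :=
  ((isCompact_closedBall (0 : ℂ) 1).image (Γ.disc_contDiff v).continuous).isClosed

theorem band_isClosed (Γ : PlanarWeb n V B A) (b : B) :
    IsClosed (Γ.band b '' (Set.Icc 0 1 ×ˢ Set.Icc 0 1)) :=
  ((isCompact_Icc.prod isCompact_Icc).image (Γ.band_smooth b).continuous).isClosed

theorem exists_isLogOn_disc_sub (Γ : PlanarWeb n V B A) {v : V} {p : ℂ}
    (hp : p ∉ Γ.disc v '' Metric.closedBall 0 1) :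
    ∃ M, IsLogOn M (fun z => z - p) (Γ.disc v '' Metric.closedBall 0 1) :=
  exists_isLogOn_image (isCompact_closedBall _ _) (convex_closedBall _ _) ⟨0, by simp⟩
    (Γ.disc_contDiff v).continuous.continuousOn (Γ.disc_injOn v) (by fun_prop)
    fun z hz h => hp (by rwa [← sub_eq_zero.1 h])

theorem exists_isLogOn_band_sub (Γ : PlanarWeb n V B A) {b : B} {p : ℂ}
    (hp : p ∉ Γ.band b '' (Set.Icc 0 1 ×ˢ Set.Icc 0 1)) :
    ∃ M, IsLogOn M (fun z => z - p) (Γ.band b '' (Set.Icc 0 1 ×ˢ Set.Icc 0 1)) :=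
  exists_isLogOn_image (isCompact_Icc.prod isCompact_Icc) ((convex_Icc _ _).prod (convex_Icc _ _))
    ⟨(0, 0), by simp⟩ (Γ.band_smooth b).continuous.continuousOn (Γ.band_injOn b) (by fun_prop)
    fun z hz h => hp (by rwa [← sub_eq_zero.1 h])

theorem band_end_isPreconnected (Γ : PlanarWeb n V B A) (b : B) (c : ℝ) :
    IsPreconnected (Γ.band b '' (Set.Icc 0 1 ×ˢ {c})) :=
  (((convex_Icc (0 : ℝ) 1).prod (convex_singleton c)).isPreconnected).image _
    (Γ.band_smooth b).continuous.continuousOn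

theorem band_end_nonempty (Γ : PlanarWeb n V B A) (b : B) (c : ℝ) :
    (Γ.band b '' (Set.Icc 0 1 ×ˢ {c})).Nonempty :=
  ⟨Γ.band b (0, c), (0, c), by simp, rfl⟩

/-- The turning of an arc of a core is the sum of a quantity which does not depend on the core and
of the angles of the arc with the normal vectors at the marked points. -/
theorem exists_logVar_core_eq (Γ : PlanarWeb n V B A) (b : B) : ∃ K : ℂ, ∀ C : Γ.Core,
    logVar (deriv (C.arc b)) 0 1 = K +
      Complex.log (-deriv (C.arc b) 1 / markNormal (Γ.disc (Γ.tgt b))) -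
      Complex.log (deriv (C.arc b) 0 / markNormal (Γ.disc (Γ.src b))) := by
  set D := Γ.disc (Γ.src b) '' Metric.closedBall 0 1 with hD
  set D' := Γ.disc (Γ.tgt b) '' Metric.closedBall 0 1 with hD'
  set Q := Γ.band b '' (Set.Icc 0 1 ×ˢ Set.Icc 0 1) with hQ
  have hdisj : Disjoint D D' := Γ.disc_disjoint_disc (Γ.src_ne_tgt b)
  have hsD : Γ.disc (Γ.src b) 1 ∈ D := ⟨1, by simp, rfl⟩
  have htD : Γ.disc (Γ.tgt b) 1 ∈ D' := ⟨1, by simp, rfl⟩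
  obtain ⟨M, hM, r, hr, hMr⟩ := exists_isLogOn_chain (Γ.disc_contDiff (Γ.src b))
    (Γ.disc_injOn _) (Γ.disc_det_pos _ 1 (by simp)) (Γ.band_isClosed b) (Γ.disc_isClosed (Γ.tgt b))
    (Γ.exists_isLogOn_band_sub (Γ.mark_notMem_band _ b))
    (Γ.exists_isLogOn_disc_sub fun h => Set.disjoint_left.1 hdisj hsD h) (Γ.mark_notMem_band _ b)
    (Γ.src_inter_band b ▸ Γ.band_end_isPreconnected b 0)
    (Γ.src_inter_band b ▸ Γ.band_end_nonempty b 0)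
    (Set.inter_comm _ _ ▸ Γ.band_inter_tgt b ▸ Γ.band_end_isPreconnected b 1)
    (Set.inter_comm _ _ ▸ Γ.band_inter_tgt b ▸ Γ.band_end_nonempty b 1) hdisj
  obtain ⟨M', hM', r', hr', hMr'⟩ := exists_isLogOn_chain (Γ.disc_contDiff (Γ.tgt b))
    (Γ.disc_injOn _) (Γ.disc_det_pos _ 1 (by simp)) (Γ.band_isClosed b) (Γ.disc_isClosed (Γ.src b))
    (Γ.exists_isLogOn_band_sub (Γ.mark_notMem_band _ b))
    (Γ.exists_isLogOn_disc_sub fun h => Set.disjoint_left.1 hdisj h htD) (Γ.mark_notMem_band _ b)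
    (Γ.band_inter_tgt b ▸ Γ.band_end_isPreconnected b 1)
    (Γ.band_inter_tgt b ▸ Γ.band_end_nonempty b 1)
    (Set.inter_comm _ _ ▸ Γ.src_inter_band b ▸ Γ.band_end_isPreconnected b 0)
    (Set.inter_comm _ _ ▸ Γ.src_inter_band b ▸ Γ.band_end_nonempty b 0) hdisj.symm
  -- `M` and `M'` were chosen from the region alone, before any core; the core enters only through
  -- its tangents at the two marked points.
  refine ⟨M (Γ.disc (Γ.tgt b) 1) - Complex.log (markNormal (Γ.disc (Γ.src b))) -
    M' (Γ.disc (Γ.src b) 1) + Complex.log (markNormal (Γ.disc (Γ.tgt b))), fun C => ?_⟩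
  have hα : ContDiff ℝ 1 (C.arc b) := (C.smooth b).of_le (by exact_mod_cast le_top)
  have hmem : ∀ t ∈ Set.Icc (0 : ℝ) 1, C.arc b t ∈ D ∪ Q ∪ D' := fun t ht => by
    have := C.mem b t ht
    rwa [Set.union_comm Q D] at this
  have hmem' : ∀ t ∈ Set.Icc (0 : ℝ) 1, C.arc b t ∈ D' ∪ Q ∪ D := fun t ht => by
    have := hmem t ht
    rcases this with (h | h) | h
    · exact Or.inr h
    · exact Or.inl (Or.inr h)
    · exact Or.inl (Or.inl h)
  rw [← C.start b] at hM hMr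
  rw [← C.finish b] at hM' hMr'
  rw [logVar_deriv_eq_secant hα (C.injOn b) (C.immersion b),
    logVar_secant_eq hα (C.injOn b) (C.immersion b) (Γ.markNormal_disc_ne_zero _) hM hmem hr hMr,
    logVar_secant_eq' hα (C.injOn b) (C.immersion b) (Γ.markNormal_disc_ne_zero _) hM' hmem' hr' hMr',
    C.start, C.finish]
  ring

theorem sameRay_div {z w c : ℂ} (h : SameRay ℝ z w) : SameRay ℝ (z / c) (w / c) := by
  have := h.map (LinearMap.mulRight ℝ c⁻¹)
  simpa [div_eq_mul_inv] using this

/-- The weighted sum of the indices of the bands does not depend on the core. -/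
theorem Core.sum_ind_eq [Fintype B] {Γ : PlanarWeb n V B A} (C C' : Γ.Core) (S : Γ.State) :
    ∑ b, C.ind b * labelWeight (S.label (Sum.inl b)) =
      ∑ b, C'.ind b * labelWeight (S.label (Sum.inl b)) := by
  choose K hK using Γ.exists_logVar_core_eq
  have key : ∀ C : Γ.Core, ∑ b, C.ind b * labelWeight (S.label (Sum.inl b)) =
      ∑ b, (K b).im / (2 * Real.pi) * labelWeight (S.label (Sum.inl b)) := by
    intro C
    refine S.sum_eq_of_sub_eq
      (x := fun b => (deriv (C.arc b) 0 / markNormal (Γ.disc (Γ.src b))).arg / (2 * Real.pi))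
      (y := fun b => (-deriv (C.arc b) 1 / markNormal (Γ.disc (Γ.tgt b))).arg / (2 * Real.pi))
      ?_ ?_ ?_
    · intro b b' h
      have h1 := C.tangent_src b b' h
      rw [← h, arg_eq_of_sameRay (div_ne_zero (C.immersion b 0 (by simp))
        (Γ.markNormal_disc_ne_zero _)) (div_ne_zero (C.immersion b' 0 (by simp))
        (Γ.markNormal_disc_ne_zero _)) (sameRay_div h1)]
    · intro b b' h
      have h1 := (C.tangent_tgt b b' h).neg
      rw [← h, arg_eq_of_sameRay (div_ne_zero (neg_ne_zero.2 (C.immersion b 1 (by simp)))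
        (Γ.markNormal_disc_ne_zero _)) (div_ne_zero (neg_ne_zero.2 (C.immersion b' 1 (by simp)))
        (Γ.markNormal_disc_ne_zero _)) (sameRay_div h1)]
    · intro b
      rw [C.ind_eq, hK b C, Complex.sub_im, Complex.add_im, Complex.log_im, Complex.log_im]
      ring
  rw [key C, key C']

end PlanarWeb

/-! ### Isotopies -/

/-- The derivative of a family of maps of the plane along a family of tangent vectors. -/
theorem continuous_fderiv_family {Φ : ℝ → ℂ → ℂ} (hΦ : ContDiff ℝ ∞ fun p : ℝ × ℂ => Φ p.1 p.2)
    {X : Type*} [TopologicalSpace X] {τ : X → ℝ} {ζ v : X → ℂ} (hτ : Continuous τ)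
    (hζ : Continuous ζ) (hv : Continuous v) :
    Continuous fun x => fderiv ℝ (Φ (τ x)) (ζ x) (v x) := by
  have h1 : ∀ t z w, fderiv ℝ (Φ t) z w =
      fderiv ℝ (fun p : ℝ × ℂ => Φ p.1 p.2) (t, z) (0, w) := by
    intro t z w
    have h2 : HasFDerivAt (fun z : ℂ => ((t, z) : ℝ × ℂ)) (ContinuousLinearMap.inr ℝ ℝ ℂ) z :=
      hasFDerivAt_prodMk_right t z
    have h3 := ((hΦ.differentiable (by simp)).differentiableAt (x := (t, z))).hasFDerivAt.comp z h2
    have h4 : HasFDerivAt (Φ t) _ z := h3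
    rw [h4.fderiv]
    simp
  simp only [h1]
  exact ((hΦ.continuous_fderiv (by simp)).comp (hτ.prodMk hζ)).clm_apply
    (continuous_const.prodMk hv)

theorem fderiv_apply_ne_zero {f : ℂ → ℂ} {z v : ℂ} (h : (fderiv ℝ f z).det ≠ 0) (hv : v ≠ 0) :
    fderiv ℝ f z v ≠ 0 := by
  have h1 : LinearMap.ker (fderiv ℝ f z : ℂ →ₗ[ℝ] ℂ) = ⊥ :=
    not_not.1 fun hcon => h (LinearMap.det_eq_zero_iff_ker_ne_bot.2 hcon)
  intro h2
  exact hv (LinearMap.ker_eq_bot'.1 h1 v h2)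

theorem contDiff_slice {Φ : ℝ → ℂ → ℂ} (hΦ : ContDiff ℝ ∞ fun p : ℝ × ℂ => Φ p.1 p.2) (t : ℝ) :
    ContDiff ℝ ∞ (Φ t) :=
  hΦ.comp (contDiff_const.prodMk contDiff_id)

namespace PlanarWeb

variable {n : ℕ} {V B A : Type*}

theorem loop_contDiff (Γ : PlanarWeb n V B A) (a : A) : ContDiff ℝ ∞ (Γ.loop a) := by
  refine (Γ.annulus_smooth a).comp (contDiff_const.mul (ContDiff.cexp ?_))
  exact (contDiff_const.mul Complex.ofRealCLM.contDiff).mul contDiff_const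

theorem loop_add_one (Γ : PlanarWeb n V B A) (a : A) (t : ℝ) : Γ.loop a (t + 1) = Γ.loop a t := by
  simp only [loop]
  congr 2
  rw [show 2 * (Real.pi : ℂ) * ((t + 1 : ℝ) : ℂ) * Complex.I =
    2 * Real.pi * t * Complex.I + 2 * Real.pi * Complex.I by push_cast; ring,
    Complex.exp_add, Complex.exp_two_pi_mul_I, mul_one]

theorem circle_mem_stdAnnulus {ρ : ℝ} (h1 : 1 ≤ ρ) (h2 : ρ ≤ 2) (t : ℝ) :
    (ρ : ℂ) * Complex.exp (2 * Real.pi * t * Complex.I) ∈ stdAnnulus := by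
  have h : ‖(ρ : ℂ) * Complex.exp (2 * Real.pi * t * Complex.I)‖ = ρ := by
    rw [norm_mul, show 2 * (Real.pi : ℂ) * t * Complex.I = ((2 * Real.pi * t : ℝ) : ℂ) * Complex.I by
      push_cast; ring, Complex.norm_exp_ofReal_mul_I, Complex.norm_real,
      Real.norm_of_nonneg (by linarith), mul_one]
  exact ⟨h1.trans h.ge, h.le.trans h2⟩

/-- An annulus is oriented anti-clockwise if the argument increases by `2π` along its directed core
circle, as seen from some point. -/
theorem isAnticlockwise_iff (Γ : PlanarWeb n V B A) (a : A) : Γ.IsAnticlockwise a ↔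
    ∃ w : ℂ, w ∉ Set.range (Γ.loop a) ∧
      logVar (fun t => Γ.loop a t - w) 0 1 = 2 * Real.pi * Complex.I := by
  refine exists_congr fun w => and_congr_right fun hw => ?_
  have h1 : ContDiff ℝ 1 fun t => Γ.loop a t - w :=
    ((Γ.loop_contDiff a).of_le (by exact_mod_cast le_top)).sub contDiff_const
  have h2 := integral_logDeriv_eq_logVar zero_le_one h1
    fun t _ h => hw ⟨t, sub_eq_zero.1 h⟩
  simp only [deriv_sub_const] at h2
  rw [h2, inv_mul_eq_iff_eq_mul₀ Complex.two_pi_I_ne_zero, mul_one]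

theorem band_mid_injective (Γ : PlanarWeb n V B A) {c : ℝ} (hc : c = 0 ∨ c = 1) {b b' : B}
    (h : Γ.band b (1 / 2, c) = Γ.band b' (1 / 2, c)) : b = b' := by
  by_contra hne
  have hhalf : (1 / 2 : ℝ) ∈ Set.Icc (0 : ℝ) 1 := by constructor <;> norm_num
  rcases hc with rfl | rfl
  · exact Set.disjoint_left.1 (Γ.ends_disjoint (i := Sum.inl b) (j := Sum.inl b') (by simpa using hne))
      ⟨(1 / 2, _), ⟨hhalf, Set.mem_singleton _⟩, rfl⟩ ⟨(1 / 2, _), ⟨hhalf, Set.mem_singleton _⟩, h.symm⟩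
  · exact Set.disjoint_left.1 (Γ.ends_disjoint (i := Sum.inr b) (j := Sum.inr b') (by simpa using hne))
      ⟨(1 / 2, _), ⟨hhalf, Set.mem_singleton _⟩, rfl⟩ ⟨(1 / 2, _), ⟨hhalf, Set.mem_singleton _⟩, h.symm⟩

/-- The numbering of the bands at a disc is determined by their positions. -/
theorem bandAt_eq_of_angles {d : ℂ → ℂ} (hd : Set.InjOn d (Metric.closedBall 0 1))
    {ψ : B → ℂ} {f f' : Fin n → B}
    (hψ : ∀ b b', ψ b = ψ b' → b = b') (hr : Set.range f = Set.range f')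
    {θ θ' : Fin n → ℝ} (hθ : ∀ i, θ i ∈ Set.Ioo 0 (2 * Real.pi))
    (hθ' : ∀ i, θ' i ∈ Set.Ioo 0 (2 * Real.pi))
    (hm : StrictMono θ ∧ StrictMono θ' ∨ StrictAnti θ ∧ StrictAnti θ')
    (h : ∀ i, d (Complex.exp (θ i * Complex.I)) = ψ (f i))
    (h' : ∀ i, d (Complex.exp (θ' i * Complex.I)) = ψ (f' i)) : f = f' := by
  have hsub : ∀ {θ θ' : Fin n → ℝ} {f f' : Fin n → B},
      (∀ i, θ i ∈ Set.Ioo 0 (2 * Real.pi)) → (∀ i, θ' i ∈ Set.Ioo 0 (2 * Real.pi)) →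
      (∀ i, d (Complex.exp (θ i * Complex.I)) = ψ (f i)) →
      (∀ i, d (Complex.exp (θ' i * Complex.I)) = ψ (f' i)) → Set.range f ⊆ Set.range f' →
      Set.range θ ⊆ Set.range θ' := by
    rintro θ θ' f f' hθ hθ' h h' hr _ ⟨i, rfl⟩
    obtain ⟨j, hj⟩ := hr ⟨i, rfl⟩
    exact ⟨j, exp_angle_inj (hθ' j) (hθ i)
      (hd (exp_angle_mem _) (exp_angle_mem _) (by rw [h, h', hj]))⟩
  -- Both lists of angles describe the same set of attaching points, and a strictly monotone list is
  -- determined by its range.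
  have hrange : Set.range θ = Set.range θ' :=
    (hsub hθ hθ' h h' hr.le).antisymm (hsub hθ' hθ h' h hr.ge)
  have heq : θ = θ' := by
    rcases hm with ⟨h1, h2⟩ | ⟨h1, h2⟩
    · exact (StrictMono.range_inj h1 h2).1 hrange
    · have h3 : (fun i => -θ i) = fun i => -θ' i := by
        refine (StrictMono.range_inj h1.neg h2.neg).1 ?_
        have e : ∀ θ : Fin n → ℝ, Set.range (fun i => -θ i) = Neg.neg '' Set.range θ := fun θ =>
          Set.range_comp Neg.neg θ
        rw [e, e, hrange]
      funext i
      exact neg_injective (congrFun h3 i)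
  funext i
  exact hψ _ _ (by rw [← h, ← h', heq])

/-- `IsIsotopic` does not mention the numbering. It is forced, because the parametrizations of discs
and bands correspond under `Φ 1`: both lists of angles locate the same points on the boundary of the
original disc. -/
theorem IsIsotopic.bandAt_eq {Γ Γ₀ : PlanarWeb n V B A} (h : Γ.IsIsotopic Γ₀) (v : V) :
    Γ₀.bandAt v = Γ.bandAt v := by
  obtain ⟨Φ, -, hbij, -, hsource, hsrc, htgt, hdisc, hband, -⟩ := h
  have hΦ := (hbij 1 (by simp)).1.1
  have hhalf : (1 / 2 : ℝ) ∈ Set.Icc (0 : ℝ) 1 := by constructor <;> norm_num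
  by_cases hv : Γ.isSource v
  · have hv₀ := (hsource v).2 hv
    obtain ⟨θ, hm, hθ, he⟩ := Γ.source_order v hv
    obtain ⟨θ₀, hm₀, hθ₀, he₀⟩ := Γ₀.source_order v hv₀
    have hb : ∀ b, Γ₀.band b (1 / 2, 0) = Φ 1 (Γ.band b (1 / 2, 0)) := fun b =>
      hband b ⟨hhalf, by simp⟩
    have hr : Set.range (Γ₀.bandAt v) = Set.range (Γ.bandAt v) := by
      ext b
      rw [← Γ₀.source_valence v hv₀, ← Γ.source_valence v hv, hsrc]
    refine bandAt_eq_of_angles (Γ.disc_injOn v) (ψ := fun b => Γ.band b (1 / 2, 0))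
      (fun b b' h => Γ.band_mid_injective (Or.inl rfl) h) hr hθ₀ hθ (Or.inl ⟨hm₀, hm⟩)
      (fun i => hΦ ?_) he
    rw [← hb, ← he₀]
    exact (hdisc v (exp_angle_mem _)).symm
  · have hv₀ : ¬ Γ₀.isSource v := fun h => hv ((hsource v).1 h)
    obtain ⟨θ, hm, hθ, he⟩ := Γ.sink_order v hv
    obtain ⟨θ₀, hm₀, hθ₀, he₀⟩ := Γ₀.sink_order v hv₀
    have hb : ∀ b, Γ₀.band b (1 / 2, 1) = Φ 1 (Γ.band b (1 / 2, 1)) := fun b =>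
      hband b ⟨hhalf, by simp⟩
    have hr : Set.range (Γ₀.bandAt v) = Set.range (Γ.bandAt v) := by
      ext b
      rw [← Γ₀.sink_valence v hv₀, ← Γ.sink_valence v hv, htgt]
    refine bandAt_eq_of_angles (Γ.disc_injOn v) (ψ := fun b => Γ.band b (1 / 2, 1))
      (fun b b' h => Γ.band_mid_injective (Or.inr rfl) h) hr hθ₀ hθ (Or.inr ⟨hm₀, hm⟩)
      (fun i => hΦ ?_) he
    rw [← hb, ← he₀]
    exact (hdisc v (exp_angle_mem _)).symm

/-- The image of a core under an isotopy. -/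
theorem IsIsotopic.exists_core [Fintype B] {Γ Γ₀ : PlanarWeb n V B A} (h : Γ.IsIsotopic Γ₀)
    (C : Γ.Core) : ∃ C₀ : Γ₀.Core, ∀ S : Γ.State,
      ∑ b, C₀.ind b * labelWeight (S.label (Sum.inl b)) =
        ∑ b, C.ind b * labelWeight (S.label (Sum.inl b)) := by
  obtain ⟨Φ, hΦs, hbij, hΦ0, -, hsrc, htgt, hdisc, hband, -⟩ := h
  have hΦ := (hbij 1 (by simp)).1.1
  have hdet := fun z => (hbij 1 (by simp)).2 z
  have h1mem : (1 : ℂ) ∈ Metric.closedBall (0 : ℂ) 1 := by simp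
  have h0I : (0 : ℝ) ∈ Set.Icc (0 : ℝ) 1 := by simp
  have h1I : (1 : ℝ) ∈ Set.Icc (0 : ℝ) 1 := by simp
  have hαd : ∀ b s, HasDerivAt (C.arc b) (deriv (C.arc b) s) s := fun b s =>
    (((C.smooth b).differentiable (by simp)) s).hasDerivAt
  have hαc : ∀ b, Continuous (deriv (C.arc b)) := fun b => (C.contDiff_deriv b).continuous
  have hd : ∀ t b s, deriv (fun s => Φ t (C.arc b s)) s =
      fderiv ℝ (Φ t) (C.arc b s) (deriv (C.arc b) s) := fun t b s =>
    ((((contDiff_slice hΦs t).differentiable (by simp)) _).hasFDerivAt.comp_hasDerivAt s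
      (hαd b s)).deriv
  have hd1 : ∀ b s, deriv (Φ 1 ∘ C.arc b) s =
      fderiv ℝ (Φ 1) (C.arc b s) (deriv (C.arc b) s) := hd 1
  have hDim : ∀ v, Γ₀.disc v '' Metric.closedBall 0 1 = Φ 1 '' (Γ.disc v '' Metric.closedBall 0 1) :=
    fun v => by rw [← Set.image_comp]; exact Set.image_congr (hdisc v)
  have hBim : ∀ b, Γ₀.band b '' (Set.Icc 0 1 ×ˢ Set.Icc 0 1) =
      Φ 1 '' (Γ.band b '' (Set.Icc 0 1 ×ˢ Set.Icc 0 1)) :=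
    fun b => by rw [← Set.image_comp]; exact Set.image_congr (hband b)
  have hs0 : ∀ b b', Γ.src b = Γ.src b' → C.arc b 0 = C.arc b' 0 := fun b b' h => by
    rw [C.start, C.start, h]
  have ht1 : ∀ b b', Γ.tgt b = Γ.tgt b' → C.arc b 1 = C.arc b' 1 := fun b b' h => by
    rw [C.finish, C.finish, h]
  let C₀ : Γ₀.Core :=
    { arc := fun b => Φ 1 ∘ C.arc b
      smooth := fun b => (contDiff_slice hΦs 1).comp (C.smooth b)
      immersion := fun b s hs => by
        rw [hd1]; exact fderiv_apply_ne_zero (hdet _) (C.immersion b s hs)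
      injOn := fun b => hΦ.comp_injOn (C.injOn b)
      start := fun b => by
        rw [hsrc, hdisc _ h1mem, Function.comp_apply, Function.comp_apply, C.start]
      finish := fun b => by
        rw [htgt, hdisc _ h1mem, Function.comp_apply, Function.comp_apply, C.finish]
      mem := fun b s hs => by
        rw [hsrc, htgt, hDim, hDim, hBim, ← Set.image_union, ← Set.image_union]
        exact Set.mem_image_of_mem _ (C.mem b s hs)
      disjoint := fun b b' hb s hs t ht h => C.disjoint b b' hb s hs t ht (hΦ h)
      tangent_src := fun b b' h => by
        rw [hsrc] at h
        rw [hd1, hd1, hs0 b b' h]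
        exact (C.tangent_src b b' h).map (fderiv ℝ (Φ 1) (C.arc b' 0) : ℂ →ₗ[ℝ] ℂ)
      tangent_tgt := fun b b' h => by
        rw [htgt] at h
        rw [hd1, hd1, ht1 b b' h]
        exact (C.tangent_tgt b b' h).map (fderiv ℝ (Φ 1) (C.arc b' 1) : ℂ →ₗ[ℝ] ℂ) }
  -- The rotation of a tangent vector during the isotopy depends only on its ray, hence only on the
  -- disc.
  have hray : ∀ (p u w : ℂ), u ≠ 0 → w ≠ 0 → SameRay ℝ u w →
      (logVar (fun t => fderiv ℝ (Φ t) p u) 0 1).im =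
        (logVar (fun t => fderiv ℝ (Φ t) p w) 0 1).im := by
    intro p u w hu hw h
    obtain ⟨r, hr, rfl⟩ := h.exists_pos_left hu hw
    have := logVar_smul_im (f := fun t => fderiv ℝ (Φ t) p u) (ρ := fun _ => r) zero_le_one
      (continuous_fderiv_family hΦs continuous_id continuous_const continuous_const).continuousOn
      (fun t ht => fderiv_apply_ne_zero ((hbij t ht).2 _) hu) continuousOn_const fun _ _ => hr
    rw [← this]
    congr 3
    ext t
    rw [map_smul, Complex.real_smul]
  refine ⟨C₀, fun S => S.sum_eq_of_sub_eq
    (x := fun b => (logVar (fun t => fderiv ℝ (Φ t) (C.arc b 0) (deriv (C.arc b) 0)) 0 1).im /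
      (2 * Real.pi))
    (y := fun b => (logVar (fun t => fderiv ℝ (Φ t) (C.arc b 1) (deriv (C.arc b) 1)) 0 1).im /
      (2 * Real.pi)) ?_ ?_ ?_⟩
  · intro b b' h
    rw [hs0 b b' h, hray _ _ _ (C.immersion b 0 h0I) (C.immersion b' 0 h0I) (C.tangent_src b b' h)]
  · intro b b' h
    rw [ht1 b b' h, hray _ _ _ (C.immersion b 1 h1I) (C.immersion b' 1 h1I) (C.tangent_tgt b b' h)]
  · intro b
    -- In this square of isotopy time and arc time, two opposite sides carry the turnings of the old
    -- and the new arc, and the other two carry the rotations of the end tangents.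
    have hsq := logVar_square (f := fun t s => fderiv ℝ (Φ t) (C.arc b s) (deriv (C.arc b) s))
      (zero_le_one (α := ℝ)) (zero_le_one (α := ℝ))
      (continuous_fderiv_family hΦs continuous_fst ((C.smooth b).continuous.comp continuous_snd)
        ((hαc b).comp continuous_snd)).continuousOn
      fun t ht s hs => fderiv_apply_ne_zero ((hbij t ht).2 _) (C.immersion b s hs)
    have hΦ0' : Φ 0 = id := funext hΦ0
    have e0 : (fun s => fderiv ℝ (Φ 0) (C.arc b s) (deriv (C.arc b) s)) = deriv (C.arc b) := by
      funext s; rw [hΦ0', fderiv_id]; rfl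
    have e1 : (fun s => fderiv ℝ (Φ 1) (C.arc b s) (deriv (C.arc b) s)) = deriv (C₀.arc b) :=
      funext fun s => (hd1 b s).symm
    rw [e0, e1] at hsq
    have him := congrArg Complex.im hsq
    simp only [Complex.add_im] at him
    rw [C₀.ind_eq, C.ind_eq]
    rw [div_sub_div_same, div_sub_div_same]
    congr 1
    linarith

/-- Isotopies preserve the direction of the annuli. -/
theorem IsIsotopic.isAnticlockwise_iff {Γ Γ₀ : PlanarWeb n V B A} (h : Γ.IsIsotopic Γ₀) (a : A) :
    Γ₀.IsAnticlockwise a ↔ Γ.IsAnticlockwise a := by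
  obtain ⟨Φ, hΦs, hbij, hΦ0, -, -, -, -, -, hann⟩ := h
  have hloop : ∀ t, Γ₀.loop a t = Φ 1 (Γ.loop a t) := fun t => by
    refine hann a ?_
    have := circle_mem_stdAnnulus (ρ := 3 / 2) (by norm_num) (by norm_num) t
    push_cast at this
    exact this
  -- The base point moves along with the isotopy, and injectivity of `Φ u` keeps it off the moving
  -- loop.
  have key : ∀ w, w ∉ Set.range (Γ.loop a) →
      logVar (fun t => Γ₀.loop a t - Φ 1 w) 0 1 = logVar (fun t => Γ.loop a t - w) 0 1 := by
    intro w hw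
    have := logVar_homotopy (f := fun u t => Φ u (Γ.loop a t) - Φ u w) (zero_le_one (α := ℝ))
      (by
        refine Continuous.continuousOn (Continuous.sub ?_ ?_)
        · exact hΦs.continuous.comp (continuous_fst.prodMk
            ((Γ.loop_contDiff a).continuous.comp continuous_snd))
        · exact hΦs.continuous.comp (continuous_fst.prodMk continuous_const))
      (fun u hu t _ h => hw ⟨t, (hbij u hu).1.1 (sub_eq_zero.1 h)⟩)
      (fun u _ => by rw [← zero_add (1 : ℝ), Γ.loop_add_one])
    simp only [hΦ0, ← hloop] at this
    exact this.symm
  rw [PlanarWeb.isAnticlockwise_iff, PlanarWeb.isAnticlockwise_iff]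
  have hbij1 := (hbij 1 (by simp)).1
  have hr : ∀ w, Φ 1 w ∉ Set.range (Γ₀.loop a) ↔ w ∉ Set.range (Γ.loop a) := fun w =>
    not_congr ⟨fun ⟨t, ht⟩ => ⟨t, hbij1.1 (by rw [← hloop, ht])⟩,
      fun ⟨t, ht⟩ => ⟨t, by rw [hloop, ht]⟩⟩
  constructor
  · rintro ⟨w₀, hw₀, h⟩
    obtain ⟨w, rfl⟩ := hbij1.2 w₀
    exact ⟨w, (hr w).1 hw₀, by rw [← key w ((hr w).1 hw₀)]; exact h⟩
  · rintro ⟨w, hw, h⟩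
    exact ⟨Φ 1 w, (hr w).2 hw, by rw [key w hw]; exact h⟩

end PlanarWeb

/-! ### The direction of an embedded annulus -/

/-- The variation of the argument along a closed curve does not change when the base point moves
off the curve. -/
theorem logVar_sub_const_eq_of_path {γ : ℝ → ℂ} (hγ : Continuous γ) (hp : γ 1 = γ 0) {w : ℝ → ℂ}
    (hw : ContinuousOn w (Set.Icc 0 1)) (h : ∀ u ∈ Set.Icc (0 : ℝ) 1, w u ∉ Set.range γ) :
    logVar (fun t => γ t - w 0) 0 1 = logVar (fun t => γ t - w 1) 0 1 := by
  refine logVar_homotopy (f := fun u t => γ t - w u) (zero_le_one (α := ℝ)) ?_ ?_ ?_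
  · exact (hγ.comp continuous_snd).continuousOn.sub
      (hw.comp continuous_fst.continuousOn fun p hp => hp.1)
  · exact fun u hu t _ h0 => h u hu ⟨t, sub_eq_zero.1 h0⟩
  · exact fun u _ => by rw [hp]

/-- A closed curve does not wind around points which are far away. -/
theorem exists_logVar_sub_const_eq_zero {γ : ℝ → ℂ} (hγ : Continuous γ)
    (hp : ∀ t, γ (t + 1) = γ t) :
    ∃ w, w ∉ Set.range γ ∧ logVar (fun t => γ t - w) 0 1 = 0 := by
  have hper : Function.Periodic γ 1 := hp
  have hb : Bornology.IsBounded (Set.range γ) := by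
    have hcomp := hper.compact_of_continuous one_ne_zero hγ
    exact hcomp.isBounded
  obtain ⟨R, hR⟩ := hb.exists_norm_le
  have hre : ∀ t, (γ t).re ≤ R := fun t => (Complex.re_le_norm _).trans (hR _ ⟨t, rfl⟩)
  -- The point `R + 1` lies to the right of the whole curve, so the differences stay in the left
  -- half plane.
  have hslit : ∀ t, (γ t - ((R + 1 : ℝ) : ℂ)) / (-1) ∈ Complex.slitPlane := fun t => by
    left
    rw [div_neg, div_one, Complex.neg_re, Complex.sub_re, Complex.ofReal_re]
    linarith [hre t]
  refine ⟨((R + 1 : ℝ) : ℂ), ?_, ?_⟩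
  · rintro ⟨t, ht⟩
    have := hre t
    rw [ht, Complex.ofReal_re] at this
    linarith
  · have hp1 : γ 1 = γ 0 := by simpa using hp 0
    rw [logVar_of_slitPlane zero_le_one (c := -1) (by norm_num) (by fun_prop) fun t _ => hslit t,
      hp1, sub_self]

/-- The point of the plane which an annulus `Ψ` assigns to polar coordinates. -/
noncomputable def polarMap (Ψ : ℂ → ℂ) (ρ t : ℝ) : ℂ :=
  Ψ (ρ * Complex.exp (2 * Real.pi * t * Complex.I))

theorem exp_two_pi_add_one (t : ℝ) : Complex.exp (2 * Real.pi * ((t + 1 : ℝ) : ℂ) * Complex.I) =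
    Complex.exp (2 * Real.pi * t * Complex.I) := by
  rw [show 2 * (Real.pi : ℂ) * ((t + 1 : ℝ) : ℂ) * Complex.I =
    2 * Real.pi * t * Complex.I + 2 * Real.pi * Complex.I by push_cast; ring,
    Complex.exp_add, Complex.exp_two_pi_mul_I, mul_one]

theorem norm_exp_two_pi (t : ℝ) : ‖Complex.exp (2 * Real.pi * t * Complex.I)‖ = 1 := by
  rw [show 2 * (Real.pi : ℂ) * t * Complex.I = ((2 * Real.pi * t : ℝ) : ℂ) * Complex.I by
      push_cast; ring, Complex.norm_exp_ofReal_mul_I]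

section polarMap

variable {Ψ : ℂ → ℂ}

theorem polarMap_add_one (Ψ : ℂ → ℂ) (ρ t : ℝ) : polarMap Ψ ρ (t + 1) = polarMap Ψ ρ t := by
  simp only [polarMap, exp_two_pi_add_one]

theorem polarMap_one (Ψ : ℂ → ℂ) (ρ : ℝ) : polarMap Ψ ρ 1 = polarMap Ψ ρ 0 := by
  simpa using polarMap_add_one Ψ ρ 0

theorem continuous_polarMap (hΨ : Continuous Ψ) :
    Continuous fun p : ℝ × ℝ => polarMap Ψ p.1 p.2 :=
  hΨ.comp (by fun_prop)

theorem polarMap_ne (hinj : Set.InjOn Ψ stdAnnulus) {ρ ρ' : ℝ} (h1 : 1 ≤ ρ) (h2 : ρ ≤ 2)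
    (h1' : 1 ≤ ρ') (h2' : ρ' ≤ 2) (hne : ρ ≠ ρ') (s t : ℝ) : polarMap Ψ ρ s ≠ polarMap Ψ ρ' t := by
  intro h
  have := congrArg norm (hinj (PlanarWeb.circle_mem_stdAnnulus h1 h2 s)
    (PlanarWeb.circle_mem_stdAnnulus h1' h2' t) h)
  rw [norm_mul, norm_mul, norm_exp_two_pi, norm_exp_two_pi, Complex.norm_real, Complex.norm_real,
    Real.norm_of_nonneg (by linarith), Real.norm_of_nonneg (by linarith)] at this
  exact hne (by linarith)

theorem exists_polarMap_eq (Ψ : ℂ → ℂ) (z : ℂ) : ∃ t, Ψ z = polarMap Ψ ‖z‖ t := by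
  refine ⟨z.arg / (2 * Real.pi), ?_⟩
  have h : 2 * (Real.pi : ℂ) * ((z.arg / (2 * Real.pi) : ℝ) : ℂ) * Complex.I = z.arg * Complex.I := by
    have : (Real.pi : ℂ) ≠ 0 := by exact_mod_cast Real.pi_ne_zero
    push_cast
    field_simp
  rw [polarMap, h, Complex.norm_mul_exp_arg_mul_I]

theorem polarMap_injOn (hinj : Set.InjOn Ψ stdAnnulus) {ρ : ℝ} (h1 : 1 ≤ ρ) (h2 : ρ ≤ 2) :
    Set.InjOn (polarMap Ψ ρ) (Set.Ico 0 1) := by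
  intro s hs t ht h
  have h3 := hinj (PlanarWeb.circle_mem_stdAnnulus h1 h2 s)
    (PlanarWeb.circle_mem_stdAnnulus h1 h2 t) h
  have hρ : (ρ : ℂ) ≠ 0 := by exact_mod_cast (by linarith : (0 : ℝ) < ρ).ne'
  obtain ⟨k, hk⟩ := Complex.exp_eq_exp_iff_exists_int.1 (mul_left_cancel₀ hρ h3)
  have h4 : (s : ℂ) = t + k := by
    apply mul_right_cancel₀ Complex.two_pi_I_ne_zero
    linear_combination hk
  have h5 : s = t + k := by exact_mod_cast h4
  have h6 : (k : ℝ) < 1 := by linarith [hs.2, ht.1]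
  have h7 : (-1 : ℝ) < k := by linarith [hs.1, ht.2]
  have h8 : k < 1 := by exact_mod_cast h6
  have h9 : -1 < k := by exact_mod_cast h7
  have : k = 0 := by omega
  rw [h5, this]; simp

theorem hasDerivAt_polarMap_radius (hΨ : Differentiable ℝ Ψ) (ρ t : ℝ) :
    HasDerivAt (fun ρ => polarMap Ψ ρ t)
      (fderiv ℝ Ψ (ρ * Complex.exp (2 * Real.pi * t * Complex.I))
        (Complex.exp (2 * Real.pi * t * Complex.I))) ρ := by
  have h1 : HasDerivAt (fun ρ : ℝ => (ρ : ℂ) * Complex.exp (2 * Real.pi * t * Complex.I))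
      (Complex.exp (2 * Real.pi * t * Complex.I)) ρ := by
    simpa using (Complex.ofRealCLM.hasDerivAt (x := ρ)).mul_const
      (Complex.exp (2 * Real.pi * t * Complex.I))
  exact (hΨ _).hasFDerivAt.comp_hasDerivAt ρ h1

theorem hasDerivAt_polarMap_angle (hΨ : Differentiable ℝ Ψ) (ρ t : ℝ) :
    HasDerivAt (polarMap Ψ ρ)
      (fderiv ℝ Ψ (ρ * Complex.exp (2 * Real.pi * t * Complex.I))
        (ρ * (Complex.exp (2 * Real.pi * t * Complex.I) * (2 * Real.pi * Complex.I)))) t := by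
  have h1 : HasDerivAt (fun t : ℝ => 2 * (Real.pi : ℂ) * t * Complex.I)
      (2 * Real.pi * Complex.I) t := by
    simpa using ((Complex.ofRealCLM.hasDerivAt (x := t)).const_mul
      (2 * (Real.pi : ℂ))).mul_const Complex.I
  exact (hΨ _).hasFDerivAt.comp_hasDerivAt t (h1.cexp.const_mul (ρ : ℂ))

/-- Every point off the core circle of an annulus can be joined to one of its two boundary circles,
hence the core circle winds around it as it does around a point of the boundary. -/
theorem logVar_sub_const_mem (hΨ : ContDiff ℝ 1 Ψ) (hinj : Set.InjOn Ψ stdAnnulus)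
    (himm : ∀ z ∈ stdAnnulus, Function.Injective (fderiv ℝ Ψ z)) {w : ℂ}
    (hw : w ∉ Set.range (polarMap Ψ (3 / 2))) :
    logVar (fun t => polarMap Ψ (3 / 2) t - w) 0 1 =
        logVar (fun t => polarMap Ψ (3 / 2) t - polarMap Ψ 1 0) 0 1 ∨
      logVar (fun t => polarMap Ψ (3 / 2) t - w) 0 1 =
        logVar (fun t => polarMap Ψ (3 / 2) t - polarMap Ψ 2 0) 0 1 := by
  have hcont := continuous_polarMap hΨ.continuous
  have hγ : Continuous (polarMap Ψ (3 / 2)) :=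
    hcont.comp (f := fun t : ℝ => ((3 / 2 : ℝ), t)) (by fun_prop)
  -- points of the annulus
  have move : ∀ ρ t ρ' : ℝ, (∀ u ∈ Set.Icc (0 : ℝ) 1, 1 ≤ ρ + u * (ρ' - ρ) ∧ ρ + u * (ρ' - ρ) ≤ 2 ∧
      ρ + u * (ρ' - ρ) ≠ 3 / 2) → logVar (fun s => polarMap Ψ (3 / 2) s - polarMap Ψ ρ t) 0 1 =
      logVar (fun s => polarMap Ψ (3 / 2) s - polarMap Ψ ρ' 0) 0 1 := by
    intro ρ t ρ' h
    have := logVar_sub_const_eq_of_path hγ (polarMap_one Ψ _)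
      (w := fun u => polarMap Ψ (ρ + u * (ρ' - ρ)) (t + u * (0 - t)))
      (hcont.comp (f := fun u : ℝ => (ρ + u * (ρ' - ρ), t + u * (0 - t)))
        (by fun_prop)).continuousOn
      (by
        rintro u hu ⟨s, hs⟩
        obtain ⟨h1, h2, h3⟩ := h u hu
        exact polarMap_ne hinj (by norm_num) (by norm_num) h1 h2 h3.symm _ _ hs)
    simpa using this
  have inner : ∀ z ∈ stdAnnulus, ‖z‖ ≠ 3 / 2 →
      logVar (fun t => polarMap Ψ (3 / 2) t - Ψ z) 0 1 =
        logVar (fun t => polarMap Ψ (3 / 2) t - polarMap Ψ 1 0) 0 1 ∨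
      logVar (fun t => polarMap Ψ (3 / 2) t - Ψ z) 0 1 =
        logVar (fun t => polarMap Ψ (3 / 2) t - polarMap Ψ 2 0) 0 1 := by
    intro z hz hne
    obtain ⟨t, ht⟩ := exists_polarMap_eq Ψ z
    have hz1 : 1 ≤ ‖z‖ := hz.1
    have hz2 : ‖z‖ ≤ 2 := hz.2
    rw [ht]
    rcases lt_or_gt_of_ne hne with h | h
    · left
      refine move _ _ _ fun u hu => ⟨?_, ?_, ne_of_lt ?_⟩ <;> nlinarith [hu.1, hu.2]
    · right
      refine move _ _ _ fun u hu => ⟨?_, ?_, ne_of_gt ?_⟩ <;> nlinarith [hu.1, hu.2]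
  have hrange : ∀ t, polarMap Ψ (3 / 2) t ∈ Ψ '' stdAnnulus := fun t =>
    ⟨_, PlanarWeb.circle_mem_stdAnnulus (by norm_num) (by norm_num) t, rfl⟩
  by_cases hwK : w ∈ Ψ '' stdAnnulus
  · obtain ⟨z, hz, rfl⟩ := hwK
    refine inner z hz fun h => hw ?_
    obtain ⟨t, ht⟩ := exists_polarMap_eq Ψ z
    exact ⟨t, by rw [ht, h]⟩
  -- points outside the annulus
  have hstdc : IsCompact stdAnnulus := by
    refine (isCompact_closedBall (0 : ℂ) 2).of_isClosed_subset ?_ fun z hz => by simpa using hz.2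
    exact (isClosed_le continuous_const continuous_norm).inter
      (isClosed_le continuous_norm continuous_const)
  have hKc : IsCompact (Ψ '' stdAnnulus) := hstdc.image hΨ.continuous
  -- The segment from `w` to a nearest point `y` of the annulus meets the annulus only at `y`, so
  -- the base point may be moved to `y`.
  obtain ⟨y, hyK, hy⟩ := hKc.exists_infDist_eq_dist ⟨_, hrange 0⟩ w
  have hdpos : 0 < dist w y := dist_pos.2 fun h => hwK (h ▸ hyK)
  have hseg : ∀ u : ℝ, 0 ≤ u → u < 1 → w + u * (y - w) ∉ Ψ '' stdAnnulus := by
    intro u hu0 hu1 hmem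
    have h1 := Metric.infDist_le_dist_of_mem (x := w) hmem
    rw [hy, Complex.dist_eq w (w + _), sub_add_cancel_left, norm_neg, norm_mul, Complex.norm_real,
      Real.norm_of_nonneg hu0, ← Complex.dist_eq, dist_comm y w] at h1
    nlinarith
  -- The core circle lies in the interior of the image, because an immersion of the plane is open
  -- there; a point approached from outside the annulus is not on it.
  have hyγ : y ∉ Set.range (polarMap Ψ (3 / 2)) := by
    rintro ⟨t, ht⟩
    set z : ℂ := ((3 / 2 : ℝ) : ℂ) * Complex.exp (2 * Real.pi * t * Complex.I) with hz
    have hzmem : z ∈ stdAnnulus := PlanarWeb.circle_mem_stdAnnulus (by norm_num) (by norm_num) t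
    have hznorm : ‖z‖ = 3 / 2 := by
      rw [hz, norm_mul, norm_exp_two_pi, Complex.norm_real]; norm_num
    have hnhds : stdAnnulus ∈ nhds z := by
      have : {z : ℂ | 1 < ‖z‖ ∧ ‖z‖ < 2} ∈ nhds z :=
        ((isOpen_lt continuous_const continuous_norm).inter
          (isOpen_lt continuous_norm continuous_const)).mem_nhds (by
            constructor <;> rw [Set.mem_ofPred_eq, hznorm] <;> norm_num)
      exact Filter.mem_of_superset this fun z hz => ⟨hz.1.le, hz.2.le⟩
    have hsurj : Function.Surjective (fderiv ℝ Ψ z) :=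
      (LinearMap.injective_iff_surjective (f := (fderiv ℝ Ψ z : ℂ →ₗ[ℝ] ℂ))).1 (himm z hzmem)
    have hmap := (hΨ.contDiffAt.hasStrictFDerivAt (x := z) one_ne_zero).map_nhds_eq_of_surj
      (LinearMap.range_eq_top.2 hsurj)
    have hKn : Ψ '' stdAnnulus ∈ nhds y := by
      rw [← ht]
      change _ ∈ nhds (Ψ z)
      rw [← hmap]
      exact Filter.image_mem_map hnhds
    have hlim : Filter.Tendsto (fun u : ℝ => w + u * (y - w)) (nhdsWithin 1 (Set.Iio 1)) (nhds y) := by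
      have h1 : Continuous fun u : ℝ => w + u * (y - w) := by fun_prop
      have h2 := (h1.tendsto 1).mono_left (nhdsWithin_le_nhds (s := Set.Iio 1))
      simpa using h2
    have hev := (hlim.eventually hKn).and (Ioo_mem_nhdsLT (zero_lt_one (α := ℝ)))
    obtain ⟨u, hu1, hu2⟩ := hev.exists
    exact hseg u hu2.1.le hu2.2 hu1
  have hpath := logVar_sub_const_eq_of_path hγ (polarMap_one Ψ _)
    (w := fun u => w + u * (y - w)) (by fun_prop) (by
      rintro u hu
      rcases hu.2.lt_or_eq with h | h
      · exact fun ⟨t, ht⟩ => hseg u hu.1 h (ht ▸ hrange t)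
      · subst h; simp [hyγ])
  simp only [Complex.ofReal_zero, zero_mul, add_zero, Complex.ofReal_one, one_mul,
    add_sub_cancel] at hpath
  rw [hpath]
  obtain ⟨z, hz, rfl⟩ := hyK
  refine inner z hz fun h => hyγ ?_
  obtain ⟨t, ht⟩ := exists_polarMap_eq Ψ z
  exact ⟨t, by rw [ht, h]⟩

/-- The turning of the core circle of an annulus is the sum of its windings around points of the two
boundary circles. -/
theorem logVar_deriv_polarMap (hΨ : ContDiff ℝ 1 Ψ) (hinj : Set.InjOn Ψ stdAnnulus)
    (himm : ∀ z ∈ stdAnnulus, Function.Injective (fderiv ℝ Ψ z)) :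
    logVar (deriv (polarMap Ψ (3 / 2))) 0 1 =
      logVar (fun t => polarMap Ψ (3 / 2) t - polarMap Ψ 1 0) 0 1 +
      logVar (fun t => polarMap Ψ (3 / 2) t - polarMap Ψ 2 0) 0 1 := by
  have hcont := continuous_polarMap hΨ.continuous
  have hdiff := hΨ.differentiable one_ne_zero
  have hc : ∀ {X : Type} [TopologicalSpace X] {ρ t : X → ℝ}, Continuous ρ → Continuous t →
      Continuous fun x => polarMap Ψ (ρ x) (t x) := fun hρ ht => hcont.comp (hρ.prodMk ht)
  set e : ℝ → ℂ := fun t => Complex.exp (2 * Real.pi * t * Complex.I) with he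
  have hec : Continuous e := by fun_prop
  have he1 : e 1 = e 0 := by simp [he]
  have he0 : ∀ t, e t ≠ 0 := fun t => Complex.exp_ne_zero _
  have hfd : Continuous fun p : ℂ × ℂ => fderiv ℝ Ψ p.1 p.2 :=
    ((hΨ.continuous_fderiv one_ne_zero).comp continuous_fst).clm_apply continuous_snd
  have hfd0 : ∀ t (v : ℂ), v ≠ 0 → fderiv ℝ Ψ (((3 / 2 : ℝ) : ℂ) * e t) v ≠ 0 := fun t v hv h => by
    have h1 := himm _ (PlanarWeb.circle_mem_stdAnnulus (ρ := 3 / 2) (by norm_num) (by norm_num) t)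
    exact hv (h1 (h.trans (map_zero _).symm))
  -- the torus
  have hdiag : logVar (fun x => polarMap Ψ (3 / 2) x - polarMap Ψ 1 x) 0 1 =
      logVar (fun x => polarMap Ψ (3 / 2) x - polarMap Ψ 1 0) 0 1 +
        logVar (fun y => polarMap Ψ (3 / 2) 1 - polarMap Ψ 1 y) 0 1 := by
    -- The two angles vary independently without the difference vanishing, so a logarithm on the
    -- plane of angles compares the diagonal with a path along two sides.
    have hz : ((0, 0) : ℝ × ℝ) ∈ (Set.univ : Set (ℝ × ℝ)) := trivial
    obtain ⟨H, hH⟩ := exists_isLogOn_of_starConvex (convex_univ.starConvex hz) hz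
      (f := fun p : ℝ × ℝ => polarMap Ψ (3 / 2) p.1 - polarMap Ψ 1 p.2)
      ((hc continuous_const continuous_fst).sub (hc continuous_const continuous_snd)).continuousOn
      fun p _ => sub_ne_zero.2 (polarMap_ne hinj (by norm_num) (by norm_num) (by norm_num)
        (by norm_num) (by norm_num) _ _)
    have key : ∀ φ : ℝ → ℝ × ℝ, Continuous φ →
        logVar (fun t => polarMap Ψ (3 / 2) (φ t).1 - polarMap Ψ 1 (φ t).2) 0 1 =
          H (φ 1) - H (φ 0) := fun φ hφ =>
      (hH.comp (u := Set.Icc 0 1) hφ.continuousOn fun _ _ => trivial).logVar_eq zero_le_one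
    have e1 := key (fun t => (t, t)) (by fun_prop)
    have e2 := key (fun t => (t, 0)) (by fun_prop)
    have e3 := key (fun t => (1, t)) (by fun_prop)
    simp only at e1 e2 e3
    rw [e1, e2, e3]; ring
  -- Both radii are increased by `u / 2`, from `(3/2, 1)` to `(2, 3/2)`. They never coincide, and at
  -- the end the moving point runs on the core circle while the fixed one is on the outer circle.
  have hsecond : logVar (fun y => polarMap Ψ (3 / 2) 1 - polarMap Ψ 1 y) 0 1 =
      logVar (fun t => polarMap Ψ (3 / 2) t - polarMap Ψ 2 0) 0 1 := by
    have h1 := logVar_homotopy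
      (f := fun u y => polarMap Ψ (3 / 2 + u / 2) 0 - polarMap Ψ (1 + u / 2) y)
      (zero_le_one (α := ℝ))
      ((hc (by fun_prop) continuous_const).sub (hc (by fun_prop) continuous_snd)).continuousOn
      (fun u hu y _ => sub_ne_zero.2 (polarMap_ne hinj (by linarith [hu.1]) (by linarith [hu.2])
        (by linarith [hu.1]) (by linarith [hu.2]) (by intro h; linarith) _ _))
      (fun u _ => by rw [polarMap_one])
    have h2 := logVar_neg (f := fun y => polarMap Ψ (3 / 2) y - polarMap Ψ 2 0) zero_le_one
      ((hc continuous_const continuous_id).sub continuous_const).continuousOn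
      (fun y _ => sub_ne_zero.2 (polarMap_ne hinj (by norm_num) (by norm_num)
        (by norm_num) (by norm_num) (by norm_num) _ _))
    simp only [neg_sub] at h2
    have n1 : (3 / 2 + 0 / 2 : ℝ) = 3 / 2 := by norm_num
    have n2 : (1 + 0 / 2 : ℝ) = 1 := by norm_num
    have n3 : (3 / 2 + 1 / 2 : ℝ) = 2 := by norm_num
    have n4 : (1 + 1 / 2 : ℝ) = 3 / 2 := by norm_num
    simp only [n1, n2, n3, n4] at h1
    rw [polarMap_one, h1, h2]
  -- from the difference of two concentric circles to the radial derivative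
  have hdr : ∀ x ρ, deriv (fun ρ => polarMap Ψ ρ x) ρ = fderiv ℝ Ψ (ρ * e x) (e x) := fun x ρ =>
    (hasDerivAt_polarMap_radius hdiff ρ x).deriv
  have hcd : ∀ x, ContDiff ℝ 1 fun ρ => polarMap Ψ ρ x := fun x =>
    hΨ.comp (Complex.ofRealCLM.contDiff.mul contDiff_const)
  have hradial : logVar (fun x => fderiv ℝ Ψ (((3 / 2 : ℝ) : ℂ) * e x) (e x)) 0 1 =
      logVar (fun x => polarMap Ψ (3 / 2) x - polarMap Ψ 1 x) 0 1 := by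
    -- The radial secant is the derivative at `u = 0` and twice the difference of the two concentric
    -- points at `u = 1`.
    have h1 := logVar_homotopy
      (f := fun u x => secant (fun ρ => polarMap Ψ ρ x) (3 / 2) (3 / 2 - u / 2))
      (zero_le_one (α := ℝ))
      (by
        refine Continuous.continuousOn ?_
        simp only [secant, hdr]
        refine intervalIntegral.continuous_parametric_intervalIntegral_of_continuous' ?_ 0 1
        exact hfd.comp (Continuous.prodMk (by fun_prop) (by fun_prop)))
      (by
        intro u hu x _
        rcases hu.1.eq_or_lt with h | h
        · rw [← h, zero_div, sub_zero, secant_self, hdr]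
          exact hfd0 x _ (he0 x)
        · exact secant_ne_zero (hcd x) (polarMap_ne hinj (by norm_num) (by norm_num)
            (by linarith [hu.2]) (by linarith) (by intro h; linarith) _ _))
      (fun u _ => by simp only [secant, hdr, he1])
    simp only [zero_div, sub_zero, secant_self, hdr] at h1
    rw [h1]
    have h2 : ∀ x, secant (fun ρ => polarMap Ψ ρ x) (3 / 2) (3 / 2 - 1 / 2) =
        2 * (polarMap Ψ (3 / 2) x - polarMap Ψ 1 x) := by
      intro x
      have n1 : (3 / 2 - 1 / 2 : ℝ) = 1 := by norm_num
      have := mul_secant (hcd x) (3 / 2) 1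
      rw [n1]
      push_cast at this
      linear_combination (-2) * this
    simp only [h2]
    exact logVar_const_mul zero_le_one
      ((hc continuous_const continuous_id).sub (hc continuous_const continuous_id)).continuousOn
      (fun x _ => sub_ne_zero.2 (polarMap_ne hinj (by norm_num) (by norm_num)
        (by norm_num) (by norm_num) (by norm_num) _ _)) two_ne_zero
  -- from the radial derivative to the tangent
  have htangent : logVar (fun x => fderiv ℝ Ψ (((3 / 2 : ℝ) : ℂ) * e x) (e x)) 0 1 =
      logVar (deriv (polarMap Ψ (3 / 2))) 0 1 := by
    have hda : deriv (polarMap Ψ (3 / 2)) = fun x => fderiv ℝ Ψ (((3 / 2 : ℝ) : ℂ) * e x)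
        (((3 / 2 : ℝ) : ℂ) * (e x * (2 * Real.pi * Complex.I))) := funext fun x =>
      (hasDerivAt_polarMap_angle hdiff (3 / 2) x).deriv
    -- The radial direction is deformed through nonzero vectors to the tangential one: `(1 - u) +
    -- 3πui` never vanishes, and `3π = (3/2) · 2π` is the speed on the core circle.
    have h1 := logVar_homotopy
      (f := fun u x => fderiv ℝ Ψ (((3 / 2 : ℝ) : ℂ) * e x)
        (e x * (((1 - u : ℝ) : ℂ) + ((3 * Real.pi * u : ℝ) : ℂ) * Complex.I)))
      (zero_le_one (α := ℝ))
      (hfd.comp (Continuous.prodMk (by fun_prop) (by fun_prop))).continuousOn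
      (by
        intro u _ x _
        refine hfd0 x _ (mul_ne_zero (he0 x) fun h => ?_)
        have hre := congrArg Complex.re h
        have him := congrArg Complex.im h
        simp only [Complex.add_re, Complex.ofReal_re, Complex.re_ofReal_mul, Complex.I_re,
          Complex.add_im, Complex.ofReal_im, Complex.im_ofReal_mul, Complex.I_im, Complex.zero_re,
          Complex.zero_im, mul_zero, add_zero, mul_one, zero_add] at hre him
        have : u = 1 := by linarith
        rw [this, mul_one] at him
        linarith [Real.pi_pos])
      (fun u _ => by simp only [he1])
    rw [hda]
    have h2 : ∀ x, e x * (((1 - 1 : ℝ) : ℂ) + ((3 * Real.pi * 1 : ℝ) : ℂ) * Complex.I) =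
        ((3 / 2 : ℝ) : ℂ) * (e x * (2 * Real.pi * Complex.I)) := fun x => by push_cast; ring
    have h3 : ∀ x, e x * (((1 - 0 : ℝ) : ℂ) + ((3 * Real.pi * 0 : ℝ) : ℂ) * Complex.I) = e x :=
      fun x => by push_cast; ring
    simp only [h2, h3] at h1
    exact h1
  rw [← htangent, hradial, hdiag, hsecond]

end polarMap

namespace PlanarWeb

variable {n : ℕ} {V B A : Type*}

theorem loop_eq_polarMap (Γ : PlanarWeb n V B A) (a : A) :
    Γ.loop a = polarMap (Γ.annulus a) (3 / 2) := by
  funext t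
  simp only [loop, polarMap]
  push_cast
  rfl

theorem deriv_loop_ne_zero (Γ : PlanarWeb n V B A) (a : A) (t : ℝ) :
    deriv (Γ.loop a) t ≠ 0 := by
  have hΨ : ContDiff ℝ 1 (Γ.annulus a) := (Γ.annulus_smooth a).of_le (by exact_mod_cast le_top)
  rw [Γ.loop_eq_polarMap, (hasDerivAt_polarMap_angle (hΨ.differentiable one_ne_zero) _ t).deriv]
  intro h
  have h1 := Γ.annulus_immersion a _ (circle_mem_stdAnnulus (ρ := 3 / 2) (by norm_num) (by norm_num) t)
    (h.trans (map_zero _).symm)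
  have h2 : ((3 / 2 : ℝ) : ℂ) ≠ 0 := by norm_num
  exact mul_ne_zero h2 (mul_ne_zero (Complex.exp_ne_zero _) Complex.two_pi_I_ne_zero) h1

/-- The turning of the core circle of an annulus is given by its index. -/
theorem logVar_deriv_loop (Γ : PlanarWeb n V B A) (a : A) :
    logVar (deriv (Γ.loop a)) 0 1 = 2 * Real.pi * Complex.I * Γ.annulusInd a := by
  have hΨ : ContDiff ℝ 1 (Γ.annulus a) := (Γ.annulus_smooth a).of_le (by exact_mod_cast le_top)
  have hinj := Γ.annulus_injOn a
  have himm := Γ.annulus_immersion a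
  have hloop := Γ.loop_eq_polarMap a
  have hd0 := Γ.deriv_loop_ne_zero a
  have hτ := logVar_deriv_of_simple_closed ((Γ.loop_contDiff a).of_le (by exact_mod_cast le_top))
    (Γ.loop_add_one a) (hloop ▸ polarMap_injOn hinj (by norm_num) (by norm_num)) hd0
  have hsum := logVar_deriv_polarMap hΨ hinj himm
  have hmem := fun w hw => logVar_sub_const_mem hΨ hinj himm (w := w) hw
  obtain ⟨w₀, hw₀, hzero⟩ := exists_logVar_sub_const_eq_zero (Γ.loop_contDiff a).continuous
    (Γ.loop_add_one a)
  have hiff := Γ.isAnticlockwise_iff a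
  rw [hloop] at hτ hzero hw₀ hiff ⊢
  -- A far away point has winding `0`, so one of the two boundary windings is `0` and the other is
  -- the whole turning.
  have hc := hmem w₀ hw₀
  rw [hzero] at hc
  have h1 : polarMap (Γ.annulus a) 1 0 ∉ Set.range (polarMap (Γ.annulus a) (3 / 2)) :=
    fun ⟨t, ht⟩ => polarMap_ne hinj (by norm_num) (by norm_num) (by norm_num) (by norm_num)
      (by norm_num) _ _ ht
  have h2 : polarMap (Γ.annulus a) 2 0 ∉ Set.range (polarMap (Γ.annulus a) (3 / 2)) :=
    fun ⟨t, ht⟩ => polarMap_ne hinj (by norm_num) (by norm_num) (by norm_num) (by norm_num)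
      (by norm_num) _ _ ht
  have h2pi := Complex.two_pi_I_ne_zero
  rcases hτ with hτ | hτ
  · have : Γ.IsAnticlockwise a := by
      rw [hiff]
      rcases hc with hc | hc
      · exact ⟨_, h2, by rw [← hτ, hsum, ← hc, zero_add]⟩
      · exact ⟨_, h1, by rw [← hτ, hsum, ← hc, add_zero]⟩
    rw [hτ, annulusInd, if_pos this]; simp
  -- When the turning is `-2πi`, the only possible variations are `0` and `-2πi`, so no point is
  -- encircled positively.
  · have : ¬ Γ.IsAnticlockwise a := by
      rw [hiff]
      rintro ⟨w, hw, h⟩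
      have hm := hmem w hw
      rw [h] at hm
      rw [hτ] at hsum
      have h4 : (4 : ℂ) * (Real.pi * Complex.I) ≠ 0 := by
        intro h; apply h2pi; linear_combination h / 2
      rcases hc with hc | hc <;> rcases hm with hm | hm
      · exact h2pi (hm.trans hc.symm)
      · exact h4 (by linear_combination hm - hsum + hc)
      · exact h4 (by linear_combination hm - hsum + hc)
      · exact h2pi (hm.trans hc.symm)
    rw [hτ, annulusInd, if_neg this]; simp

end PlanarWeb

/-! ### Annuli in a decomposition, transport of states, and the conclusion. -/

namespace PlanarWeb

variable {n : ℕ} {V B A : Type*}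

/-- Over a full period the tangents at both ends agree, so the turning is exactly `2πi` times the
count of left caps minus left cups, wherever the annulus is first cut. -/
theorem Decomposition.pieceTurn_annulus {Γ : PlanarWeb n V B A} (D : Γ.Decomposition) (a : A) :
    (pieceTurn (D.annulusPieces a) : ℝ) = Γ.annulusInd a := by
  have hγ : ContDiff ℝ 1 (Γ.loop a) := (Γ.loop_contDiff a).of_le (by exact_mod_cast le_top)
  have hper : ∀ t, deriv (Γ.loop a) (t + 1) = deriv (Γ.loop a) t := fun t => by
    rw [← deriv_comp_add_const]; simp only [Γ.loop_add_one]
  have hd0 := Γ.deriv_loop_ne_zero a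
  have h1 := ((D.annulus_cut a).logVar_deriv hγ (hd0 _)).2
  rw [logVar_periodic (hγ.continuous_deriv le_rfl) hd0 hper, Γ.logVar_deriv_loop, hper, sub_self,
    zero_add] at h1
  have h2 := mul_left_cancel₀ Complex.two_pi_I_ne_zero h1
  exact_mod_cast h2.symm

theorem IsIsotopic.annulusInd_eq {Γ Γ₀ : PlanarWeb n V B A} (h : Γ.IsIsotopic Γ₀) (a : A) :
    Γ₀.annulusInd a = Γ.annulusInd a := by
  unfold annulusInd
  rw [propext (h.isAnticlockwise_iff a)]

/-- The states of isotopic webs correspond to each other. -/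
def IsIsotopic.stateEquiv {Γ Γ₀ : PlanarWeb n V B A} (h : Γ.IsIsotopic Γ₀) : Γ.State ≃ Γ₀.State :=
  Equiv.subtypeEquivRight fun S => by simp only [h.bandAt_eq]

theorem IsIsotopic.label_stateEquiv {Γ Γ₀ : PlanarWeb n V B A} (h : Γ.IsIsotopic Γ₀) (S : Γ.State)
    (e : B ⊕ A) : (h.stateEquiv S).label e = S.label e := rfl

theorem IsIsotopic.perm_stateEquiv {Γ Γ₀ : PlanarWeb n V B A} (h : Γ.IsIsotopic Γ₀) (S : Γ.State)
    (v : V) : (h.stateEquiv S).perm v = S.perm v := by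
  ext i
  simp only [State.perm, Equiv.ofBijective_apply, h.label_stateEquiv, h.bandAt_eq]

end PlanarWeb

theorem mainTheorem4 {n : ℕ} (hn : 1 ≤ n) {V B A : Type*} [Fintype V] [Fintype B] [Fintype A]
    (Γ : PlanarWeb n V B A) (C : Γ.Core) (x : LaurentPolynomial ℤ) (hx : Γ.IsBracket x) :
    ∃ r : Γ.State → ℤ, (∀ S, (r S : ℝ) = C.rot S) ∧
      x = ∑ S : Γ.State, qpow n (r S) * ∏ v : V, (-qpow n 1) ^ permLength (S.perm v) := by
  obtain ⟨Γ₀, hiso, D, rfl⟩ := hx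
  -- The exponent is an integer because it is read off from a count of caps and cups.
  refine ⟨fun S => ∑ b, pieceTurn (D.bandPieces b) * labelWeight (S.label (Sum.inl b)) +
    ∑ a, pieceTurn (D.annulusPieces a) * labelWeight (S.label (Sum.inr a)), fun S => ?_, ?_⟩
  -- The image of `C` and the core of the decomposition are two cores of the same web `Γ₀`, so
  -- independence of the core links them.
  · obtain ⟨C₀, hC₀⟩ := hiso.exists_core C
    have h1 := C₀.sum_ind_eq D.core (hiso.stateEquiv S)
    have h2 := D.sum_ind (hiso.stateEquiv S)
    simp only [hiso.label_stateEquiv] at h1 h2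
    rw [PlanarWeb.Core.rot, ← hC₀ S, h1, h2]
    push_cast
    simp only [D.pieceTurn_annulus, hiso.annulusInd_eq]
  · rw [D.contraction_eq_sum, ← hiso.stateEquiv.sum_comp]
    simp only [hiso.label_stateEquiv, hiso.perm_stateEquiv]
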